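/- **Setting.** Let $q\in\mathbf C$, $|q|>1$, $\sigma_qf(z)=f(qz)$, $[x;q]=xq^{\mathbf Z}$, $\theta(z)=\sum_{n\in\mathbf Z}q^{-n(n+1)/2}z^n$, and for an integer $\delta\ge 1$ write $\theta(z)^\delta=\sum_{n\in\mathbf Z}t_nz^n$. Let $\mu\in\mathbf Z$, $\nu=\mu+\delta$, let $A\in GL_r(\mathbf C)$, $B\in GL_s(\mathbf C)$ be block-diagonal, with blocks $A_\alpha$, $B_\beta$ having the only eigenvalue $\alpha$, resp. $\beta$. For $U=\sum_{k<\delta}U_kz^k\in \mathrm{Mat}_{r,s}(\mathbf C[z])$ put $$M_0=\begin{pmatrix}z^\mu A&0\\0&z^\nu B\end{pmatrix},\qquad M=M_U=\begin{pmatrix}z^\mu A&z^\mu UB\\0&z^\nu B\end{pmatrix}.$$ *Summation and alien derivations.* Call $c\in\mathbf C^*$ prohibited if $q^{\mathbf Z}c^\mu\,\mathrm{Sp}(A)\cap q^{\mathbf Z}c^\nu\,\mathrm{Sp}(B)\ne\emptyset$. For $c$ not prohibited there is exactly one block-unipotent matrix $S_c\hat F=\begin{pmatrix}I&F_c\\0&I\end{pmatrix}$,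 meromorphic on $\mathbf C^*$, with poles only on $[-c;q]$, of order at most $\delta$, such that $\sigma_q(S_c\hat F)\,M_0=M\,S_c\hat F$. Fix a basepoint $a\in\mathbf C^*$ such that $-a$ is not prohibited, and a non-prohibited $c_0\in\mathbf C^*$ with $a\notin[-c_0;q]$. Then $LS_{c,a}(M)=\log\bigl((S_{c_0}\hat F(a))^{-1}S_c\hat F(a)\bigr)$ is a meromorphic function of $c$ near every $\xi\in\mathbf C^*$ with $a\notin[-\xi;q]$; its residue (that of $LS_{c,a}(M)\,dc$) at $c=\xi$ is the $q$-alien derivation $\dot\Delta_\xi(M)$, and $\dot\Delta^{(\delta)}_\xi(M)\in\mathrm{Mat}_{r,s}(\mathbf C)$ is its upper right block. *The $q$-Borel invariant.* Choose a map $x\mapsto x^{1/\delta}$ on $\mathbf C^*$ with $(x^{1/\delta})^\delta=x$. Let $A^{1/\delta}$ be the block-diagonal matrix with blocks $\alpha^{1/\delta}(\alpha^{-1}A_\alpha)^{1/\delta}$, the root of the unipotent factor being given by the binomial series; similarly for $B^{1/\delta}$. Let $L(X)=A^{1/\delta}X(B^{1/\delta})^{-1}$ on $\mathrm{Mat}_{r,s}(\mathbf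 C)$, and let $L_{\alpha,\beta}$ be its $(\alpha,\beta)$ component. Let $\mu_\delta$ be the set of $\delta$-th roots of $1$ in $\mathbf C$. The $q$-Borel invariant of $U$ is $\bigl(\mathcal B_q^{(\delta)}U(jL)\bigr)_{j\in\mu_\delta}\in\mathrm{Mat}_{r,s}(\mathbf C)^{\mu_\delta}$, where $\mathcal B_q^{(\delta)}U(jL)=\sum_{k<\delta}t_{-k}\,(jL)^kU_k$. For $j\in\mu_\delta$ write $\xi=j\alpha^{1/\delta}/\beta^{1/\delta}$ for the only eigenvalue of $L_{\xi\alpha,\beta}:=jL_{\alpha,\beta}$; thus $\xi$ runs through the $\delta$-th roots of $\alpha/\beta$. Let $\bigoplus_\xi\dot\Delta^{(\delta)}_\xi(M)\in\mathrm{Mat}_{r,s}(\mathbf C)^{\mu_\delta}$ be the family whose $(\alpha,\beta)$ component at $j$ is the $(\alpha,\beta)$ component of $\dot\Delta^{(\delta)}_\xi(M)$, for this $\xi$. **Theorem.** (0) The sums $S_c\hat F$ exist and are unique, and $LS_{c,a}(M)$ is meromorphic in $c$, as said above. (1) There is a linear automorphism $\Phi_a$ of $\mathrm{Mat}_{r,s}(\mathbf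 C)^{\mu_\delta}$ which, on the $(\alpha,\beta)$ component at $j$, is left multiplication by $$\theta^{-\delta}\bigl(a\,L_{\xi\alpha,\beta}^{-1}\bigr)\,\bigl(\delta L_{\xi\alpha,\beta}^{\delta-1}\bigr)^{-1},$$ the first factor being the function $c\mapsto\theta(a/c)^{-\delta}$ applied to $L_{\xi\alpha,\beta}$ by holomorphic functional calculus. For every $U$ it sends the $q$-Borel invariant to the alien-derivation invariant: $$\Phi_a\Bigl(\bigl(\mathcal B_q^{(\delta)}U(jL)\bigr)_{j\in\mu_\delta}\Bigr)=\bigoplus_\xi\dot\Delta^{(\delta)}_\xi(M_U).$$ (2) The $q$-alien derivations are a complete set of analytic invariants within the formal class of $M_0$, for gauge transformations $\begin{pmatrix}I&F\\0&I\end{pmatrix}$ with $F\in\mathrm{Mat}_{r,s}(\mathbf C(\{z\}))$. That is: every $\begin{pmatrix}z^\mu A&W\\0&z^\nu B\end{pmatrix}$ with $W\in\mathrm{Mat}_{r,s}(\mathbf C(\{z\}))$ is equivalent to some $M_U$ with $\deg U<\delta$; and $M_U$, $M_{U'}$ are equivalent if and only if $\dot\Delta_\xi(M_U)=\dot\Delta_\xi(M_{U'})$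 for all prohibited $\xi\in\mathbf C^*$. If moreover $t_{-k}\neq0$ for $0\le k<\delta$, then $M_U$, $M_{U'}$ are equivalent if and only if $\bigoplus_\xi\dot\Delta^{(\delta)}_\xi(M_U)=\bigoplus_\xi\dot\Delta^{(\delta)}_\xi(M_{U'})$. -/

import Mathlib

open Filter Topology

noncomputable section

namespace QAlien

/-! ### Theta function, Laurent coefficients of its powers, `q`-spirals -/

/-- `θ(z) = ∑_{n ∈ ℤ} q^{-n(n+1)/2} z^n` (the exponent is an integer: `n(n+1)` is even). -/
def theta (q z : ℂ) : ℂ := ∑' n : ℤ, q ^ (-(n * (n + 1) / 2)) * z ^ n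

/-- The coefficients `t_n` of the Laurent expansion `θ(z)^δ = ∑_{n ∈ ℤ} t_n z^n` on `ℂ^*`,
computed as iterated Cauchy products of the series of `θ`. -/
def thetaPowCoeff (q : ℂ) : ℕ → ℤ → ℂ
  | 0, n => if n = 0 then 1 else 0
  | δ + 1, n => ∑' m : ℤ, thetaPowCoeff q δ (n - m) * q ^ (-(m * (m + 1) / 2))

/-- The discrete `q`-spiral `[x;q] = x q^ℤ`. -/
def spiral (q x : ℂ) : Set ℂ := {z | ∃ n : ℤ, z = x * q ^ n}

/-! ### Residues, logarithm of a unipotent matrix, holomorphic functional calculus -/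

/-- The residue of `f(c) dc` at `c = ξ`: the value of `(2πi)⁻¹ ∮_{|c - ξ| = ε} f(c) dc` for small
`ε > 0`. -/
def residue (f : ℂ → ℂ) (ξ : ℂ) : ℂ :=
  limUnder (𝓝[>] (0 : ℝ)) fun ε => (2 * Real.pi * Complex.I)⁻¹ * ∮ c in C(ξ, ε), f c

/-- Entrywise residue of a matrix-valued function. -/
def matResidue {m n : Type*} (f : ℂ → Matrix m n ℂ) (ξ : ℂ) : Matrix m n ℂ :=
  Matrix.of fun i j => residue (fun c => f c i j) ξ

/-- `log P = ∑_{k ≥ 1} (-1)^{k-1} (P - 1)^k / k` for a unipotent matrix `P`; the terms with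
`k` larger than the size of `P` vanish. -/
def unipotentLog {m : Type*} [Fintype m] [DecidableEq m] (P : Matrix m m ℂ) : Matrix m m ℂ :=
  ∑ k ∈ Finset.range (Fintype.card m), ((-1 : ℂ) ^ k / (k + 1)) • (P - 1) ^ (k + 1)

/-- Holomorphic functional calculus for an endomorphism `T` of the space of `m × n` matrices:
`f(T) X = (2πi)⁻¹ ∮ f(c) (c - T)⁻¹ X dc`, the contour being made of small circles around the
eigenvalues of `T`, in a neighbourhood of which `f` is holomorphic. -/
def holoCalc {m n : Type*} (f : ℂ → ℂ) (T : Module.End ℂ (Matrix m n ℂ)) (X : Matrix m n ℂ) :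
    Matrix m n ℂ :=
  ∑ᶠ lam ∈ spectrum ℂ T, matResidue (fun c => f c • (resolvent T c) X) lam

/-! ### Roots of matrices and the operator `L` -/

/-- The root `A^{1/δ} = A_s^{1/δ} A_u^{1/δ}` of a square matrix `A` whose only eigenvalue is
`x ≠ 0`, where `ρ` is the chosen map `y ↦ y^{1/δ}`. Here `A_s = x I` and `A_u = x⁻¹ A` are the
factors of the multiplicative Dunford decomposition, and `A_u^{1/δ}` is given by the (finite)
binomial series in the nilpotent matrix `A_u - I`. -/
def unipRoot (δ : ℕ) (ρ : ℂ → ℂ) (x : ℂ) {k : ℕ} (A : Matrix (Fin k) (Fin k) ℂ) :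
    Matrix (Fin k) (Fin k) ℂ :=
  ρ x • ∑ l ∈ Finset.range k, Ring.choose (1 / (δ : ℂ)) l • (x⁻¹ • A - 1) ^ l

/-- The endomorphism `X ↦ R X S⁻¹` of the space of `m × n` matrices. -/
def conjOp {m n : Type*} [Fintype m] [Fintype n] [DecidableEq n]
    (R : Matrix m m ℂ) (S : Matrix n n ℂ) : Module.End ℂ (Matrix m n ℂ) where
  toFun X := R * X * S⁻¹
  map_add' X Y := by rw [Matrix.mul_add, Matrix.add_mul]
  map_smul' a X := by simp

/-! ### One-level `q`-difference modules, summation, alien derivations -/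

section OneLevel

variable {m n : Type*}

/-- The polynomial matrix `U(z) = ∑_{k < δ} U_k z^k`, of degree `< δ`, with given coefficients. -/
def polyEval {δ : ℕ} (U : Fin δ → Matrix m n ℂ) (z : ℂ) : Matrix m n ℂ :=
  ∑ k : Fin δ, z ^ (k : ℕ) • U k

/-- The upper block-triangular matrix with diagonal blocks `z^μ A`, `z^{μ+δ} B` and upper right
block `W(z)`. -/
def triMat (δ : ℕ) (μ : ℤ) (A : Matrix m m ℂ) (B : Matrix n n ℂ) (W : ℂ → Matrix m n ℂ) (z : ℂ) :
    Matrix (m ⊕ n) (m ⊕ n) ℂ :=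
  Matrix.fromBlocks (z ^ μ • A) (W z) 0 (z ^ (μ + δ) • B)

/-- The graded module `M₀ = diag(z^μ A, z^ν B)`, `ν = μ + δ`. -/
def gradedMat (δ : ℕ) (μ : ℤ) (A : Matrix m m ℂ) (B : Matrix n n ℂ) :
    ℂ → Matrix (m ⊕ n) (m ⊕ n) ℂ :=
  triMat δ μ A B fun _ => 0

/-- The module `M` with diagonal blocks `z^μ A`, `z^ν B`, `ν = μ + δ`, and upper right block
`z^μ U(z) B`. -/
def modMat [Fintype n] (δ : ℕ) (μ : ℤ) (A : Matrix m m ℂ) (B : Matrix n n ℂ)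
    (U : Fin δ → Matrix m n ℂ) : ℂ → Matrix (m ⊕ n) (m ⊕ n) ℂ :=
  triMat δ μ A B fun z => z ^ μ • (polyEval U z * B)

/-- The direction `c` is not prohibited:
`q^ℤ c^μ Sp(A) ∩ q^ℤ c^ν Sp(B) = ∅`, with `ν = μ + δ`. -/
def NonResonant [Fintype m] [DecidableEq m] [Fintype n] [DecidableEq n] (q : ℂ) (δ : ℕ) (μ : ℤ)
    (A : Matrix m m ℂ) (B : Matrix n n ℂ) (c : ℂ) : Prop :=
  ∀ x ∈ spectrum ℂ A, ∀ y ∈ spectrum ℂ B, ∀ k l : ℤ,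
    q ^ k * c ^ μ * x ≠ q ^ l * c ^ (μ + δ) * y

variable [Fintype m] [DecidableEq m] [Fintype n] [DecidableEq n]

/-- `F` is a summation of the formal gauge transformation from `M₀` to `M` in the direction `c`:
it is block-unipotent, meromorphic on `ℂ^*` with poles only on `[-c;q]` and of order at most `δ`
there, and `(σ_q F) M₀ = M F`. -/
structure IsSummation (q : ℂ) (δ : ℕ) (M₀ M : ℂ → Matrix (m ⊕ n) (m ⊕ n) ℂ) (c : ℂ)
    (F : ℂ → Matrix (m ⊕ n) (m ⊕ n) ℂ) : Prop where
  unipotent : ∀ z, F z = Matrix.fromBlocks 1 (F z).toBlocks₁₂ 0 1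
  analytic : ∀ z, z ≠ 0 → z ∉ spiral q (-c) → ∀ i j, AnalyticAt ℂ (fun w => F w i j) z
  polar : ∀ z ∈ spiral q (-c), ∀ i j, MeromorphicAt (fun w => F w i j) z ∧
    ((-(δ : ℤ) : ℤ) : WithTop ℤ) ≤ meromorphicOrderAt (fun w => F w i j) z
  gauge : ∀ z, z ≠ 0 → z ∉ spiral q (-c) → F (q * z) * M₀ z = M z * F z

/-- The sum `S_c F̂` of the formal gauge transformation in the direction `c`. Its values outside
`[-c;q]` are uniquely determined when `c` is not prohibited. -/
def qSum (q : ℂ) (δ : ℕ) (M₀ M : ℂ → Matrix (m ⊕ n) (m ⊕ n) ℂ) (c : ℂ) :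
    ℂ → Matrix (m ⊕ n) (m ⊕ n) ℂ :=
  Classical.epsilon (IsSummation q δ M₀ M c)

/-- `LS_{c,a} = log (S_{c₀,c} F̂ (a))`, where `S_{c₀,c} F̂ = (S_{c₀} F̂)⁻¹ S_c F̂` is the Stokes
operator. -/
def logStokes (q : ℂ) (δ : ℕ) (M₀ M : ℂ → Matrix (m ⊕ n) (m ⊕ n) ℂ) (c₀ a c : ℂ) :
    Matrix (m ⊕ n) (m ⊕ n) ℂ :=
  unipotentLog ((qSum q δ M₀ M c₀ a)⁻¹ * qSum q δ M₀ M c a)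

/-- The `q`-alien derivation at `ξ`: the residue of `LS_{c,a} dc` at `c = ξ`. -/
def alienDer (q : ℂ) (δ : ℕ) (M₀ M : ℂ → Matrix (m ⊕ n) (m ⊕ n) ℂ) (c₀ a ξ : ℂ) :
    Matrix (m ⊕ n) (m ⊕ n) ℂ :=
  matResidue (logStokes q δ M₀ M c₀ a) ξ

/-- The matrices `M`, `M'` are analytically equivalent within their formal class: there is a
block-unipotent `G = (1, F; 0, 1)`, with `F` a matrix of meromorphic germs at `0`, such that
`(σ_q G) M = M' G`. -/
def AnalyticEquiv (q : ℂ) (M M' : ℂ → Matrix (m ⊕ n) (m ⊕ n) ℂ) : Prop :=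
  ∃ F : ℂ → Matrix m n ℂ, (∀ i j, MeromorphicAt (fun z => F z i j) 0) ∧
    ∀ᶠ z in 𝓝[≠] (0 : ℂ),
      Matrix.fromBlocks 1 (F (q * z)) 0 1 * M z = M' z * Matrix.fromBlocks 1 (F z) 0 1

end OneLevel

/-! ### The `q`-Borel invariant and the alien-derivation invariant

`A` and `B` are block-diagonal; the blocks `A i` and `B j` have the unique eigenvalues `α i` and
`β j`. -/

section Invariants

/-- The coefficients of the `q`-Borel transform `∑ t_{-k} U_k ξ^k` of `U = ∑ U_k z^k`. -/
def qBorel {m n : Type*} (q : ℂ) {δ : ℕ} (U : Fin δ → Matrix m n ℂ) : Fin δ → Matrix m n ℂ :=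
  fun k => thetaPowCoeff q δ (-((k : ℕ) : ℤ)) • U k

/-- The value `V(T) = ∑ T^k V_k` of `V = ∑ V_k ξ^k` at an endomorphism `T`. -/
def evalOp {m n : Type*} {δ : ℕ} (V : Fin δ → Matrix m n ℂ) (T : Module.End ℂ (Matrix m n ℂ)) :
    Matrix m n ℂ :=
  ∑ k : Fin δ, (T ^ (k : ℕ)) (V k)

variable {ι κ : Type*} {r : ι → ℕ} {s : κ → ℕ}

/-- The `(i,j)` block of a block matrix. -/
def blk (X : Matrix (Σ i, Fin (r i)) (Σ j, Fin (s j)) ℂ) (i : ι) (j : κ) :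
    Matrix (Fin (r i)) (Fin (s j)) ℂ :=
  Matrix.of fun k l => X ⟨i, k⟩ ⟨j, l⟩

/-- The component `L_{i,j} : X ↦ A_i^{1/δ} X (B_j^{1/δ})⁻¹` of the operator `L`. -/
def Lcomp (δ : ℕ) (ρ : ℂ → ℂ) (α : ι → ℂ) (β : κ → ℂ)
    (A : ∀ i, Matrix (Fin (r i)) (Fin (r i)) ℂ) (B : ∀ j, Matrix (Fin (s j)) (Fin (s j)) ℂ)
    (i : ι) (j : κ) : Module.End ℂ (Matrix (Fin (r i)) (Fin (s j)) ℂ) :=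
  conjOp (unipRoot δ ρ (α i) (A i)) (unipRoot δ ρ (β j) (B j))

variable [Fintype ι] [DecidableEq ι] [Fintype κ] [DecidableEq κ]

/-- The operator `L : X ↦ A^{1/δ} X (B^{1/δ})⁻¹`. -/
def Lop (δ : ℕ) (ρ : ℂ → ℂ) (α : ι → ℂ) (β : κ → ℂ)
    (A : ∀ i, Matrix (Fin (r i)) (Fin (r i)) ℂ) (B : ∀ j, Matrix (Fin (s j)) (Fin (s j)) ℂ) :
    Module.End ℂ (Matrix (Σ i, Fin (r i)) (Σ j, Fin (s j)) ℂ) :=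
  conjOp (Matrix.blockDiagonal' fun i => unipRoot δ ρ (α i) (A i))
    (Matrix.blockDiagonal' fun j => unipRoot δ ρ (β j) (B j))

/-- The `q`-Borel invariant: the family of the values of the `q`-Borel transform of `U` at the
operators `ζ L`, where `ζ^δ = 1`. -/
def borelInvariant (q : ℂ) {δ : ℕ} (ρ : ℂ → ℂ) (α : ι → ℂ) (β : κ → ℂ)
    (A : ∀ i, Matrix (Fin (r i)) (Fin (r i)) ℂ) (B : ∀ j, Matrix (Fin (s j)) (Fin (s j)) ℂ)
    (U : Fin δ → Matrix (Σ i, Fin (r i)) (Σ j, Fin (s j)) ℂ) :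
    rootsOfUnity δ ℂ → Matrix (Σ i, Fin (r i)) (Σ j, Fin (s j)) ℂ :=
  fun ζ => evalOp (qBorel q U) (((ζ : ℂˣ) : ℂ) • Lop δ ρ α β A B)

/-- The eigenvalue `ξ = ζ (α_i)^{1/δ} / (β_j)^{1/δ}` of `ζ L_{i,j}`. When `ζ` runs through the
`δ`-th roots of unity, `ξ` runs through the `δ`-th roots of `α_i / β_j`. -/
def polePoint (δ : ℕ) (ρ : ℂ → ℂ) (α : ι → ℂ) (β : κ → ℂ) (ζ : rootsOfUnity δ ℂ) (i : ι) (j : κ) :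
    ℂ :=
  ((ζ : ℂˣ) : ℂ) * ρ (α i) / ρ (β j)

/-- The alien-derivation invariant: its `(i,j)` block at `ζ` is the `(i,j)` block of the upper
right (level `δ`) block of the alien derivation at the eigenvalue `ξ` of `ζ L_{i,j}`. -/
def alienInvariant (q : ℂ) {δ : ℕ} (μ : ℤ) (ρ : ℂ → ℂ) (α : ι → ℂ) (β : κ → ℂ)
    (A : ∀ i, Matrix (Fin (r i)) (Fin (r i)) ℂ) (B : ∀ j, Matrix (Fin (s j)) (Fin (s j)) ℂ)
    (c₀ a : ℂ) (U : Fin δ → Matrix (Σ i, Fin (r i)) (Σ j, Fin (s j)) ℂ) :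
    rootsOfUnity δ ℂ → Matrix (Σ i, Fin (r i)) (Σ j, Fin (s j)) ℂ :=
  fun ζ => Matrix.of fun x y =>
    (alienDer q δ (gradedMat δ μ (Matrix.blockDiagonal' A) (Matrix.blockDiagonal' B))
      (modMat δ μ (Matrix.blockDiagonal' A) (Matrix.blockDiagonal' B) U) c₀ a
      (polePoint δ ρ α β ζ x.1 y.1)).toBlocks₁₂ x y

/-- Left multiplication by `θ^{-δ}(a T⁻¹) (δ T^{δ-1})⁻¹`, the first factor being the holomorphic
function `c ↦ θ(a/c)^{-δ}` applied to `T`. -/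
def thetaMul {m n : Type*} (q : ℂ) (δ : ℕ) (a : ℂ) (T : Module.End ℂ (Matrix m n ℂ))
    (X : Matrix m n ℂ) : Matrix m n ℂ :=
  holoCalc (fun c => (theta q (a / c) ^ δ)⁻¹) T ((Ring.inverse ((δ : ℂ) • T ^ (δ - 1))) X)

end Invariants

end QAlien

end

open QAlien Filter Topology

open Filter Topology
namespace QAlien

/-! ### Laurent coefficients of holomorphic functions on the punctured plane -/

/-! Everything takes place in the upper right block. There the gauge equation becomes `z^δ f(qz) = T
f(z) + U(z)` with `T X = A X B⁻¹` (`gauge_triMat_iff`), and on each pair of blocks `T` is `τ = α/β`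
plus a nilpotent. Since `θ(qz) = z θ(z)`, the numerator `g = θ(z/c)^δ f` satisfies the equation with
constant coefficients `c^δ g(qz) = T g(z) + θ(z/c)^δ U(z)`. On Laurent coefficients this is `(c^δ
q^n - T) g_n = [θ(z/c)^δ U]_n`.

The direction `c` is not prohibited exactly when no `c^δ q^n` is an eigenvalue of `T`. The numbers
`c^δ q^n` then stay away from `τ` (`exists_gap`), the resolvents are uniformly bounded, and `g`
converges on the whole of `ℂ^*`. As `θ` has simple zeros, precisely on `[-1;q]`, solutions `f` with
poles of order at most `δ` on `[-c;q]` correspond to holomorphic `g`. The homogeneous equation for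
`g` has only the zero solution, so the sum is unique.

As a function of `c`, only one term of the series is singular at a prohibited `ξ`: the one with `ξ^δ
q^n = τ`. Let `L` be the root of `q^{-n} T` with eigenvalue `ξ`. Modulo functions regular at `ξ`,
`(c^δ - L^δ)⁻¹ ∑ c^k V_k` agrees with `(c - L)⁻¹ (δ L^{δ-1})⁻¹ ∑ L^k V_k`, because `c^δ - L^δ` is `c
- L` times a factor which becomes `δ L^{δ-1}` at `c = L`. So the residue is an invertible operator
applied to `∑ t_{n-k} L^k U_k` (`hasResidue_qSol`). For `n = 0` this sum is the `q`-Borel invariant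
and the operator is `Φ_a`.

For completeness, `M_U` and `M_{U'}` are equivalent only if `U = U'`: the Taylor coefficients of a
gauge transformation would satisfy `q^m f_m = T f_{m+δ}` in high degree, which is incompatible with
convergence unless they vanish (`normalForm_unique`). The same recurrence, solved by iterating it
towards infinity, yields the polynomial normal form. Finally the alien derivations determine `U`:
for fixed `n` the possible `L` differ by `δ`-th roots of unity, a Vandermonde argument isolates each
`t_{n-k} U_k`, and `n` can be chosen so that `t_{n-k} ≠ 0` (`alienDer_injective`). -/

theorem eqOn_zero_of_circleIntegral_zpow_mul_eq_zero {h : ℂ → ℂ} {R : ℝ} (hR : 0 < R)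
    (hc : ContinuousOn h (Metric.sphere 0 R))
    (h0 : ∀ n : ℤ, (∮ z in C(0, R), z ^ n * h z) = 0) :
    ∀ z ∈ Metric.sphere (0 : ℂ) R, h z = 0 := by
  have : Fact (0 < 2 * Real.pi) := ⟨Real.two_pi_pos⟩
  set f : ℝ → ℂ := fun t => h (circleMap 0 R t) with hf
  have hfc : Continuous f := by
    refine hc.comp_continuous (continuous_circleMap 0 R) fun t => ?_
    exact circleMap_mem_sphere 0 hR.le t
  have hper : Function.Periodic f (2 * Real.pi) := fun t => by
    simp only [hf, periodic_circleMap 0 R t]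
  let F : C(AddCircle (2 * Real.pi), ℂ) :=
    ⟨hper.lift, continuous_coinduced_dom.mpr hfc⟩
  have hF : ∀ t : ℝ, F t = f t := fun t => rfl
  have hcoef : fourierCoeff F = 0 := by
    funext n
    rw [fourierCoeff_eq_intervalIntegral _ n 0]
    -- The shift by one absorbs the factor `z` in `dz = i z dt`: this moment is, up to a nonzero
    -- constant, the `n`-th Fourier coefficient.
    have := h0 (-n - 1)
    simp only [circleIntegral, deriv_circleMap, smul_eq_mul] at this
    have h2 : ∀ t : ℝ, (circleMap 0 R t * Complex.I) * (circleMap 0 R t ^ (-n - 1) *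
        h (circleMap 0 R t)) = (Complex.I * (R : ℂ) ^ (-n)) * (fourier (-n) (t : AddCircle (2 * Real.pi)) • F t) := by
      intro t
      have hne : circleMap 0 R t ≠ 0 := by
        simpa using circleMap_ne_center (c := 0) (θ := t) hR.ne'
      rw [hF, fourier_coe_apply, zpow_sub_one₀ hne, smul_eq_mul]
      have : circleMap 0 R t ^ (-n) = (R : ℂ) ^ (-n) *
          Complex.exp (2 * Real.pi * Complex.I * ((-n : ℤ) : ℂ) * t / ((2 * Real.pi : ℝ) : ℂ)) := by
        rw [circleMap_zero, mul_zpow, ← Complex.exp_int_mul]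
        congr 2
        have : (Real.pi : ℂ) ≠ 0 := by exact_mod_cast Real.pi_ne_zero
        push_cast
        field_simp
      rw [this]
      field_simp
      simp [hf]
    simp only [h2] at this
    rw [intervalIntegral.integral_const_mul] at this
    have hne : Complex.I * (R : ℂ) ^ (-n) ≠ 0 :=
      mul_ne_zero Complex.I_ne_zero (zpow_ne_zero _ (by exact_mod_cast hR.ne'))
    have h3 := (mul_eq_zero.mp this).resolve_left hne
    simp only [zero_add, h3, smul_zero, Pi.zero_apply]
  intro z hz
  obtain ⟨t, rfl⟩ : z ∈ Set.range (circleMap 0 R) := by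
    rwa [range_circleMap, abs_of_pos hR]
  have h4 := has_pointwise_sum_fourier_series_of_summable (f := F)
    (by rw [hcoef]; exact summable_zero) (t : AddCircle (2 * Real.pi))
  rw [hcoef] at h4
  simp only [Pi.zero_apply, zero_smul] at h4
  exact (h4.unique hasSum_zero)

/-- The integral `∮ z^n g(z) dz` over the unit circle: up to `2πi`, a Laurent coefficient. -/
noncomputable def circleMoment (g : ℂ → ℂ) (n : ℤ) : ℂ := ∮ z in C(0, 1), z ^ n * g z

/-- Cauchy's theorem on the annulus between the two circles. -/
theorem circleIntegral_zpow_mul_eq {g : ℂ → ℂ} (hg : ∀ z ≠ 0, DifferentiableAt ℂ g z) (n : ℤ)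
    {R : ℝ} (hR : 0 < R) : (∮ z in C(0, R), z ^ n * g z) = circleMoment g n := by
  have key : ∀ r R : ℝ, 0 < r → r ≤ R →
      (∮ z in C(0, R), z ^ n * g z) = ∮ z in C(0, r), z ^ n * g z := by
    intro r R hr hrR
    have hd : ∀ z : ℂ, z ≠ 0 → DifferentiableAt ℂ (fun z => z ^ n * g z) z := fun z hz =>
      (differentiableAt_zpow.mpr (Or.inl hz)).mul (hg z hz)
    have hne : ∀ z : ℂ, z ∉ Metric.ball (0 : ℂ) r → z ≠ 0 := by
      rintro z hz rfl
      exact hz (Metric.mem_ball_self hr)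
    refine Complex.circleIntegral_eq_of_differentiable_on_annulus_off_countable hr hrR
      Set.countable_empty ?_ ?_
    · exact fun z hz => (hd z (hne z hz.2)).continuousAt.continuousWithinAt
    · intro z hz
      refine hd z (hne z fun h => hz.1.2 (Metric.ball_subset_closedBall h))
  rcases le_total 1 R with h | h
  · exact key 1 R one_pos h
  · exact (key R 1 hR h).symm

theorem eq_zero_of_circleMoment_eq_zero {g : ℂ → ℂ} (hg : ∀ z ≠ 0, DifferentiableAt ℂ g z)
    (h0 : ∀ n, circleMoment g n = 0) : ∀ z ≠ 0, g z = 0 := by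
  intro z hz
  have hR : 0 < ‖z‖ := norm_pos_iff.mpr hz
  refine eqOn_zero_of_circleIntegral_zpow_mul_eq_zero hR ?_ (fun n => ?_) z (by simp)
  · intro w hw
    refine (hg w ?_).continuousAt.continuousWithinAt
    rintro rfl
    simp at hw
    exact hz (norm_eq_zero.mp hw.symm)
  · rw [circleIntegral_zpow_mul_eq hg n hR, h0]

/-- The substitution `z ↦ qz` rotates the unit circle and dilates it to radius `|q|`. Periodicity in
the angle removes the rotation, independence of the radius removes the dilation, and `z^n dz`
contributes the power of `q`. -/
theorem circleMoment_comp_mul {g : ℂ → ℂ} (hg : ∀ z ≠ 0, DifferentiableAt ℂ g z) {q : ℂ}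
    (hq : q ≠ 0) (n : ℤ) :
    circleMoment (fun z => g (q * z)) n = q ^ (-n - 1) * circleMoment g n := by
  rw [← circleIntegral_zpow_mul_eq hg n (norm_pos_iff.mpr hq)]
  simp only [circleMoment, circleIntegral, deriv_circleMap, smul_eq_mul]
  have h1 : ∀ t : ℝ, q * circleMap 0 1 t = circleMap 0 ‖q‖ (t + q.arg) := by
    intro t
    conv_lhs => rw [← Complex.norm_mul_exp_arg_mul_I q]
    simp only [circleMap, zero_add, Complex.ofReal_one, one_mul, Complex.ofReal_add, add_mul,
      Complex.exp_add]
    ring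
  have h2 : ∀ t : ℝ, circleMap 0 1 t * Complex.I * (circleMap 0 1 t ^ n * g (q * circleMap 0 1 t)) =
      q ^ (-n - 1) * (fun t => circleMap 0 ‖q‖ t * Complex.I *
        (circleMap 0 ‖q‖ t ^ n * g (circleMap 0 ‖q‖ t))) (t + q.arg) := by
    intro t
    simp only [← h1, mul_zpow, zpow_sub₀ hq, zpow_neg, zpow_one]
    have := zpow_ne_zero n hq
    field_simp
  simp only [h2, intervalIntegral.integral_const_mul]
  congr 1
  rw [intervalIntegral.integral_comp_add_right (fun t => circleMap 0 ‖q‖ t * Complex.I *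
        (circleMap 0 ‖q‖ t ^ n * g (circleMap 0 ‖q‖ t)))]
  have hper : Function.Periodic (fun t => circleMap 0 ‖q‖ t * Complex.I *
        (circleMap 0 ‖q‖ t ^ n * g (circleMap 0 ‖q‖ t))) (2 * Real.pi) := fun t => by
    simp only [periodic_circleMap 0 ‖q‖ t]
  have := hper.intervalIntegral_add_eq q.arg 0
  simpa [add_comm] using this

theorem circleMoment_congr {g g' : ℂ → ℂ} (h : ∀ z ≠ 0, g z = g' z) (n : ℤ) :
    circleMoment g n = circleMoment g' n := by
  refine circleIntegral.integral_congr zero_le_one fun z hz => ?_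
  have : z ≠ 0 := by rintro rfl; simp at hz
  simp only [h z this]

theorem circleMoment_const_mul (a : ℂ) (g : ℂ → ℂ) (n : ℤ) :
    circleMoment (fun z => a * g z) n = a * circleMoment g n := by
  simp only [circleMoment, mul_left_comm _ a, circleIntegral.integral_const_mul]

theorem circleMoment_id_mul (g : ℂ → ℂ) (n : ℤ) :
    circleMoment (fun z => z * g z) n = circleMoment g (n + 1) := by
  refine circleIntegral.integral_congr zero_le_one fun z hz => ?_
  have : z ≠ 0 := by rintro rfl; simp at hz
  simp only [zpow_add_one₀ this]
  ring

theorem circleMoment_sub {g g' : ℂ → ℂ} (hg : ∀ z ≠ 0, DifferentiableAt ℂ g z)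
    (hg' : ∀ z ≠ 0, DifferentiableAt ℂ g' z) (n : ℤ) :
    circleMoment (fun z => g z - g' z) n = circleMoment g n - circleMoment g' n := by
  have hi : ∀ {g : ℂ → ℂ}, (∀ z ≠ 0, DifferentiableAt ℂ g z) →
      CircleIntegrable (fun z => z ^ n * g z) 0 1 := fun {g} hg => by
    refine ContinuousOn.circleIntegrable zero_le_one fun z hz => ?_
    have : z ≠ 0 := by rintro rfl; simp at hz
    exact ((differentiableAt_zpow.mpr (Or.inl this)).mul
      (hg z this)).continuousAt.continuousWithinAt
  simp only [circleMoment, mul_sub]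
  exact circleIntegral.integral_sub (hi hg) (hi hg')

/-- A holomorphic solution on the punctured plane of `g(qz) = w g(z)` vanishes unless `w` is a power
of `q`. -/
theorem eq_zero_of_comp_mul_eq_const_mul {q w : ℂ} (hq : q ≠ 0) (hw : ∀ n : ℤ, q ^ n ≠ w)
    {g : ℂ → ℂ} (hg : ∀ z ≠ 0, DifferentiableAt ℂ g z) (h : ∀ z ≠ 0, g (q * z) = w * g z) :
    ∀ z ≠ 0, g z = 0 := by
  refine eq_zero_of_circleMoment_eq_zero hg fun n => ?_
  have h1 := circleMoment_comp_mul hg hq n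
  rw [circleMoment_congr h, circleMoment_const_mul] at h1
  have h2 : (q ^ (-n - 1) - w) * circleMoment g n = 0 := by rw [sub_mul, h1, sub_self]
  exact (mul_eq_zero.mp h2).resolve_left (sub_ne_zero.mpr (hw _))

/-- A holomorphic solution on the punctured plane of `g(qz) = z g(z)` vanishes if its Laurent
coefficient of degree `0` does. -/
theorem eq_zero_of_comp_mul_eq_id_mul {q : ℂ} (hq : q ≠ 0) {g : ℂ → ℂ}
    (hg : ∀ z ≠ 0, DifferentiableAt ℂ g z) (h : ∀ z ≠ 0, g (q * z) = z * g z)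
    (h0 : circleMoment g 0 = 0) : ∀ z ≠ 0, g z = 0 := by
  have h1 : ∀ n, circleMoment g (n + 1) = q ^ (-n - 1) * circleMoment g n := fun n => by
    rw [← circleMoment_comp_mul hg hq n, circleMoment_congr h, circleMoment_id_mul]
  refine eq_zero_of_circleMoment_eq_zero hg fun n => ?_
  induction n with
  | zero => exact h0
  | succ n ih => rw [h1, ih, mul_zero]
  | pred n ih =>
    have := h1 (-(n : ℤ) - 1)
    rw [sub_add_cancel, ih] at this
    exact (mul_eq_zero.mp this.symm).resolve_left (zpow_ne_zero _ hq)

/-! ### Laurent series converging on the punctured plane -/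

section RapidlySummable

variable {E : Type*} [NormedAddCommGroup E]

/-- The Laurent series `∑ a_n z^n` converges absolutely on the punctured plane. -/
def RapidlySummable (a : ℤ → E) : Prop := ∀ ρ : ℝ, 0 < ρ → Summable fun n : ℤ => ‖a n‖ * ρ ^ n

theorem RapidlySummable.of_norm_le {F : Type*} [NormedAddCommGroup F] {a : ℤ → E} {b : ℤ → F}
    (ha : RapidlySummable a) (C : ℝ) (h : ∀ n, ‖b n‖ ≤ C * ‖a n‖) : RapidlySummable b := by
  intro ρ hρ
  refine Summable.of_nonneg_of_le (fun n => by positivity) (fun n => ?_) ((ha ρ hρ).mul_left C)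
  rw [← mul_assoc]
  exact mul_le_mul_of_nonneg_right (h n) (by positivity)

theorem RapidlySummable.comp_sub {a : ℤ → E} (ha : RapidlySummable a) (k : ℤ) :
    RapidlySummable fun n => a (n - k) := by
  intro ρ hρ
  have h1 := ((Equiv.subRight k).summable_iff.mpr (ha ρ hρ)).mul_right (ρ ^ k)
  refine h1.congr fun n => ?_
  simp only [Function.comp, Equiv.subRight_apply, mul_assoc, ← zpow_add₀ hρ.ne', sub_add_cancel]

variable [NormedSpace ℂ E]

theorem RapidlySummable.summable_norm {a : ℤ → E} (ha : RapidlySummable a) {z : ℂ} (hz : z ≠ 0) :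
    Summable fun n : ℤ => ‖z ^ n • a n‖ := by
  simpa [norm_smul, mul_comm] using ha ‖z‖ (norm_pos_iff.mpr hz)

theorem RapidlySummable.summable [CompleteSpace E] {a : ℤ → E} (ha : RapidlySummable a) {z : ℂ}
    (hz : z ≠ 0) : Summable fun n : ℤ => z ^ n • a n :=
  (ha.summable_norm hz).of_norm

theorem RapidlySummable.zpow_smul {a : ℤ → E} (ha : RapidlySummable a) {w : ℂ} (hw : w ≠ 0) :
    RapidlySummable fun n => w ^ n • a n := by
  intro ρ hρ
  refine (ha (‖w‖ * ρ) (by positivity)).congr fun n => ?_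
  rw [norm_smul, norm_zpow, mul_zpow]
  ring

theorem RapidlySummable.sum {F ι : Type*} [NormedAddCommGroup F] (s : Finset ι) {a : ι → ℤ → F}
    (ha : ∀ i ∈ s, RapidlySummable (a i)) : RapidlySummable fun n => ∑ i ∈ s, a i n := by
  intro ρ hρ
  refine Summable.of_nonneg_of_le (fun n => by positivity) (fun n => ?_)
    (summable_sum fun i hi => ha i hi ρ hρ)
  rw [← Finset.sum_mul]
  exact mul_le_mul_of_nonneg_right (norm_sum_le _ _) (by positivity)

/-- The sign of `n` decides which boundary radius dominates; adding both gives a majorant valid for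
all `n`, as needed for locally uniform convergence of Laurent series on an annulus. -/
theorem zpow_le_add {r R x : ℝ} (hr : 0 < r) (hrx : r ≤ x) (hxR : x ≤ R) (n : ℤ) :
    x ^ n ≤ r ^ n + R ^ n := by
  have hx : 0 < x := hr.trans_le hrx
  have hR : 0 < R := hx.trans_le hxR
  rcases le_total 0 n with h | h
  · have := zpow_le_zpow_left₀ h hx.le hxR
    have := zpow_pos hr n
    linarith
  · have h1 := zpow_le_zpow_left₀ (neg_nonneg.mpr h) hr.le hrx
    rw [zpow_neg, zpow_neg] at h1
    have h2 := (inv_le_inv₀ (zpow_pos hr n) (zpow_pos hx n)).mp h1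
    have := zpow_pos hR n
    linarith

theorem RapidlySummable.differentiableAt [CompleteSpace E] {a : ℤ → E} (ha : RapidlySummable a)
    {z : ℂ} (hz : z ≠ 0) : DifferentiableAt ℂ (fun z => ∑' n : ℤ, z ^ n • a n) z := by
  have hz' := norm_pos_iff.mpr hz
  set U : Set ℂ := {w | ‖z‖ / 2 < ‖w‖ ∧ ‖w‖ < 2 * ‖z‖} with hU
  have hUo : IsOpen U :=
    (isOpen_lt continuous_const continuous_norm).inter (isOpen_lt continuous_norm continuous_const)
  have hzU : z ∈ U := ⟨by linarith, by linarith⟩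
  have hne : ∀ w ∈ U, w ≠ 0 := by
    rintro w ⟨hw, -⟩ rfl
    rw [norm_zero] at hw
    linarith
  have := Complex.differentiableOn_tsum_of_summable_norm
    (u := fun n : ℤ => ‖a n‖ * (‖z‖ / 2) ^ n + ‖a n‖ * (2 * ‖z‖) ^ n) (U := U)
    (F := fun n w => w ^ n • a n)
    ((ha _ (by positivity)).add (ha _ (by positivity)))
    (fun n w hw => ((differentiableAt_zpow.mpr (Or.inl (hne w hw))).smul_const
      _).differentiableWithinAt) hUo
    (fun n w hw => by
      rw [norm_smul, norm_zpow, mul_comm, ← mul_add]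
      exact mul_le_mul_of_nonneg_left (zpow_le_add (by positivity) hw.1.le hw.2.le n)
        (norm_nonneg _))
  exact this.differentiableAt (hUo.mem_nhds hzU)

/-- Absolute convergence at radius `1` permits termwise integration, and only the term proportional
to `z⁻¹` survives. -/
theorem RapidlySummable.circleMoment {a : ℤ → ℂ} (ha : RapidlySummable a) (m : ℤ) :
    circleMoment (fun z => ∑' n : ℤ, z ^ n • a n) m = 2 * Real.pi * Complex.I * a (-m - 1) := by
  have hne : ∀ t : ℝ, circleMap 0 1 t ≠ 0 := fun t => by
    simp
  have h1 : HasSum (fun n : ℤ => ∮ z in C(0, 1), z ^ m * (z ^ n * a n))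
      (QAlien.circleMoment (fun z => ∑' n : ℤ, z ^ n • a n) m) := by
    have := intervalIntegral.hasSum_intervalIntegral_of_summable_norm (ι := ℤ) (a := 0)
      (b := 2 * Real.pi)
      (f := fun n : ℤ => (⟨fun t : ℝ => deriv (circleMap 0 1) t • (circleMap 0 1 t ^ m *
        (circleMap 0 1 t ^ n * a n)), by
          simp only [deriv_circleMap]
          have := continuous_circleMap 0 1
          have h2 : ∀ n : ℤ, Continuous fun t => circleMap 0 1 t ^ n := fun n =>
            this.zpow₀ n fun t => Or.inl (hne t)
          exact (this.mul continuous_const).smul ((h2 m).mul ((h2 n).mul continuous_const))⟩ :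
            C(ℝ, ℂ)))
      ?_
    · convert! this using 1
      rw [QAlien.circleMoment, circleIntegral]
      congr 1
      funext t
      simp only [ContinuousMap.coe_mk, smul_eq_mul]
      rw [tsum_mul_left, tsum_mul_left]
    · have h3 := ha 1 one_pos
      refine Summable.of_nonneg_of_le (fun n => norm_nonneg _) (fun n => ?_) h3
      refine (ContinuousMap.norm_le _ (by positivity)).mpr fun t => ?_
      simp
  have h2 : ∀ n : ℤ, n ≠ -m - 1 → (∮ z in C(0, 1), z ^ m * (z ^ n * a n)) = 0 := fun n hn => by
    have h3 : (∮ z in C(0, 1), z ^ m * (z ^ n * a n)) =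
        ∮ z in C(0, 1), a n * (z - 0) ^ (m + n) := by
      refine circleIntegral.integral_congr zero_le_one fun z hz => ?_
      have : z ≠ 0 := by rintro rfl; simp at hz
      simp only [sub_zero, zpow_add₀ this]
      ring
    rw [h3, circleIntegral.integral_const_mul, circleIntegral.integral_sub_zpow_of_ne (by omega),
      mul_zero]
  rw [← h1.tsum_eq, tsum_eq_single (-m - 1) h2]
  have h3 : (∮ z in C(0, 1), z ^ m * (z ^ (-m - 1) * a (-m - 1))) =
      ∮ z in C(0, 1), a (-m - 1) * (z - 0)⁻¹ := by
    refine circleIntegral.integral_congr zero_le_one fun z hz => ?_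
    have : z ≠ 0 := by rintro rfl; simp at hz
    simp only [sub_zero, ← mul_assoc, ← zpow_add₀ this]
    rw [show m + (-m - 1) = -1 by ring, zpow_neg_one, mul_comm]
  rw [h3, circleIntegral.integral_const_mul, circleIntegral.integral_sub_center_inv 0 one_ne_zero]
  ring

/-- Absolutely convergent Laurent series are multiplied by the Cauchy product. -/
theorem RapidlySummable.mul {a b : ℤ → ℂ} (ha : RapidlySummable a) (hb : RapidlySummable b) :
    RapidlySummable (fun n => ∑' m : ℤ, a (n - m) * b m) ∧
      ∀ z : ℂ, z ≠ 0 → (∑' n : ℤ, z ^ n • a n) * (∑' n : ℤ, z ^ n • b n) =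
        ∑' n : ℤ, z ^ n • ∑' m : ℤ, a (n - m) * b m := by
  let e : ℤ × ℤ ≃ ℤ × ℤ :=
    { toFun := fun p => (p.1 - p.2, p.2)
      invFun := fun p => (p.1 + p.2, p.2)
      left_inv := fun p => by simp
      right_inv := fun p => by simp }
  have hs : ∀ z : ℂ, z ≠ 0 →
      Summable fun p : ℤ × ℤ => ‖z ^ p.1 * (a (p.1 - p.2) * b p.2)‖ := by
    intro z hz
    have h1 := (ha.summable_norm hz).mul_of_nonneg (hb.summable_norm hz)
      (fun _ => norm_nonneg _) (fun _ => norm_nonneg _)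
    refine (e.summable_iff.mpr h1).congr fun p => ?_
    simp only [Function.comp, e, Equiv.coe_fn_mk, ← norm_mul, smul_eq_mul]
    congr 1
    rw [zpow_sub₀ hz]
    have := zpow_ne_zero p.2 hz
    field_simp
  refine ⟨fun ρ hρ => ?_, fun z hz => ?_⟩
  · have h0 : (ρ : ℂ) ≠ 0 := by exact_mod_cast hρ.ne'
    have h1 := hs ρ h0
    refine Summable.of_nonneg_of_le (fun n => by positivity) (fun n => ?_) h1.prod
    have h2 := h1.prod_factor n
    have h3 : ‖∑' m : ℤ, (ρ : ℂ) ^ n * (a (n - m) * b m)‖ ≤ _ := norm_tsum_le_tsum_norm h2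
    rw [tsum_mul_left, norm_mul, norm_zpow, Complex.norm_real, Real.norm_of_nonneg hρ.le,
      mul_comm] at h3
    exact h3
  · rw [tsum_mul_tsum_of_summable_norm (ha.summable_norm hz) (hb.summable_norm hz),
      ← e.tsum_eq]
    refine (e.summable_iff.mpr (summable_mul_of_summable_norm (ha.summable_norm hz)
      (hb.summable_norm hz))).tsum_prod.trans (tsum_congr fun n => ?_)
    rw [smul_eq_mul, ← tsum_mul_left]
    refine tsum_congr fun m => ?_
    simp only [Function.comp, e, Equiv.coe_fn_mk, smul_eq_mul]
    rw [zpow_sub₀ hz]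
    have := zpow_ne_zero m hz
    field_simp

end RapidlySummable

/-! ### The theta function -/

theorem summable_int_of_ratio {f : ℤ → ℝ} (hf : ∀ n, 0 < f n)
    (h1 : Tendsto (fun n : ℕ => f (n + 1) / f n) atTop (𝓝 0))
    (h2 : Tendsto (fun n : ℕ => f (-(n + 1)) / f (-n)) atTop (𝓝 0)) : Summable f := by
  refine Summable.of_nat_of_neg ?_ ?_
  · refine summable_of_ratio_test_tendsto_lt_one zero_lt_one
      (Eventually.of_forall fun n => (hf n).ne') ?_
    refine h1.congr fun n => ?_
    rw [Real.norm_of_nonneg (hf _).le, Real.norm_of_nonneg (hf _).le]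
    push_cast
    rfl
  · refine summable_of_ratio_test_tendsto_lt_one zero_lt_one
      (Eventually.of_forall fun n => (hf _).ne') ?_
    refine h2.congr fun n => ?_
    rw [Real.norm_of_nonneg (hf _).le, Real.norm_of_nonneg (hf _).le]
    push_cast
    rfl

/-- The coefficients of the theta series. -/
noncomputable def thetaCoeff (q : ℂ) (n : ℤ) : ℂ := q ^ (-(n * (n + 1) / 2))

theorem thetaCoeff_succ {q : ℂ} (hq : q ≠ 0) (n : ℤ) :
    thetaCoeff q (n + 1) = q ^ (-(n + 1)) * thetaCoeff q n := by
  rw [thetaCoeff, thetaCoeff, ← zpow_add₀ hq]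
  congr 1
  have : (n + 1) * (n + 1 + 1) = n * (n + 1) + (n + 1) * 2 := by ring
  rw [this, Int.add_mul_ediv_right _ _ two_ne_zero]
  ring

theorem ne_zero_of_one_lt_norm {q : ℂ} (hq : 1 < ‖q‖) : q ≠ 0 := by
  rintro rfl
  rw [norm_zero] at hq
  linarith

theorem tendsto_zpow_neg_mul {q : ℂ} (hq : 1 < ‖q‖) (C : ℝ) :
    Tendsto (fun n : ℕ => (‖q‖ ^ n)⁻¹ * C) atTop (𝓝 0) := by
  have := (tendsto_pow_atTop_atTop_of_one_lt hq).inv_tendsto_atTop.mul_const C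
  simpa using this

theorem rapidlySummable_thetaCoeff {q : ℂ} (hq : 1 < ‖q‖) : RapidlySummable (thetaCoeff q) := by
  intro ρ hρ
  have hq0 := ne_zero_of_one_lt_norm hq
  have hn : 0 < ‖q‖ := norm_pos_iff.mpr hq0
  have hpos : ∀ n, 0 < ‖thetaCoeff q n‖ * ρ ^ n := fun n =>
    mul_pos (norm_pos_iff.mpr (zpow_ne_zero _ hq0)) (zpow_pos hρ n)
  have hs : ∀ n : ℤ, ‖thetaCoeff q (n + 1)‖ * ρ ^ (n + 1) =
      (‖q‖ ^ (-(n + 1)) * ρ) * (‖thetaCoeff q n‖ * ρ ^ n) := fun n => by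
    rw [thetaCoeff_succ hq0, norm_mul, norm_zpow, zpow_add_one₀ hρ.ne']
    ring
  refine summable_int_of_ratio hpos ?_ ?_
  · refine (tendsto_zpow_neg_mul hq (‖q‖⁻¹ * ρ)).congr fun n => ?_
    rw [hs, mul_div_assoc, div_self (hpos _).ne', mul_one, neg_add, zpow_add₀ hn.ne', zpow_neg,
      zpow_natCast, zpow_neg_one]
    ring
  · refine (tendsto_zpow_neg_mul hq ρ⁻¹).congr fun n => ?_
    have h1 := hs (-(n + 1))
    have h2 : -((n : ℤ) + 1) + 1 = -n := by ring
    rw [h2] at h1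
    rw [h1, div_mul_eq_div_div_swap, div_self (hpos _).ne', neg_neg, zpow_natCast, one_div,
      mul_inv]

theorem theta_eq (q z : ℂ) : theta q z = ∑' n : ℤ, z ^ n • thetaCoeff q n := by
  simp only [theta, thetaCoeff, smul_eq_mul, mul_comm]

theorem differentiableAt_theta {q z : ℂ} (hq : 1 < ‖q‖) (hz : z ≠ 0) :
    DifferentiableAt ℂ (theta q) z := by
  rw [funext (theta_eq q)]
  exact (rapidlySummable_thetaCoeff hq).differentiableAt hz

theorem differentiableAt_theta_div {q c z : ℂ} (hq : 1 < ‖q‖) (hc : c ≠ 0) (hz : z ≠ 0) :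
    DifferentiableAt ℂ (fun z => theta q (z / c)) z :=
  DifferentiableAt.fun_comp' (g := theta q) (f := fun z => z / c) z
    (differentiableAt_theta hq (div_ne_zero hz hc)) (differentiableAt_id.div_const c)

theorem analyticAt_theta_div {q c z : ℂ} (hq : 1 < ‖q‖) (hc : c ≠ 0) (hz : z ≠ 0) :
    AnalyticAt ℂ (fun z => theta q (z / c)) z :=
  DifferentiableOn.analyticAt (s := {0}ᶜ)
    (fun _ hw => (differentiableAt_theta_div hq hc hw).differentiableWithinAt)
    (isOpen_compl_singleton.mem_nhds hz)

/-- This equation is what turns the factor `z^δ` of the `q`-difference equation into the constant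
`c^δ` after multiplication by `θ(z/c)^δ`. -/
theorem theta_mul {q z : ℂ} (hq : 1 < ‖q‖) (hz : z ≠ 0) : theta q (q * z) = z * theta q z := by
  have hq0 := ne_zero_of_one_lt_norm hq
  rw [theta_eq, theta_eq, ← tsum_mul_left, ← (Equiv.addRight (1 : ℤ)).tsum_eq]
  refine tsum_congr fun n => ?_
  rw [Equiv.coe_addRight, thetaCoeff_succ hq0, mul_zpow, zpow_add_one₀ hz, zpow_neg]
  have := zpow_ne_zero (n + 1) hq0
  simp only [smul_eq_mul]
  field_simp

/-- The coefficients of Euler's function `∏_{k ≥ 1} (1 + u^k z)`. -/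
noncomputable def eulerCoeff (u : ℂ) (n : ℕ) : ℂ :=
  ∏ k ∈ Finset.range n, u ^ (k + 1) / (1 - u ^ (k + 1))

/-- Euler's function `∏_{k ≥ 1} (1 + u^k z)`, as a power series. -/
noncomputable def euler (u z : ℂ) : ℂ := ∑' n : ℕ, z ^ n * eulerCoeff u n

theorem summable_eulerCoeff {u : ℂ} (hu : ‖u‖ < 1) (hu0 : u ≠ 0) {ρ : ℝ} (hρ : 0 < ρ) :
    Summable fun n : ℕ => ‖eulerCoeff u n‖ * ρ ^ n := by
  have h1 : ∀ k : ℕ, (1 : ℂ) - u ^ (k + 1) ≠ 0 := fun k h => by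
    have := congrArg norm (sub_eq_zero.mp h)
    rw [norm_one, norm_pow] at this
    exact (pow_lt_one₀ (norm_nonneg u) hu k.succ_ne_zero).ne this.symm
  have h2 : ∀ n, eulerCoeff u n ≠ 0 := fun n =>
    Finset.prod_ne_zero_iff.mpr fun k _ => div_ne_zero (pow_ne_zero _ hu0) (h1 k)
  have hpos : ∀ n, 0 < ‖eulerCoeff u n‖ * ρ ^ n := fun n =>
    mul_pos (norm_pos_iff.mpr (h2 n)) (pow_pos hρ n)
  refine summable_of_ratio_test_tendsto_lt_one zero_lt_one
    (Eventually.of_forall fun n => (hpos n).ne') ?_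
  have h3 : Tendsto (fun n : ℕ => u ^ (n + 1)) atTop (𝓝 0) :=
    (tendsto_pow_atTop_nhds_zero_of_norm_lt_one hu).comp (tendsto_add_atTop_nat 1)
  have h4 : Tendsto (fun n : ℕ => ‖u ^ (n + 1) / (1 - u ^ (n + 1))‖ * ρ) atTop (𝓝 0) := by
    have := ((h3.div (tendsto_const_nhds (x := (1 : ℂ)).sub h3) (by simp)).norm).mul_const ρ
    simpa using this
  refine h4.congr fun n => ?_
  rw [Real.norm_of_nonneg (hpos _).le, Real.norm_of_nonneg (hpos _).le,
    eq_div_iff (hpos n).ne']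
  conv_rhs => rw [eulerCoeff, Finset.prod_range_succ, ← eulerCoeff, norm_mul, pow_succ]
  ring_nf

theorem eulerCoeff_succ {u : ℂ} (hu : ‖u‖ < 1) (n : ℕ) :
    eulerCoeff u (n + 1) * (1 - u ^ (n + 1)) = u ^ (n + 1) * eulerCoeff u n := by
  have h1 : (1 : ℂ) - u ^ (n + 1) ≠ 0 := fun h => by
    have := congrArg norm (sub_eq_zero.mp h)
    rw [norm_one, norm_pow] at this
    exact (pow_lt_one₀ (norm_nonneg u) hu n.succ_ne_zero).ne this.symm
  rw [eulerCoeff, Finset.prod_range_succ, ← eulerCoeff]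
  field_simp

theorem summable_euler {u : ℂ} (hu : ‖u‖ < 1) (hu0 : u ≠ 0) (z : ℂ) :
    Summable fun n : ℕ => z ^ n * eulerCoeff u n := by
  refine Summable.of_norm_bounded (summable_eulerCoeff hu hu0 (ρ := ‖z‖ + 1) (by positivity))
    fun n => ?_
  rw [norm_mul, norm_pow, mul_comm]
  gcongr
  linarith

theorem differentiable_euler {u : ℂ} (hu : ‖u‖ < 1) (hu0 : u ≠ 0) :
    Differentiable ℂ (euler u) := by
  intro z
  have := Complex.differentiableOn_tsum_of_summable_norm
    (U := Metric.ball 0 (‖z‖ + 1)) (F := fun (n : ℕ) z => z ^ n * eulerCoeff u n)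
    (summable_eulerCoeff hu hu0 (ρ := ‖z‖ + 1) (by positivity))
    (fun n => ((differentiable_id.pow n).mul_const _).differentiableOn) Metric.isOpen_ball
    (fun n w hw => by
      rw [norm_mul, norm_pow, mul_comm]
      have := (mem_ball_zero_iff.mp hw).le
      gcongr)
  exact this.differentiableAt (Metric.isOpen_ball.mem_nhds (by simp))

theorem euler_zero (u : ℂ) : euler u 0 = 1 := by
  rw [euler, tsum_eq_single 0 fun n hn => by simp [hn]]
  simp [eulerCoeff]

/-- The coefficient recurrence says `E(z) - E(uz) = uz E(uz)`. This equation stands in for the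
infinite product, which is never formed. -/
theorem euler_eq {u : ℂ} (hu : ‖u‖ < 1) (hu0 : u ≠ 0) (z : ℂ) :
    euler u z = (1 + u * z) * euler u (u * z) := by
  have hs := summable_euler hu hu0
  have h1 : euler u z - euler u (u * z) = u * z * euler u (u * z) := by
    rw [euler, euler, ← (hs z).tsum_sub (hs (u * z)), ((hs z).sub (hs (u * z))).tsum_eq_zero_add,
      ← tsum_mul_left]
    simp only [pow_zero, sub_self, zero_add]
    refine tsum_congr fun n => ?_
    have := eulerCoeff_succ hu n
    rw [mul_pow]
    linear_combination z ^ (n + 1) * this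
  linear_combination h1

/-- If no factor `1 + u^{k+1} z` vanished, the functional equation would carry the zero along `u^n z
→ 0`, against continuity and the value `1` at the origin. -/
theorem exists_of_euler_eq_zero {u : ℂ} (hu : ‖u‖ < 1) (hu0 : u ≠ 0) {z : ℂ}
    (h : euler u z = 0) : ∃ k : ℕ, u ^ (k + 1) * z = -1 := by
  by_contra! hk
  have h1 : ∀ n : ℕ, euler u (u ^ n * z) = 0 := by
    intro n
    induction n with
    | zero => simpa using h
    | succ n ih =>
      rw [euler_eq hu hu0, ← mul_assoc, ← pow_succ'] at ih
      refine (mul_eq_zero.mp ih).resolve_left fun h2 => hk n ?_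
      linear_combination h2
  have h2 : Tendsto (fun n : ℕ => u ^ n * z) atTop (𝓝 0) := by
    simpa using (tendsto_pow_atTop_nhds_zero_of_norm_lt_one hu).mul_const z
  have h3 := ((differentiable_euler hu hu0).continuous.tendsto 0).comp h2
  rw [euler_zero] at h3
  have h4 : Tendsto (fun _ : ℕ => (0 : ℂ)) atTop (𝓝 1) := h3.congr fun n => h1 n
  exact zero_ne_one (tendsto_nhds_unique tendsto_const_nhds h4)

/-- The theta function is a constant multiple of a product of Euler's functions. -/
theorem exists_theta_eq_euler {q : ℂ} (hq : 1 < ‖q‖) : ∃ κ : ℂ, κ ≠ 0 ∧ ∀ z, z ≠ 0 →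
    theta q z = κ * (euler q⁻¹ z * ((1 + z⁻¹) * euler q⁻¹ z⁻¹)) := by
  have hq0 := ne_zero_of_one_lt_norm hq
  have hu0 : q⁻¹ ≠ 0 := inv_ne_zero hq0
  have hu : ‖q⁻¹‖ < 1 := by rw [norm_inv]; exact inv_lt_one_of_one_lt₀ hq
  set P : ℂ → ℂ := fun z => euler q⁻¹ z * ((1 + z⁻¹) * euler q⁻¹ z⁻¹) with hP
  have hd := differentiable_euler hu hu0
  have hPd : ∀ z ≠ 0, DifferentiableAt ℂ P z := fun z hz =>
    (hd z).mul (((differentiableAt_const _).add (differentiableAt_inv hz)).mul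
      ((hd _).comp z (differentiableAt_inv hz)))
  have hPq : ∀ z ≠ 0, P (q * z) = z * P z := fun z hz => by
    simp only [hP]
    rw [euler_eq hu hu0 (q * z), euler_eq hu hu0 z⁻¹, ← mul_assoc q⁻¹ q z, inv_mul_cancel₀ hq0,
      mul_inv]
    field_simp
    ring
  have hP1 : P 1 ≠ 0 := by
    have h1 : euler q⁻¹ 1 ≠ 0 := fun h => by
      obtain ⟨k, hk⟩ := exists_of_euler_eq_zero hu hu0 h
      have := congrArg norm hk
      rw [mul_one, norm_pow, norm_neg, norm_one] at this
      exact (pow_lt_one₀ (norm_nonneg _) hu k.succ_ne_zero).ne this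
    simp only [hP, inv_one]
    exact mul_ne_zero h1 (mul_ne_zero (by norm_num) h1)
  -- The product obeys the functional equation of `θ`, so a single vanishing moment would force it
  -- to vanish identically, whereas `P 1 ≠ 0`.
  have hPm : circleMoment P 0 ≠ 0 := fun h =>
    hP1 (eq_zero_of_comp_mul_eq_id_mul hq0 hPd hPq h 1 one_ne_zero)
  set κ := circleMoment (theta q) 0 / circleMoment P 0 with hκ
  have hθ : ∀ z ≠ 0, DifferentiableAt ℂ (theta q) z := fun z hz => differentiableAt_theta hq hz
  refine ⟨κ, div_ne_zero ?_ hPm, fun z hz => sub_eq_zero.mp ?_⟩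
  -- The moment of index `0` is `2πi` times the coefficient of `z⁻¹`, and this coefficient of `θ` is
  -- `q^0 = 1`.
  · rw [funext (theta_eq q), (rapidlySummable_thetaCoeff hq).circleMoment]
    simp [thetaCoeff]
  · have hκP : ∀ z ≠ 0, DifferentiableAt ℂ (fun z => κ * P z) z := fun z hz =>
      (hPd z hz).const_mul κ
    refine eq_zero_of_comp_mul_eq_id_mul hq0 (g := fun z => theta q z - κ * P z)
      (fun z hz => (hθ z hz).sub (hκP z hz)) (fun z hz => ?_) ?_ z hz
    · simp only [theta_mul hq hz, hPq z hz]
      ring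
    · rw [circleMoment_sub hθ hκP, circleMoment_const_mul, hκ, div_mul_cancel₀ _ hPm, sub_self]

/-! ### Location and simplicity of the zeros of the theta function. -/

/-- The three factors of the product vanish only at points `-q^{k+1}`, `-1` and `-q^{-(k+1)}`
respectively, with `k ≥ 0`. -/
theorem mem_spiral_of_theta_eq_zero {q z : ℂ} (hq : 1 < ‖q‖) (hz : z ≠ 0) (h : theta q z = 0) :
    z ∈ spiral q (-1) := by
  have hq0 := ne_zero_of_one_lt_norm hq
  have hu0 : q⁻¹ ≠ 0 := inv_ne_zero hq0
  have hu : ‖q⁻¹‖ < 1 := by rw [norm_inv]; exact inv_lt_one_of_one_lt₀ hq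
  obtain ⟨κ, hκ, hP⟩ := exists_theta_eq_euler hq
  rw [hP z hz] at h
  rcases mul_eq_zero.mp ((mul_eq_zero.mp h).resolve_left hκ) with h | h
  · obtain ⟨k, hk⟩ := exists_of_euler_eq_zero hu hu0 h
    refine ⟨((k + 1 : ℕ) : ℤ), ?_⟩
    rw [zpow_natCast, ← hk, inv_pow]
    field_simp
  rcases mul_eq_zero.mp h with h | h
  · refine ⟨0, ?_⟩
    have : z⁻¹ = -1 := by linear_combination h
    rw [← inv_inv z, this]
    norm_num
  · obtain ⟨k, hk⟩ := exists_of_euler_eq_zero hu hu0 h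
    refine ⟨-((k + 1 : ℕ) : ℤ), ?_⟩
    rw [zpow_neg, zpow_natCast, ← inv_pow]
    have h2 : z = -(q⁻¹ ^ (k + 1)) := by
      rw [mul_inv_eq_iff_eq_mul₀ hz] at hk
      linear_combination hk
    rw [h2]
    ring

/-- The factor `1 + z⁻¹ = (z + 1)/z` carries the zero at `-1`; the two Euler factors do not vanish
there, since `u^{k+1} ≠ 1`. -/
theorem theta_neg_one_and_deriv_ne_zero {q : ℂ} (hq : 1 < ‖q‖) :
    theta q (-1) = 0 ∧ deriv (theta q) (-1) ≠ 0 := by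
  have hq0 := ne_zero_of_one_lt_norm hq
  have hu0 : q⁻¹ ≠ 0 := inv_ne_zero hq0
  have hu : ‖q⁻¹‖ < 1 := by rw [norm_inv]; exact inv_lt_one_of_one_lt₀ hq
  obtain ⟨κ, hκ, hP⟩ := exists_theta_eq_euler hq
  have hm : (-1 : ℂ) ≠ 0 := by norm_num
  have h1 : euler q⁻¹ (-1) ≠ 0 := fun h => by
    obtain ⟨k, hk⟩ := exists_of_euler_eq_zero hu hu0 h
    have := congrArg norm hk
    rw [mul_neg, mul_one, norm_neg, norm_pow, norm_neg, norm_one] at this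
    exact (pow_lt_one₀ (norm_nonneg _) hu k.succ_ne_zero).ne this
  refine ⟨by rw [hP _ hm]; norm_num, ?_⟩
  have hd := differentiable_euler hu hu0
  set k : ℂ → ℂ := fun z => κ * (euler q⁻¹ z * (z⁻¹ * euler q⁻¹ z⁻¹)) with hk
  have hkd : DifferentiableAt ℂ k (-1) :=
    ((hd _).mul ((differentiableAt_inv hm).mul ((hd _).comp _ (differentiableAt_inv hm)))).const_mul
      κ
  have h2 : theta q =ᶠ[𝓝 (-1)] fun z => (z + 1) * k z := by
    filter_upwards [isOpen_ne.mem_nhds hm] with z hz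
    rw [hP z hz, hk]
    field_simp
  have h3 : HasDerivAt (fun z : ℂ => (z + 1) * k z) (1 * k (-1) + (-1 + 1) * deriv k (-1)) (-1) :=
    ((hasDerivAt_id _).add_const _).mul hkd.hasDerivAt
  rw [h2.deriv_eq, h3.deriv]
  simp only [hk, inv_neg, inv_one]
  simp [hκ, h1]

/-- Differentiating `θ(qz) = z θ(z)` at a zero `w` gives `q θ'(qw) = w θ'(w)`, so simple zeros
propagate in both directions along the spiral from `-1`. -/
theorem theta_and_deriv_of_mem_spiral {q z : ℂ} (hq : 1 < ‖q‖) (hz : z ∈ spiral q (-1)) :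
    theta q z = 0 ∧ deriv (theta q) z ≠ 0 := by
  have hq0 := ne_zero_of_one_lt_norm hq
  have key : ∀ w : ℂ, w ≠ 0 → (theta q (q * w) = 0 ∧ deriv (theta q) (q * w) ≠ 0 ↔
      theta q w = 0 ∧ deriv (theta q) w ≠ 0) := by
    intro w hw
    have h1 : (fun z => theta q (q * z)) =ᶠ[𝓝 w] fun z => z * theta q z := by
      filter_upwards [isOpen_ne.mem_nhds hw] with z hz using theta_mul hq hz
    have h2 : HasDerivAt (fun z => theta q (q * z)) (deriv (theta q) (q * w) * q) w := by
      have h3 : HasDerivAt (fun z => q * z) q w := by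
        simpa using (hasDerivAt_id w).const_mul q
      exact (differentiableAt_theta hq (mul_ne_zero hq0 hw)).hasDerivAt.comp w h3
    have h4 : HasDerivAt (fun z => z * theta q z) (1 * theta q w + w * deriv (theta q) w) w :=
      (hasDerivAt_id w).mul (differentiableAt_theta hq hw).hasDerivAt
    have h5 : deriv (theta q) (q * w) * q = 1 * theta q w + w * deriv (theta q) w :=
      h2.unique (h4.congr_of_eventuallyEq h1)
    rw [theta_mul hq hw, mul_eq_zero, or_iff_right hw]
    refine and_congr_right fun h0 => not_congr ?_
    rw [h0, mul_zero, zero_add] at h5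
    refine ⟨fun h => ?_, fun h => ?_⟩
    · rw [h, zero_mul] at h5
      exact (mul_eq_zero.mp h5.symm).resolve_left hw
    · rw [h, mul_zero] at h5
      exact (mul_eq_zero.mp h5).resolve_right hq0
  obtain ⟨n, rfl⟩ := hz
  induction n with
  | zero => simpa using theta_neg_one_and_deriv_ne_zero hq
  | succ n ih =>
    rw [zpow_add_one₀ hq0, ← mul_assoc, mul_comm _ q]
    exact (key _ (mul_ne_zero (by norm_num) (zpow_ne_zero _ hq0))).mpr ih
  | pred n ih =>
    refine (key _ (mul_ne_zero (by norm_num) (zpow_ne_zero _ hq0))).mp ?_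
    rwa [mul_left_comm, ← zpow_one_add₀ hq0, add_sub_cancel]

theorem meromorphicOrderAt_theta_div {q c z : ℂ} (hq : 1 < ‖q‖) (hc : c ≠ 0)
    (hz : z ∈ spiral q (-c)) : AnalyticAt ℂ (fun z => theta q (z / c)) z ∧
      meromorphicOrderAt (fun z => theta q (z / c)) z = 1 := by
  have hq0 := ne_zero_of_one_lt_norm hq
  obtain ⟨n, rfl⟩ := hz
  set z := -c * q ^ n with hz
  have hzc : z / c ∈ spiral q (-1) := ⟨n, by rw [hz]; field_simp⟩
  have hz0 : z ≠ 0 := mul_ne_zero (neg_ne_zero.mpr hc) (zpow_ne_zero _ hq0)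
  obtain ⟨h1, h2⟩ := theta_and_deriv_of_mem_spiral hq hzc
  have han := analyticAt_theta_div hq hc hz0
  refine ⟨han, ?_⟩
  have h3 : deriv (fun z => theta q (z / c)) z ≠ 0 := by
    have h4 : HasDerivAt (fun z => z / c) (1 / c) z := (hasDerivAt_id z).div_const c
    have h5 : HasDerivAt (fun z => theta q (z / c)) (deriv (theta q) (z / c) * (1 / c)) z :=
      HasDerivAt.comp_of_eq (h₂ := theta q) (h := fun z => z / c) z
        (differentiableAt_theta hq (div_ne_zero hz0 hc)).hasDerivAt h4 rfl
    rw [h5.deriv]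
    exact mul_ne_zero h2 (one_div_ne_zero hc)
  -- The function is a local coordinate, its derivative being nonzero; its order is therefore that
  -- of `id` at its value `0`.
  have h4 := meromorphicOrderAt_comp_of_deriv_ne_zero (f := id) han h3
  rw [h1, meromorphicOrderAt_id] at h4
  exact h4

theorem theta_div_ne_zero {q c z : ℂ} (hq : 1 < ‖q‖) (hc : c ≠ 0) (hz : z ≠ 0)
    (h : z ∉ spiral q (-c)) : theta q (z / c) ≠ 0 := fun h0 => by
  obtain ⟨n, hn⟩ := mem_spiral_of_theta_eq_zero hq (div_ne_zero hz hc) h0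
  refine h ⟨n, ?_⟩
  field_simp at hn
  rw [hn]
  ring

/-! ### Laurent coefficients of the powers of the theta function -/

theorem thetaPowCoeff_spec {q : ℂ} (hq : 1 < ‖q‖) (δ : ℕ) :
    RapidlySummable (thetaPowCoeff q δ) ∧
      ∀ z : ℂ, z ≠ 0 → ∑' n : ℤ, z ^ n • thetaPowCoeff q δ n = theta q z ^ δ := by
  induction δ with
  | zero =>
    refine ⟨fun ρ hρ => summable_of_ne_finset_zero (s := {0}) fun n hn => ?_, fun z hz => ?_⟩
    · simp only [Finset.mem_singleton] at hn
      simp [thetaPowCoeff, hn]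
    · rw [tsum_eq_single 0 fun n hn => by simp [thetaPowCoeff, hn]]
      simp [thetaPowCoeff]
  | succ δ ih =>
    obtain ⟨h1, h2⟩ := ih.1.mul (rapidlySummable_thetaCoeff hq)
    refine ⟨h1, fun z hz => ?_⟩
    rw [pow_succ, ← ih.2 z hz, theta_eq, h2 z hz]
    rfl

/-! ### Residues -/

section Residue

variable {E : Type*} [NormedAddCommGroup E] [NormedSpace ℂ E]

/-- The integral of `f` along small circles around `ξ` is `2πi v`. -/
def HasResidue (f : ℂ → E) (ξ : ℂ) (v : E) : Prop :=
  ∀ᶠ ε in 𝓝[>] (0 : ℝ), CircleIntegrable f ξ ε ∧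
    (∮ c in C(ξ, ε), f c) = (2 * Real.pi * Complex.I : ℂ) • v

theorem HasResidue.residue_eq {f : ℂ → ℂ} {ξ v : ℂ} (h : HasResidue f ξ v) : residue f ξ = v := by
  refine Tendsto.limUnder_eq (tendsto_const_nhds.congr' ?_)
  filter_upwards [h] with ε hε
  rw [hε.2, smul_eq_mul, inv_mul_cancel_left₀ Complex.two_pi_I_ne_zero]

theorem HasResidue.congr {f g : ℂ → E} {ξ : ℂ} {v : E} (h : HasResidue f ξ v)
    (hfg : f =ᶠ[𝓝[≠] ξ] g) : HasResidue g ξ v := by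
  obtain ⟨r, hr, hr'⟩ := Metric.mem_nhdsWithin_iff.mp hfg
  filter_upwards [h, Ioo_mem_nhdsGT hr] with ε hε hε'
  have heq : Set.EqOn f g (Metric.sphere ξ ε) := fun c hc => hr'
    ⟨Metric.mem_ball.mpr (by rw [Metric.mem_sphere.mp hc]; exact hε'.2), by
      rintro rfl
      rw [Metric.mem_sphere, dist_self] at hc
      exact hε'.1.ne hc⟩
  have habs : |ε| = ε := abs_of_pos hε'.1
  refine ⟨(circleIntegrable_congr (by rwa [habs])).mp hε.1, ?_⟩
  rw [← hε.2]
  exact circleIntegral.integral_congr hε'.1.le heq.symm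

theorem HasResidue.add {f g : ℂ → E} {ξ : ℂ} {v w : E} (hf : HasResidue f ξ v)
    (hg : HasResidue g ξ w) : HasResidue (fun c => f c + g c) ξ (v + w) := by
  filter_upwards [hf, hg] with ε h1 h2
  exact ⟨h1.1.add h2.1, by rw [circleIntegral.integral_add h1.1 h2.1, h1.2, h2.2, smul_add]⟩

theorem HasResidue.sub {f g : ℂ → E} {ξ : ℂ} {v w : E} (hf : HasResidue f ξ v)
    (hg : HasResidue g ξ w) : HasResidue (fun c => f c - g c) ξ (v - w) := by
  filter_upwards [hf, hg] with ε h1 h2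
  exact ⟨h1.1.sub h2.1, by rw [circleIntegral.integral_sub h1.1 h2.1, h1.2, h2.2, smul_sub]⟩

theorem HasResidue.map [CompleteSpace E] {F : Type*} [NormedAddCommGroup F] [NormedSpace ℂ F]
    [CompleteSpace F]
    {f : ℂ → E} {ξ : ℂ} {v : E} (hf : HasResidue f ξ v) (T : E →L[ℂ] F) :
    HasResidue (fun c => T (f c)) ξ (T v) := by
  filter_upwards [hf] with ε h
  have h1 := h.1.out
  refine ⟨?_, ?_⟩
  · have h2 := h.1
    rw [circleIntegrable_def] at h2 ⊢
    exact ⟨T.integrable_comp h2.1, T.integrable_comp h2.2⟩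
  · have h3 := T.intervalIntegral_comp_comm h1
    rw [← map_smul, ← h.2]
    simp only [circleIntegral, ← h3, map_smul]

theorem hasResidue_zero (ξ : ℂ) : HasResidue (fun _ => (0 : E)) ξ 0 :=
  Eventually.of_forall fun ε => ⟨circleIntegrable_const 0 ξ ε, by simp [circleIntegral]⟩

theorem HasResidue.sum {ι : Type*} (s : Finset ι) {f : ι → ℂ → E} {ξ : ℂ} {v : ι → E}
    (h : ∀ i ∈ s, HasResidue (f i) ξ (v i)) :
    HasResidue (fun c => ∑ i ∈ s, f i c) ξ (∑ i ∈ s, v i) := by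
  classical
  induction s using Finset.induction_on with
  | empty => simpa using hasResidue_zero ξ
  | insert i s hi ih =>
    simp only [Finset.sum_insert hi]
    exact (h i (Finset.mem_insert_self i s)).add
      (ih fun j hj => h j (Finset.mem_insert_of_mem hj))

theorem hasResidue_of_analyticAt [CompleteSpace E] {f : ℂ → E} {ξ : ℂ} (hf : AnalyticAt ℂ f ξ) :
    HasResidue f ξ 0 := by
  obtain ⟨r, hr, hr'⟩ := Metric.eventually_nhds_iff_ball.mp hf.eventually_analyticAt
  filter_upwards [Ioo_mem_nhdsGT hr] with ε hε
  have hsub : Metric.closedBall ξ ε ⊆ Metric.ball ξ r := Metric.closedBall_subset_ball hε.2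
  have hd : ∀ z ∈ Metric.closedBall ξ ε, DifferentiableAt ℂ f z := fun z hz =>
    (hr' z (hsub hz)).differentiableAt
  have hc : ContinuousOn f (Metric.closedBall ξ ε) := fun z hz =>
    (hd z hz).continuousAt.continuousWithinAt
  refine ⟨(hc.mono Metric.sphere_subset_closedBall).circleIntegrable hε.1.le, ?_⟩
  rw [smul_zero]
  exact Complex.circleIntegral_eq_zero_of_differentiable_on_off_countable hε.1.le
    Set.countable_empty hc fun z hz => hd z (Metric.ball_subset_closedBall hz.1)

theorem hasResidue_inv_pow (ξ : ℂ) (k : ℕ) :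
    HasResidue (fun c => ((c - ξ) ^ (k + 1))⁻¹) ξ (if k = 0 then 1 else 0) := by
  filter_upwards [self_mem_nhdsWithin] with ε hε
  have hε : 0 < ε := hε
  refine ⟨?_, ?_⟩
  · refine ContinuousOn.circleIntegrable hε.le fun z hz => ?_
    have : z - ξ ≠ 0 := by
      rw [sub_ne_zero]
      rintro rfl
      rw [Metric.mem_sphere, dist_self] at hz
      exact hε.ne hz
    exact (((continuousAt_id.sub continuousAt_const).pow _).inv₀
      (pow_ne_zero _ this)).continuousWithinAt
  · split_ifs with h
    · subst h
      simp only [zero_add, pow_one, smul_eq_mul, mul_one]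
      exact circleIntegral.integral_sub_center_inv ξ hε.ne'
    · have h1 : (-((k + 1 : ℕ) : ℤ)) ≠ -1 := by omega
      have := circleIntegral.integral_sub_zpow_of_ne h1 ξ ξ ε
      simpa only [zpow_neg, zpow_natCast, smul_zero] using this

/-- The Taylor coefficients of `h` at `ξ` are the residues of `h(c) (c - ξ)^{-k-1}`. -/
theorem exists_hasResidue_inv_pow_mul {h : ℂ → ℂ} {ξ : ℂ} (hh : AnalyticAt ℂ h ξ) :
    ∃ η : ℕ → ℂ, η 0 = h ξ ∧
      ∀ k, HasResidue (fun c => ((c - ξ) ^ (k + 1))⁻¹ * h c) ξ (η k) := by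
  have hex : ∀ (k : ℕ) (h : ℂ → ℂ), AnalyticAt ℂ h ξ → ∃ v : ℂ, (k = 0 → v = h ξ) ∧
      HasResidue (fun c => ((c - ξ) ^ (k + 1))⁻¹ * h c) ξ v := by
    intro k
    -- Write `h(c) = h(ξ) + (c - ξ) d(c)` with `d = dslope h ξ` analytic. The constant contributes
    -- an explicit residue, and `d` has a pole factor of one order less; hence `h` must vary in the
    -- induction.
    induction k with
    | zero =>
      intro h hh
      have h0 := (hasResidue_inv_pow ξ 0).map (h ξ • ContinuousLinearMap.id ℂ ℂ)
      obtain ⟨p, hp⟩ := hh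
      have h2 : AnalyticAt ℂ (dslope h ξ) ξ := hp.has_fpower_series_dslope_fslope.analyticAt
      refine ⟨h ξ, fun _ => rfl, ?_⟩
      have h3 := h0.add (hasResidue_of_analyticAt h2)
      simp only [if_true, add_zero, smul_apply, ContinuousLinearMap.id_apply,
        smul_eq_mul, mul_one] at h3
      refine h3.congr ?_
      filter_upwards [self_mem_nhdsWithin] with c hc
      have hc : c - ξ ≠ 0 := sub_ne_zero.mpr hc
      rw [dslope_of_ne _ (sub_ne_zero.mp hc), slope_def_field]
      field_simp
      ring
    | succ k ih =>
      intro h hh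
      have h0 := (hasResidue_inv_pow ξ (k + 1)).map (h ξ • ContinuousLinearMap.id ℂ ℂ)
      obtain ⟨p, hp⟩ := hh
      have h2 : AnalyticAt ℂ (dslope h ξ) ξ := hp.has_fpower_series_dslope_fslope.analyticAt
      obtain ⟨v, -, hv⟩ := ih _ h2
      refine ⟨_, fun h => absurd h k.succ_ne_zero, (h0.add hv).congr ?_⟩
      filter_upwards [self_mem_nhdsWithin] with c hc
      have hc : c - ξ ≠ 0 := sub_ne_zero.mpr hc
      rw [dslope_of_ne _ (sub_ne_zero.mp hc), slope_def_field]
      simp only [smul_apply, ContinuousLinearMap.id_apply, smul_eq_mul]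
      field_simp
      ring
  choose η h1 h2 using fun k => hex k h hh
  exact ⟨η, h1 0 rfl, h2⟩

end Residue

/-! ### Functional calculus for an endomorphism with a single eigenvalue -/

section Calculus

open Polynomial

/-- `p(L) = p(ξ) + (L - ξ) r(L)` is an invertible scalar plus a commuting nilpotent. This is the
source of most of the invertibility claims below. -/
theorem isUnit_aeval_of_eval_ne_zero {R : Type*} [Ring R] [Algebra ℂ R] {L : R} {ξ : ℂ}
    (hL : IsNilpotent (L - algebraMap ℂ R ξ)) {p : ℂ[X]} (hp : p.eval ξ ≠ 0) :
    IsUnit (aeval L p) := by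
  obtain ⟨r, hr⟩ : X - C ξ ∣ p - C (p.eval ξ) := dvd_iff_isRoot.mpr (by simp)
  have h1 : aeval L p = algebraMap ℂ R (p.eval ξ) + (L - algebraMap ℂ R ξ) * aeval L r := by
    have := congrArg (aeval L) hr
    simp only [map_sub, map_mul, aeval_X, aeval_C] at this
    rw [← this, add_sub_cancel]
  have hcomm : Commute (L - algebraMap ℂ R ξ) (aeval L r) := by
    have : Commute (aeval L (X - C ξ)) (aeval L r) := by
      rw [commute_iff_eq, ← map_mul, mul_comm, map_mul]
    simpa using this
  rw [h1]
  refine (hcomm.isNilpotent_mul_right hL).isUnit_add_left_of_commute ?_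
    (Algebra.commutes _ _).symm
  exact (IsUnit.mk0 _ hp).map (algebraMap ℂ R)

theorem ring_inverse_eq_of_mul_eq_one {R : Type*} [MonoidWithZero R] {a b : R} (h1 : a * b = 1)
    (h2 : b * a = 1) : Ring.inverse a = b :=
  Ring.inverse_unit (⟨a, b, h1, h2⟩ : Rˣ)

/-- The resolvent of `T`, where `T - τ` is nilpotent. -/
theorem ring_inverse_sub_eq_sum {R : Type*} [Ring R] [Algebra ℂ R] {T : R} {τ w : ℂ} {K : ℕ}
    (hT : (T - algebraMap ℂ R τ) ^ K = 0) (hw : w ≠ τ) :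
    Ring.inverse (algebraMap ℂ R w - T) =
      ∑ k ∈ Finset.range K, ((w - τ) ^ (k + 1))⁻¹ • (T - algebraMap ℂ R τ) ^ k := by
  have hw : w - τ ≠ 0 := sub_ne_zero.mpr hw
  set y : R := (w - τ)⁻¹ • (T - algebraMap ℂ R τ) with hy
  have hyK : y ^ K = 0 := by rw [hy, _root_.smul_pow, hT, smul_zero]
  have h1 : algebraMap ℂ R w - T = (w - τ) • (1 - y) := by
    rw [hy, smul_sub, smul_smul, mul_inv_cancel₀ hw, one_smul, Algebra.smul_def, mul_one, map_sub]
    abel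
  have h2 : ∑ k ∈ Finset.range K, ((w - τ) ^ (k + 1))⁻¹ • (T - algebraMap ℂ R τ) ^ k =
      (w - τ)⁻¹ • ∑ k ∈ Finset.range K, y ^ k := by
    rw [Finset.smul_sum]
    refine Finset.sum_congr rfl fun k _ => ?_
    rw [hy, _root_.smul_pow, smul_smul, pow_succ', mul_inv, inv_pow]
  rw [h1, h2]
  refine ring_inverse_eq_of_mul_eq_one ?_ ?_
  · rw [smul_mul_smul_comm, mul_inv_cancel₀ hw, one_smul, mul_neg_geom_sum, hyK, sub_zero]
  · rw [smul_mul_smul_comm, inv_mul_cancel₀ hw, one_smul, geom_sum_mul_neg, hyK, sub_zero]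

variable {E : Type*} [NormedAddCommGroup E] [NormedSpace ℂ E] [FiniteDimensional ℂ E]

theorem analyticAt_linearMap_apply (T : Module.End ℂ E) {f : ℂ → E} {ξ : ℂ}
    (hf : AnalyticAt ℂ f ξ) : AnalyticAt ℂ (fun c => T (f c)) ξ :=
  ((Module.End.toContinuousLinearMap (𝕜 := ℂ) E T).analyticAt _).comp hf

/-- Inversion is analytic at the units of the Banach algebra of continuous endomorphisms.
Analyticity is assumed only vector by vector, so `P c` is rebuilt from its values on a basis. -/
theorem analyticAt_ring_inverse_apply {P : ℂ → Module.End ℂ E} {w : ℂ → E} {ξ : ℂ}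
    (hP : ∀ v, AnalyticAt ℂ (fun c => P c v) ξ) (hu : IsUnit (P ξ)) (hw : AnalyticAt ℂ w ξ) :
    AnalyticAt ℂ (fun c => Ring.inverse (P c) (w c)) ξ := by
  have := FiniteDimensional.complete ℂ E
  let e := Module.End.toContinuousLinearMap (𝕜 := ℂ) E
  have h1 : AnalyticAt ℂ (fun c => e (P c)) ξ := by
    let b := Module.finBasis ℂ E
    have h2 : ∀ c, e (P c) = ∑ i, (LinearMap.toContinuousLinearMap (b.coord i)).smulRight
        (P c (b i)) := fun c => by
      ext v
      conv_lhs => rw [← b.sum_repr v]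
      rw [map_sum, sum_apply]
      refine Finset.sum_congr rfl fun i _ => ?_
      rw [map_smul]
      rfl
    simp only [h2]
    refine Finset.analyticAt_fun_sum _ fun i _ => ?_
    exact ((ContinuousLinearMap.smulRightL ℂ E E
      (LinearMap.toContinuousLinearMap (b.coord i))).analyticAt _).comp (hP (b i))
  have h3 : ∀ c, Ring.inverse (P c) (w c) = Ring.inverse (e (P c)) (w c) := fun c => by
    have : e (Ring.inverse (P c)) = Ring.inverse (e (P c)) := by
      by_cases h : IsUnit (P c)
      · symm
        refine ring_inverse_eq_of_mul_eq_one ?_ ?_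
        · rw [← map_mul, Ring.mul_inverse_cancel _ h, map_one]
        · rw [← map_mul, Ring.inverse_mul_cancel _ h, map_one]
      · rw [Ring.inverse_non_unit _ h, map_zero, Ring.inverse_non_unit]
        intro h'
        exact h ((MulEquiv.isUnit_map e).mp h')
    rw [← this]
    rfl
  simp only [h3]
  obtain ⟨u, hu'⟩ := hu.map e
  have h4 : AnalyticAt ℂ (fun c => Ring.inverse (e (P c))) ξ := by
    have := analyticAt_inverse (𝕜 := ℂ) u
    rw [hu'] at this
    exact AnalyticAt.fun_comp (g := Ring.inverse) (f := fun c => e (P c)) this h1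
  exact (ContinuousLinearMap.apply ℂ E).analyticAt_bilinear (w ξ, Ring.inverse (e (P ξ))) |>.comp₂ hw h4

/-- The operator `h(L)` for an endomorphism `L` with `ξ` as its only eigenvalue. -/
theorem exists_functionalCalculus {L : Module.End ℂ E} {ξ : ℂ}
    (hL : IsNilpotent (L - algebraMap ℂ _ ξ)) {h : ℂ → ℂ} (hh : AnalyticAt ℂ h ξ) :
    ∃ H : Module.End ℂ E, (h ξ ≠ 0 → IsUnit H) ∧
      ∀ v, HasResidue (fun c => h c • resolvent L c v) ξ (H v) := by
  have := FiniteDimensional.complete ℂ E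
  obtain ⟨K, hK⟩ := hL
  obtain ⟨η, h0, hη⟩ := exists_hasResidue_inv_pow_mul hh
  -- The Taylor polynomial of `h` at `ξ`, evaluated at `L`. The range `K + 1` keeps the constant
  -- term `h ξ`, on which invertibility rests, even when `K = 0`.
  refine ⟨aeval (L - algebraMap ℂ _ ξ) (∑ k ∈ Finset.range (K + 1), C (η k) * X ^ k), fun hξ => ?_,
    fun v => ?_⟩
  · refine isUnit_aeval_of_eval_ne_zero (ξ := 0) (by simpa using ⟨K, hK⟩) ?_
    simp [eval_finsetSum, Finset.sum_range_succ', h0, hξ]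
  · have h1 : HasResidue (fun c => ∑ k ∈ Finset.range (K + 1), (((c - ξ) ^ (k + 1))⁻¹ * h c) •
        ((L - algebraMap ℂ (Module.End ℂ E) ξ) ^ k) v) ξ
        (∑ k ∈ Finset.range (K + 1), η k • ((L - algebraMap ℂ (Module.End ℂ E) ξ) ^ k) v) :=
      HasResidue.sum _ fun k _ => (hη k).map
        ((ContinuousLinearMap.id ℂ ℂ).smulRight (((L - algebraMap ℂ (Module.End ℂ E) ξ) ^ k) v))
    have h2 : aeval (L - algebraMap ℂ (Module.End ℂ E) ξ)
        (∑ k ∈ Finset.range (K + 1), C (η k) * X ^ k) v =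
        ∑ k ∈ Finset.range (K + 1), η k • ((L - algebraMap ℂ (Module.End ℂ E) ξ) ^ k) v := by
      simp [map_sum, LinearMap.sum_apply]
    rw [h2]
    refine h1.congr ?_
    filter_upwards [self_mem_nhdsWithin] with c hc
    rw [resolvent, ring_inverse_sub_eq_sum (K := K + 1) (by rw [pow_succ, hK, zero_mul]) hc,
      LinearMap.sum_apply, Finset.smul_sum]
    refine Finset.sum_congr rfl fun k _ => ?_
    rw [LinearMap.smul_apply, smul_smul, mul_comm]

/-- `∑_{i < k} c^i X^{k-1-i} = (c^k - X^k) / (c - X)`. -/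
noncomputable def geomPoly (c : ℂ) (k : ℕ) : ℂ[X] :=
  ∑ i ∈ Finset.range k, C c ^ i * X ^ (k - 1 - i)

theorem sub_mul_geomPoly (c : ℂ) (k : ℕ) : (C c - X) * geomPoly c k = C c ^ k - X ^ k :=
  (Commute.all (C c) X).mul_geom_sum₂ k

/-- The quotient of `geomPoly c δ - δ X^{δ-1}` by `c - X`. -/
noncomputable def geomQuot (c : ℂ) (δ : ℕ) : ℂ[X] :=
  ∑ i ∈ Finset.range δ, geomPoly c i * X ^ (δ - 1 - i)

theorem sub_mul_geomQuot (c : ℂ) (δ : ℕ) :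
    (C c - X) * geomQuot c δ = geomPoly c δ - C (δ : ℂ) * X ^ (δ - 1) := by
  have h1 : C (δ : ℂ) * X ^ (δ - 1) = ∑ i ∈ Finset.range δ, (X : ℂ[X]) ^ i * X ^ (δ - 1 - i) := by
    rw [geom_sum₂_self, map_natCast]
  rw [h1, geomQuot, geomPoly, Finset.mul_sum, ← Finset.sum_sub_distrib]
  refine Finset.sum_congr rfl fun i _ => ?_
  rw [← mul_assoc, sub_mul_geomPoly, sub_mul]

omit [FiniteDimensional ℂ E] in
theorem analyticAt_aeval_geomPoly (L : Module.End ℂ E) (k : ℕ) (v : E) (ξ : ℂ) :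
    AnalyticAt ℂ (fun c => aeval L (geomPoly c k) v) ξ := by
  have : ∀ c, aeval L (geomPoly c k) v =
      ∑ i ∈ Finset.range k, c ^ i • (L ^ (k - 1 - i)) v := fun c => by
    simp only [geomPoly, map_sum, LinearMap.sum_apply]
    refine Finset.sum_congr rfl fun i _ => ?_
    rw [map_mul, map_pow, map_pow, aeval_C, aeval_X, ← map_pow]
    rfl
  simp only [this]
  exact Finset.analyticAt_fun_sum _ fun i _ => (analyticAt_id.pow i).smul analyticAt_const

omit [FiniteDimensional ℂ E] in
theorem analyticAt_aeval_geomQuot (L : Module.End ℂ E) (k : ℕ) (v : E) (ξ : ℂ) :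
    AnalyticAt ℂ (fun c => aeval L (geomQuot c k) v) ξ := by
  have : ∀ c, aeval L (geomQuot c k) v =
      ∑ i ∈ Finset.range k, aeval L (geomPoly c i) ((L ^ (k - 1 - i)) v) := fun c => by
    simp only [geomQuot, map_sum, map_mul, map_pow, aeval_X, LinearMap.sum_apply]
    exact Finset.sum_congr rfl fun i _ => rfl
  simp only [this]
  exact Finset.analyticAt_fun_sum _ fun i _ => analyticAt_aeval_geomPoly L i _ ξ

/-- Let `P` be the value of `geomPoly c δ` at `L`. Then `c^δ - L^δ = (c - L) P`, and both `c^k -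
L^k` and `P - δ L^{δ-1}` are divisible by `c - L`. The singular factor `(c - L)⁻¹` thus cancels in
the difference, and the right-hand side is regular at the eigenvalue. -/
theorem ring_inverse_sub_ring_inverse {R : Type*} [Ring R] [Algebra ℂ R] {L : R} {c : ℂ} {δ : ℕ}
    (k : ℕ) (ha : IsUnit (aeval L (C c - X))) (hP : IsUnit (aeval L (geomPoly c δ)))
    (h0 : IsUnit (aeval L (C (δ : ℂ) * X ^ (δ - 1) : ℂ[X]))) :
    Ring.inverse (algebraMap ℂ R (c ^ δ) - L ^ δ) * aeval L (C c ^ k : ℂ[X]) -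
      Ring.inverse (algebraMap ℂ R c - L) *
        (Ring.inverse (aeval L (C (δ : ℂ) * X ^ (δ - 1) : ℂ[X])) * L ^ k) =
    Ring.inverse (aeval L (geomPoly c δ)) *
      (Ring.inverse (aeval L (C (δ : ℂ) * X ^ (δ - 1) : ℂ[X])) *
        (aeval L (C (δ : ℂ) * X ^ (δ - 1) : ℂ[X]) * aeval L (geomPoly c k) -
          aeval L (geomQuot c δ) * L ^ k)) := by
  set p0 : ℂ[X] := C (δ : ℂ) * X ^ (δ - 1) with hp0
  set a := aeval L (C c - X : ℂ[X]) with haa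
  set P := aeval L (geomPoly c δ)
  set P0 := aeval L p0
  have e1 : algebraMap ℂ R (c ^ δ) - L ^ δ = a * P := by
    rw [← map_mul, sub_mul_geomPoly]
    simp
  have e2 : algebraMap ℂ R c - L = a := by simp [haa]
  have e3 : (L ^ k : R) = aeval L (X ^ k : ℂ[X]) := by simp
  have haP : a * P = P * a := by rw [← map_mul, mul_comm, map_mul]
  have haP0 : a * P0 = P0 * a := by rw [← map_mul, mul_comm, map_mul]
  have hPP0 : P * P0 = P0 * P := by rw [← map_mul, mul_comm, map_mul]
  have hu : IsUnit (a * P) := ha.mul hP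
  have hU : IsUnit (P0 * (a * P)) := h0.mul hu
  rw [e1, e2, e3]
  -- All denominators are cleared at once; what remains is an identity between polynomials evaluated
  -- at `L`.
  refine hU.mul_left_cancel ?_
  have l1 : P0 * (a * P) * (Ring.inverse (a * P) * aeval L (C c ^ k : ℂ[X])) =
      P0 * aeval L (C c ^ k : ℂ[X]) := by
    rw [mul_assoc, Ring.mul_inverse_cancel_left _ _ hu]
  have l2 : P0 * (a * P) * (Ring.inverse a * (Ring.inverse P0 * aeval L (X ^ k : ℂ[X]))) =
      P * aeval L (X ^ k : ℂ[X]) := by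
    rw [haP, ← mul_assoc, mul_assoc _ _ (Ring.inverse a), mul_assoc P a, Ring.mul_inverse_cancel _ ha,
      mul_one, ← hPP0, mul_assoc, Ring.mul_inverse_cancel_left _ _ h0]
  have l3 : ∀ Z, P0 * (a * P) * (Ring.inverse P * (Ring.inverse P0 * Z)) = a * Z := fun Z => by
    rw [← mul_assoc, mul_assoc _ _ (Ring.inverse P), mul_assoc a, Ring.mul_inverse_cancel _ hP, mul_one,
      ← haP0, mul_assoc, Ring.mul_inverse_cancel_left _ _ h0]
  rw [mul_sub, l1, l2, l3, haa]
  simp only [P0, P, ← map_mul, ← map_sub]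
  congr 1
  have g1 := sub_mul_geomPoly c k
  have g2 := sub_mul_geomQuot c δ
  rw [← hp0] at g2
  linear_combination (-p0) * g1 + X ^ k * g2

/-- The residue at the eigenvalue `ξ` of `L` of `h(c) (c^δ - L^δ)⁻¹ V(c)` is
`h(L) (δ L^{δ-1})⁻¹ V(L)`. -/
theorem hasResidue_ring_inverse_pow_sub {δ : ℕ} (hδ : 0 < δ) {L : Module.End ℂ E} {ξ : ℂ}
    (hξ : ξ ≠ 0) (hL : IsNilpotent (L - algebraMap ℂ _ ξ)) {h : ℂ → ℂ} (hh : AnalyticAt ℂ h ξ)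
    {H : Module.End ℂ E} (hH : ∀ v, HasResidue (fun c => h c • resolvent L c v) ξ (H v))
    (V : Fin δ → E) :
    HasResidue (fun c => h c • Ring.inverse (algebraMap ℂ _ (c ^ δ) - L ^ δ)
      (∑ k : Fin δ, c ^ (k : ℕ) • V k)) ξ
      (H (Ring.inverse ((δ : ℂ) • L ^ (δ - 1)) (∑ k : Fin δ, (L ^ (k : ℕ)) (V k)))) := by
  have := FiniteDimensional.complete ℂ E
  set p0 : ℂ[X] := C (δ : ℂ) * X ^ (δ - 1) with hp0
  have hp0' : (δ : ℂ) • L ^ (δ - 1) = aeval L p0 := by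
    simp [hp0, Algebra.smul_def]
  have hδ0 : (δ : ℂ) ≠ 0 := by exact_mod_cast hδ.ne'
  have h0 : IsUnit (aeval L p0) := isUnit_aeval_of_eval_ne_zero hL (by simp [hp0, hδ0, hξ])
  -- At `c = ξ` the quotient takes the value `δ ξ^{δ-1}` at `ξ`, as for the derivative of `X^δ`.
  have hPξ : (geomPoly ξ δ).eval ξ ≠ 0 := by
    have := congrArg (eval ξ) (sub_mul_geomQuot ξ δ)
    simp only [eval_mul, eval_sub, eval_C, eval_X, sub_self, zero_mul, eval_pow] at this
    rw [sub_eq_zero.mp this.symm]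
    exact mul_ne_zero hδ0 (pow_ne_zero _ hξ)
  -- The remainder left after the `(c - L)⁻¹` term is removed; being analytic at `ξ`, it has no
  -- residue.
  set D : ℂ → E := fun c => ∑ k : Fin δ, Ring.inverse (aeval L (geomPoly c δ))
    (Ring.inverse (aeval L p0) (aeval L p0 (aeval L (geomPoly c k) (V k)) -
      aeval L (geomQuot c δ) ((L ^ (k : ℕ)) (V k)))) with hD
  have hDan : AnalyticAt ℂ D ξ := by
    refine Finset.analyticAt_fun_sum _ fun k _ => ?_
    refine analyticAt_ring_inverse_apply (fun v => analyticAt_aeval_geomPoly L δ v ξ)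
      (isUnit_aeval_of_eval_ne_zero hL hPξ) ?_
    exact analyticAt_linearMap_apply _ ((analyticAt_linearMap_apply _
      (analyticAt_aeval_geomPoly L k _ ξ)).sub (analyticAt_aeval_geomQuot L δ _ ξ))
  have h1 := (hH (Ring.inverse (aeval L p0) (∑ k : Fin δ, (L ^ (k : ℕ)) (V k)))).add
    (hasResidue_of_analyticAt (hh.smul hDan))
  rw [add_zero, ← hp0'] at h1
  refine h1.congr ?_
  have hev : ∀ᶠ c in 𝓝[≠] ξ, (geomPoly c δ).eval ξ ≠ 0 := by
    have hcont : Continuous fun c => (geomPoly c δ).eval ξ := by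
      simp only [geomPoly, eval_finsetSum, eval_mul, eval_pow, eval_C, eval_X]
      fun_prop
    exact nhdsWithin_le_nhds (hcont.continuousAt.eventually_ne hPξ)
  filter_upwards [hev, self_mem_nhdsWithin] with c hc hcξ
  have hcξ : c - ξ ≠ 0 := sub_ne_zero.mpr hcξ
  have ha : IsUnit (aeval L (C c - X : ℂ[X])) :=
    isUnit_aeval_of_eval_ne_zero hL (by simpa using hcξ)
  have hP : IsUnit (aeval L (geomPoly c δ)) := isUnit_aeval_of_eval_ne_zero hL hc
  have key : ∀ k : Fin δ, _ := fun k =>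
    congrArg (fun T : Module.End ℂ E => T (V k)) (ring_inverse_sub_ring_inverse (k : ℕ) ha hP h0)
  rw [hp0', Pi.smul_apply', ← smul_add]
  congr 1
  rw [resolvent, map_sum, map_sum, map_sum, hD, ← Finset.sum_add_distrib]
  refine Finset.sum_congr rfl fun k _ => ?_
  have := key k
  simp only [LinearMap.sub_apply, Module.End.mul_apply, map_pow, aeval_C] at this
  rw [sub_eq_iff_eq_add'] at this
  refine this.symm.trans ?_
  rw [← map_pow, ← map_pow]
  rfl

end Calculus

/-! ### Summation of a `q`-difference equation `z^δ f(qz) = T f(z) + U(z)` -/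

section QDifference

variable {E : Type*} [NormedAddCommGroup E] [NormedSpace ℂ E]

/-- The Laurent coefficients of `θ(z/c)^δ U(z)`. -/
noncomputable def rhsCoeff (q : ℂ) {δ : ℕ} (U : Fin δ → E) (c : ℂ) (n : ℤ) : E :=
  ∑ k : Fin δ, (c⁻¹ ^ (n - k) * thetaPowCoeff q δ (n - k)) • U k

/-- The Laurent coefficients of the solution of `c^δ g(qz) = T g(z) + θ(z/c)^δ U(z)`. -/
noncomputable def solCoeff (q : ℂ) {δ : ℕ} (T : Module.End ℂ E) (U : Fin δ → E) (c : ℂ) (n : ℤ) :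
    E :=
  Ring.inverse (algebraMap ℂ (Module.End ℂ E) (c ^ δ * q ^ n) - T) (rhsCoeff q U c n)

/-- The solution of `z^δ f(qz) = T f(z) + U(z)` with poles on `[-c;q]`. -/
noncomputable def qSol (q : ℂ) {δ : ℕ} (T : Module.End ℂ E) (U : Fin δ → E) (c z : ℂ) : E :=
  (theta q (z / c) ^ δ)⁻¹ • ∑' n : ℤ, z ^ n • solCoeff q T U c n

theorem rapidlySummable_rhsCoeff_term {q : ℂ} (hq : 1 < ‖q‖) {δ : ℕ} (v : E) {c : ℂ}
    (hc : c ≠ 0) (k : ℤ) :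
    RapidlySummable fun n : ℤ => (c⁻¹ ^ (n - k) * thetaPowCoeff q δ (n - k)) • v := by
  have h1 := ((thetaPowCoeff_spec hq δ).1.zpow_smul (inv_ne_zero hc)).comp_sub k
  refine h1.of_norm_le ‖v‖ fun n => ?_
  rw [norm_smul, smul_eq_mul, mul_comm]

theorem rapidlySummable_rhsCoeff {q : ℂ} (hq : 1 < ‖q‖) {δ : ℕ} (U : Fin δ → E) {c : ℂ}
    (hc : c ≠ 0) : RapidlySummable (rhsCoeff q U c) :=
  RapidlySummable.sum _ fun k _ => rapidlySummable_rhsCoeff_term hq (U k) hc k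

theorem tsum_rhsCoeff [CompleteSpace E] {q : ℂ} (hq : 1 < ‖q‖) {δ : ℕ} (U : Fin δ → E) {c z : ℂ}
    (hc : c ≠ 0) (hz : z ≠ 0) :
    ∑' n : ℤ, z ^ n • rhsCoeff q U c n =
      theta q (z / c) ^ δ • ∑ k : Fin δ, z ^ (k : ℕ) • U k := by
  simp only [rhsCoeff, Finset.smul_sum]
  rw [Summable.tsum_finsetSum fun k _ =>
    (rapidlySummable_rhsCoeff_term hq (U k) hc k).summable hz]
  refine Finset.sum_congr rfl fun k _ => ?_
  rw [← (Equiv.addRight (k : ℤ)).tsum_eq, ← (thetaPowCoeff_spec hq δ).2 _ (div_ne_zero hz hc),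
    smul_smul, mul_comm, ← tsum_mul_left, ← Summable.tsum_smul_const]
  · refine tsum_congr fun n => ?_
    simp only [Equiv.coe_addRight, add_sub_cancel_right, smul_smul]
    congr 1
    rw [zpow_add₀ hz, div_eq_mul_inv, mul_zpow, zpow_natCast, smul_eq_mul]
    ring
  · exact ((thetaPowCoeff_spec hq δ).1.summable (div_ne_zero hz hc)).mul_left _

variable [FiniteDimensional ℂ E]

/-! ### Small divisors `c^δ q^n - τ` and convergence of the solution. -/

/-- The resolvent is a finite sum of powers of `(w - τ)⁻¹`, which gives one constant for all the
infinitely many `w = c^δ q^n`. -/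
theorem exists_norm_ring_inverse_le {T : Module.End ℂ E} {τ : ℂ}
    (hT : IsNilpotent (T - algebraMap ℂ _ τ)) {d : ℝ} (hd : 0 < d) :
    ∃ C : ℝ, ∀ w : ℂ, d ≤ ‖w - τ‖ → ∀ v,
      ‖Ring.inverse (algebraMap ℂ (Module.End ℂ E) w - T) v‖ ≤ C * ‖v‖ := by
  obtain ⟨K, hK⟩ := hT
  set M : ℕ → ℝ := fun k => ‖Module.End.toContinuousLinearMap (𝕜 := ℂ) E
    ((T - algebraMap ℂ (Module.End ℂ E) τ) ^ k)‖ with hM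
  refine ⟨∑ k ∈ Finset.range K, (d ^ (k + 1))⁻¹ * M k, fun w hw v => ?_⟩
  have hne : w ≠ τ := by
    rintro rfl
    rw [sub_self, norm_zero] at hw
    linarith
  rw [ring_inverse_sub_eq_sum hK hne, LinearMap.sum_apply, Finset.sum_mul]
  refine (norm_sum_le _ _).trans (Finset.sum_le_sum fun k _ => ?_)
  rw [LinearMap.smul_apply, norm_smul, norm_inv, norm_pow, mul_assoc]
  gcongr
  exact (Module.End.toContinuousLinearMap (𝕜 := ℂ) E
    ((T - algebraMap ℂ (Module.End ℂ E) τ) ^ k)).le_opNorm v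

omit [FiniteDimensional ℂ E] in
theorem isUnit_algebraMap_sub {T : Module.End ℂ E} {τ w : ℂ}
    (hT : IsNilpotent (T - algebraMap ℂ _ τ)) (hw : w ≠ τ) :
    IsUnit (algebraMap ℂ (Module.End ℂ E) w - T) := by
  have := isUnit_aeval_of_eval_ne_zero hT (p := Polynomial.C w - Polynomial.X)
    (by simpa using sub_ne_zero.mpr hw)
  simpa using this

/-- Uniformly for `c` near `ξ`, `c^δ q^n` is large for large `n` and small for very negative `n`,
hence far from `τ ≠ 0`. Finitely many indices remain, and continuity in `c` settles them. An index
resonant at `ξ` is left out, so that the estimate is also available at prohibited directions. -/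
theorem exists_gap {q : ℂ} (hq : 1 < ‖q‖) (δ : ℕ) {τ : ℂ} (hτ : τ ≠ 0) {ξ : ℂ} (hξ : ξ ≠ 0) :
    ∃ d : ℝ, 0 < d ∧ ∀ᶠ c in 𝓝 ξ, ∀ n : ℤ, ξ ^ δ * q ^ n ≠ τ → d ≤ ‖c ^ δ * q ^ n - τ‖ := by
  have hq0 := ne_zero_of_one_lt_norm hq
  have hτ' := norm_pos_iff.mpr hτ
  have hx : 0 < ‖ξ ^ δ‖ := norm_pos_iff.mpr (pow_ne_zero _ hξ)
  obtain ⟨n₁, hn₁⟩ := ((tendsto_pow_atTop_atTop_of_one_lt hq).eventually_ge_atTop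
    ((‖τ‖ + 1) * (‖ξ ^ δ‖ / 2)⁻¹)).exists_forall_of_atTop
  obtain ⟨n₂, hn₂⟩ := ((tendsto_pow_atTop_atTop_of_one_lt hq).eventually_ge_atTop
    ((‖τ‖ / 2)⁻¹ * (2 * ‖ξ ^ δ‖))).exists_forall_of_atTop
  have hcont : ContinuousAt (fun c : ℂ => c ^ δ) ξ := (continuous_pow δ).continuousAt
  have hbig : ∀ᶠ c in 𝓝 ξ, ‖ξ ^ δ‖ / 2 < ‖c ^ δ‖ ∧ ‖c ^ δ‖ < 2 * ‖ξ ^ δ‖ :=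
    (hcont.norm.eventually_const_lt (by linarith)).and
      (hcont.norm.eventually_lt_const (by linarith))
  set s : Finset ℤ := (Finset.Icc (-(n₂ : ℤ)) n₁).filter fun n => ξ ^ δ * q ^ n ≠ τ with hs
  obtain ⟨d', hd', hds⟩ : ∃ d' : ℝ, 0 < d' ∧ ∀ n ∈ s, d' < ‖ξ ^ δ * q ^ n - τ‖ := by
    have h1 : ∀ᶠ d' in 𝓝[>] (0 : ℝ), ∀ n ∈ s, d' < ‖ξ ^ δ * q ^ n - τ‖ := by
      refine (Finset.eventually_all s).mpr fun n hn => ?_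
      refine nhdsWithin_le_nhds (eventually_lt_nhds ?_)
      exact norm_pos_iff.mpr (sub_ne_zero.mpr (Finset.mem_filter.mp hn).2)
    obtain ⟨d', h2, h3⟩ := (h1.and self_mem_nhdsWithin).exists
    exact ⟨d', h3, h2⟩
  have hmid : ∀ᶠ c in 𝓝 ξ, ∀ n ∈ s, d' < ‖c ^ δ * q ^ n - τ‖ := by
    refine (Finset.eventually_all s).mpr fun n hn => ?_
    exact ((hcont.mul continuousAt_const).sub continuousAt_const).norm.eventually_const_lt
      (hds n hn)
  -- The three gaps: `d'` for the finitely many middle indices, `1` for `n > n₁`, and `‖τ‖ / 2` for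
  -- `n < -n₂`.
  refine ⟨min d' (min 1 (‖τ‖ / 2)), lt_min hd' (lt_min one_pos (by linarith)), ?_⟩
  filter_upwards [hbig, hmid] with c ⟨hc1, hc2⟩ hc3 n hn
  rcases lt_or_ge (n₁ : ℤ) n with h | h
  · refine ((min_le_right _ _).trans (min_le_left _ _)).trans ?_
    lift n to ℕ using by omega
    have h1 := hn₁ n (by omega)
    rw [zpow_natCast]
    have h2 : ‖τ‖ + 1 ≤ ‖c ^ δ * q ^ n‖ := by
      rw [norm_mul, norm_pow q]
      calc ‖τ‖ + 1 = (‖ξ ^ δ‖ / 2) * ((‖τ‖ + 1) * (‖ξ ^ δ‖ / 2)⁻¹) := by field_simp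
        _ ≤ _ := by gcongr
    have h3 := norm_sub_norm_le (c ^ δ * q ^ n) τ
    linarith
  rcases lt_or_ge n (-(n₂ : ℤ)) with h' | h'
  · refine ((min_le_right _ _).trans (min_le_right _ _)).trans ?_
    obtain ⟨m, rfl⟩ : ∃ m : ℕ, n = -m := ⟨n.natAbs, by omega⟩
    have h1 := hn₂ m (by omega)
    rw [zpow_neg, zpow_natCast]
    have hqm : 0 < ‖q‖ ^ m := pow_pos (by linarith) m
    have h2 : ‖c ^ δ * (q ^ m)⁻¹‖ ≤ ‖τ‖ / 2 := by
      rw [norm_mul, norm_inv, norm_pow q, mul_inv_le_iff₀ hqm]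
      rw [inv_mul_le_iff₀ (by positivity)] at h1
      linarith
    have h3 := norm_sub_norm_le τ (c ^ δ * (q ^ m)⁻¹)
    rw [norm_sub_rev] at h3
    linarith
  · exact (min_le_left _ _).trans
      (hc3 n (Finset.mem_filter.mpr ⟨Finset.mem_Icc.mpr ⟨h', h⟩, hn⟩)).le

/-- By the gap, a direction close to `ξ` can only be resonant at an index already resonant at `ξ`.
Then `c^δ = ξ^δ`, which has finitely many solutions. -/
theorem eventually_nonresonant {q : ℂ} (hq : 1 < ‖q‖) {δ : ℕ} (hδ : 0 < δ) {τ : ℂ} (hτ : τ ≠ 0)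
    {ξ : ℂ} (hξ : ξ ≠ 0) : ∀ᶠ c in 𝓝[≠] ξ, ∀ n : ℤ, c ^ δ * q ^ n ≠ τ := by
  have hq0 := ne_zero_of_one_lt_norm hq
  obtain ⟨d, hd, h⟩ := exists_gap hq δ hτ hξ
  have h1 : ∀ᶠ c in 𝓝[≠] ξ, c ^ δ ≠ ξ ^ δ := by
    have hfin : {c : ℂ | c ^ δ = ξ ^ δ}.Finite := by
      have h2 := (Polynomial.X ^ δ - Polynomial.C (ξ ^ δ)).rootSet_finite ℂ
      refine h2.subset fun c hc => ?_
      rw [Polynomial.mem_rootSet]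
      refine ⟨Polynomial.X_pow_sub_C_ne_zero hδ _, ?_⟩
      have : c ^ δ = ξ ^ δ := hc
      simp [this]
    have := (hfin.subset Set.sdiff_subset : ({c : ℂ | c ^ δ = ξ ^ δ} \ {ξ}).Finite).isClosed
    have h3 := this.isOpen_compl.mem_nhds (x := ξ) (by simp)
    filter_upwards [nhdsWithin_le_nhds h3, self_mem_nhdsWithin] with c hc hc' he
    exact hc ⟨he, hc'⟩
  filter_upwards [nhdsWithin_le_nhds h, h1] with c hc hc1 n hn
  by_cases hn' : ξ ^ δ * q ^ n = τ
  · exact hc1 (mul_right_cancel₀ (zpow_ne_zero n hq0) (hn.trans hn'.symm))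
  · have := hc n hn'
    rw [hn, sub_self, norm_zero] at this
    linarith

theorem rapidlySummable_solCoeff {q : ℂ} (hq : 1 < ‖q‖) {δ : ℕ} {T : Module.End ℂ E} {τ : ℂ}
    (hτ : τ ≠ 0) (hT : IsNilpotent (T - algebraMap ℂ _ τ)) (U : Fin δ → E) {c : ℂ} (hc : c ≠ 0)
    (hcr : ∀ n : ℤ, c ^ δ * q ^ n ≠ τ) : RapidlySummable (solCoeff q T U c) := by
  obtain ⟨d, hd, hgap⟩ := exists_gap hq δ hτ hc
  obtain ⟨C, hC⟩ := exists_norm_ring_inverse_le hT hd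
  exact (rapidlySummable_rhsCoeff hq U hc).of_norm_le C fun n =>
    hC _ (hgap.self_of_nhds n (hcr n)) _

theorem differentiableAt_tsum_solCoeff {q : ℂ} (hq : 1 < ‖q‖) {δ : ℕ} {T : Module.End ℂ E} {τ : ℂ}
    (hτ : τ ≠ 0) (hT : IsNilpotent (T - algebraMap ℂ _ τ)) (U : Fin δ → E) {c : ℂ} (hc : c ≠ 0)
    (hcr : ∀ n : ℤ, c ^ δ * q ^ n ≠ τ) {z : ℂ} (hz : z ≠ 0) :
    DifferentiableAt ℂ (fun z => ∑' n : ℤ, z ^ n • solCoeff q T U c n) z := by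
  have := FiniteDimensional.complete ℂ E
  exact (rapidlySummable_solCoeff hq hτ hT U hc hcr).differentiableAt hz

theorem theta_mul_div_pow {q : ℂ} (hq : 1 < ‖q‖) (δ : ℕ) {c z : ℂ} (hc : c ≠ 0) (hz : z ≠ 0) :
    theta q (q * z / c) ^ δ = (z / c) ^ δ * theta q (z / c) ^ δ := by
  rw [mul_div_assoc, theta_mul hq (div_ne_zero hz hc), mul_pow]

theorem qSol_equation {q : ℂ} (hq : 1 < ‖q‖) {δ : ℕ} {T : Module.End ℂ E} {τ : ℂ}
    (hτ : τ ≠ 0) (hT : IsNilpotent (T - algebraMap ℂ _ τ)) (U : Fin δ → E) {c : ℂ} (hc : c ≠ 0)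
    (hcr : ∀ n : ℤ, c ^ δ * q ^ n ≠ τ) {z : ℂ} (hz : z ≠ 0) (hzc : z ∉ spiral q (-c)) :
    z ^ δ • qSol q T U c (q * z) = T (qSol q T U c z) + ∑ k : Fin δ, z ^ (k : ℕ) • U k := by
  have := FiniteDimensional.complete ℂ E
  have hq0 := ne_zero_of_one_lt_norm hq
  have hs := rapidlySummable_solCoeff hq hτ hT U hc hcr
  have hθ : theta q (z / c) ^ δ ≠ 0 := pow_ne_zero _ (theta_div_ne_zero hq hc hz hzc)
  -- The equation of the numerator, true coefficient by coefficient by the definition of `solCoeff`.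
  have h1 : c ^ δ • ∑' n : ℤ, (q * z) ^ n • solCoeff q T U c n =
      T (∑' n : ℤ, z ^ n • solCoeff q T U c n) +
        theta q (z / c) ^ δ • ∑ k : Fin δ, z ^ (k : ℕ) • U k := by
    have hTs : T (∑' n : ℤ, z ^ n • solCoeff q T U c n) =
        ∑' n : ℤ, T (z ^ n • solCoeff q T U c n) :=
      (Module.End.toContinuousLinearMap (𝕜 := ℂ) E T).map_tsum (hs.summable hz)
    have hTS : Summable fun n : ℤ => T (z ^ n • solCoeff q T U c n) :=
      (Module.End.toContinuousLinearMap (𝕜 := ℂ) E T).summable (hs.summable hz)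
    rw [← tsum_rhsCoeff hq U hc hz, hTs, ← hTS.tsum_add
      ((rapidlySummable_rhsCoeff hq U hc).summable hz), ← (hs.summable
      (mul_ne_zero hq0 hz)).tsum_const_smul]
    refine tsum_congr fun n => ?_
    have h2 := congrArg (fun S : Module.End ℂ E => S (rhsCoeff q U c n))
      (Ring.mul_inverse_cancel _ (isUnit_algebraMap_sub hT (hcr n)))
    simp only [Module.End.mul_apply, LinearMap.sub_apply, Module.algebraMap_end_apply,
      Module.End.one_apply] at h2
    change (c ^ δ * q ^ n) • solCoeff q T U c n - T (solCoeff q T U c n) = _ at h2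
    rw [← h2, map_smul, smul_sub, add_sub_cancel, mul_zpow, smul_smul, smul_smul]
    congr 1
    ring
  have h3 : qSol q T U c (q * z) = ((z / c) ^ δ * theta q (z / c) ^ δ)⁻¹ • (c ^ δ)⁻¹ • c ^ δ •
      ∑' n : ℤ, (q * z) ^ n • solCoeff q T U c n := by
    rw [qSol, theta_mul_div_pow hq δ hc hz, inv_smul_smul₀ (pow_ne_zero δ hc)]
  rw [h3, h1, smul_smul, smul_smul, qSol, map_smul]
  have h4 : z ^ δ * ((z / c) ^ δ * theta q (z / c) ^ δ)⁻¹ * (c ^ δ)⁻¹ =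
      (theta q (z / c) ^ δ)⁻¹ := by
    have := pow_ne_zero δ hc
    have := pow_ne_zero δ hz
    rw [div_pow]
    field_simp
  rw [h4, smul_add, inv_smul_smul₀ hθ]

/-- A meromorphic function with poles of order at most `δ` on `[-c;q]` is a quotient of a function
holomorphic on the punctured plane by `θ(z/c)^δ`. -/
theorem exists_differentiable_numerator {q : ℂ} (hq : 1 < ‖q‖) (δ : ℕ) {c : ℂ} (hc : c ≠ 0)
    {f : ℂ → ℂ} (h1 : ∀ z, z ≠ 0 → z ∉ spiral q (-c) → AnalyticAt ℂ f z)
    (h2 : ∀ z ∈ spiral q (-c), MeromorphicAt f z ∧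
      ((-(δ : ℤ) : ℤ) : WithTop ℤ) ≤ meromorphicOrderAt f z) :
    ∃ g : ℂ → ℂ, (∀ z ≠ 0, DifferentiableAt ℂ g z) ∧
      ∀ z, z ≠ 0 → z ∉ spiral q (-c) → f z = (theta q (z / c) ^ δ)⁻¹ * g z := by
  have hθ : ∀ z, z ≠ 0 → AnalyticAt ℂ (fun z => theta q (z / c)) z := fun z hz =>
    analyticAt_theta_div hq hc hz
  set φ : ℂ → ℂ := fun z => theta q (z / c) ^ δ * f z with hφ
  have hmer : MeromorphicOn φ {0}ᶜ := fun z hz => by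
    refine ((hθ z hz).pow δ).meromorphicAt.mul ?_
    by_cases h : z ∈ spiral q (-c)
    · exact (h2 z h).1
    · exact (h1 z hz h).meromorphicAt
  -- On the spiral `θ(z/c)^δ` has a zero of order `δ`, so the product has nonnegative order
  -- everywhere. Passing to the normal form corrects its values at the removable singularities.
  have hnf := meromorphicNFOn_toMeromorphicNFOn φ {0}ᶜ
  have han : ∀ z, z ≠ 0 → AnalyticAt ℂ (toMeromorphicNFOn φ {0}ᶜ) z := by
    intro z hz
    refine (hnf (show z ∈ ({0}ᶜ : Set ℂ) from hz)).meromorphicOrderAt_nonneg_iff_analyticAt.mp ?_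
    rw [meromorphicOrderAt_toMeromorphicNFOn hmer hz]
    by_cases h : z ∈ spiral q (-c)
    · have h3 := meromorphicOrderAt_mul ((hθ z hz).pow δ).meromorphicAt (h2 z h).1
      have h4 : meromorphicOrderAt ((fun z => theta q (z / c)) ^ δ) z = ((δ : ℤ) : WithTop ℤ) := by
        rw [meromorphicOrderAt_pow (hθ z hz).meromorphicAt, (meromorphicOrderAt_theta_div hq hc h).2]
        simp
      rw [h4] at h3
      change _ ≤ meromorphicOrderAt ((fun z => theta q (z / c)) ^ δ * f) z
      rw [h3]
      calc (0 : WithTop ℤ) = ((δ : ℤ) : WithTop ℤ) + ((-(δ : ℤ) : ℤ) : WithTop ℤ) := by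
            rw [← WithTop.coe_add, add_neg_cancel]; rfl
        _ ≤ _ := by gcongr; exact (h2 z h).2
    · exact (((hθ z hz).pow δ).mul (h1 z hz h)).meromorphicOrderAt_nonneg
  refine ⟨toMeromorphicNFOn φ {0}ᶜ, fun z hz => (han z hz).differentiableAt, fun z hz h => ?_⟩
  have hzφ : AnalyticAt ℂ φ z := ((hθ z hz).pow δ).mul (h1 z hz h)
  rw [toMeromorphicNFOn_eq_toMeromorphicNFAt hmer hz,
    toMeromorphicNFAt_eq_self.mpr hzφ.meromorphicNFAt, hφ,
    inv_mul_cancel_left₀ (pow_ne_zero _ (theta_div_ne_zero hq hc hz h))]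

/-- The spiral is the zero set of `θ(·/c)`, so its discreteness in `ℂ^*` follows from the isolation
of zeros. -/
theorem eventually_notMem_spiral {q : ℂ} (hq : 1 < ‖q‖) {c z : ℂ} (hc : c ≠ 0) (hz : z ≠ 0) :
    ∀ᶠ w in 𝓝[≠] z, w ∉ spiral q (-c) := by
  by_cases h : z ∈ spiral q (-c)
  · obtain ⟨h1, h2⟩ := meromorphicOrderAt_theta_div hq hc h
    have h3 := (meromorphicOrderAt_ne_top_iff_eventually_ne_zero h1.meromorphicAt).mp
      (by rw [h2]; exact WithTop.coe_ne_top)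
    filter_upwards [h3] with w hw hws
    refine hw (theta_and_deriv_of_mem_spiral hq ?_).1
    obtain ⟨n, rfl⟩ := hws
    exact ⟨n, by field_simp⟩
  · have h1 := theta_div_ne_zero hq hc hz h
    have h2 : ContinuousAt (fun w => theta q (w / c)) z :=
      (differentiableAt_theta_div hq hc hz).continuousAt
    filter_upwards [nhdsWithin_le_nhds (h2.eventually_ne h1)] with w hw hws
    refine hw (theta_and_deriv_of_mem_spiral hq ?_).1
    obtain ⟨n, rfl⟩ := hws
    exact ⟨n, by field_simp⟩

/-- The homogeneous equation has no solution with poles on `[-c;q]` of order at most `δ`. -/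
theorem eq_zero_of_homogeneous {q : ℂ} (hq : 1 < ‖q‖) {δ : ℕ} {T : Module.End ℂ E} {τ : ℂ}
    (hT : IsNilpotent (T - algebraMap ℂ _ τ)) {c : ℂ} (hc : c ≠ 0)
    (hcr : ∀ n : ℤ, c ^ δ * q ^ n ≠ τ) {f G : ℂ → E} (hG : ∀ z ≠ 0, DifferentiableAt ℂ G z)
    (hfG : ∀ z, z ≠ 0 → z ∉ spiral q (-c) → f z = (theta q (z / c) ^ δ)⁻¹ • G z)
    (hf : ∀ z, z ≠ 0 → z ∉ spiral q (-c) → z ^ δ • f (q * z) = T (f z)) :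
    ∀ z, z ≠ 0 → z ∉ spiral q (-c) → f z = 0 := by
  have := FiniteDimensional.complete ℂ E
  have hq0 := ne_zero_of_one_lt_norm hq
  let e := Module.End.toContinuousLinearMap (𝕜 := ℂ) E
  have hspiral : ∀ z, z ∉ spiral q (-c) → q * z ∉ spiral q (-c) := fun z h h' => by
    obtain ⟨n, hn⟩ := h'
    refine h ⟨n - 1, ?_⟩
    rw [zpow_sub_one₀ hq0, ← mul_assoc, ← hn]
    field_simp
  have hG1 : ∀ z, z ≠ 0 → z ∉ spiral q (-c) → c ^ δ • G (q * z) = T (G z) := fun z hz h => by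
    have hθ := pow_ne_zero δ (theta_div_ne_zero hq hc hz h)
    have h1 := hf z hz h
    rw [hfG z hz h, hfG _ (mul_ne_zero hq0 hz) (hspiral z h), theta_mul_div_pow hq δ hc hz,
      map_smul] at h1
    have h2 := congrArg (fun v => theta q (z / c) ^ δ • v) h1
    simp only [smul_inv_smul₀ hθ] at h2
    rw [← h2, smul_smul, smul_smul]
    congr 1
    have := pow_ne_zero δ hc
    have := pow_ne_zero δ hz
    rw [div_pow]
    field_simp
  -- The equation extends across the spiral by continuity of `G`, the spiral being discrete.
  have hG2 : ∀ z ≠ 0, c ^ δ • G (q * z) = T (G z) := fun z hz => by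
    have h1 : ContinuousAt (fun z => c ^ δ • G (q * z)) z := by
      refine ContinuousAt.const_smul ?_ (c ^ δ)
      exact ContinuousAt.comp' (f := fun z => q * z) (hG _ (mul_ne_zero hq0 hz)).continuousAt
        (continuous_const.mul continuous_id).continuousAt
    have h2 : ContinuousAt (fun z => T (G z)) z :=
      ContinuousAt.comp' (f := G) (g := T) (e T).continuous.continuousAt (hG z hz).continuousAt
    refine tendsto_nhds_unique (h1.tendsto.mono_left (nhdsWithin_le_nhds (s := {z}ᶜ)))
      ((h2.tendsto.mono_left nhdsWithin_le_nhds).congr' ?_)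
    filter_upwards [eventually_notMem_spiral hq hc hz,
      nhdsWithin_le_nhds (isOpen_ne.mem_nhds hz)] with w hw hw0
    exact (hG1 w hw0 hw).symm
  set N := T - algebraMap ℂ (Module.End ℂ E) τ with hN
  have hTN : ∀ v, T v = τ • v + N v := fun v => by
    simp [hN, Module.algebraMap_end_apply]
  have hcommN : ∀ k v, (N ^ k) (T v) = T ((N ^ k) v) := fun k v => by
    have : Commute (N ^ k) T :=
      ((Commute.refl T).sub_left (Algebra.commutes τ T : Commute _ _)).pow_left k
    exact congrArg (fun S : Module.End ℂ E => S v) this.eq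
  -- Descending induction on `k`. Once `N^{k+1} G = 0`, each coordinate of `N^k G` solves the scalar
  -- equation `g(qz) = (τ/c^δ) g(z)`, whose multiplier is not a power of `q`. The case `k = 0` is
  -- the one needed.
  have key : ∀ k, ∀ z ≠ 0, (N ^ k) (G z) = 0 := by
    obtain ⟨K, hK⟩ := hT
    have hstep : ∀ k, (∀ z ≠ 0, (N ^ (k + 1)) (G z) = 0) → ∀ z ≠ 0, (N ^ k) (G z) = 0 := by
      intro k ih
      have h1 : ∀ z ≠ 0, (N ^ k) (G (q * z)) = (τ / c ^ δ) • (N ^ k) (G z) := fun z hz => by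
        have h2 := congrArg (N ^ k) (hG2 z hz)
        rw [map_smul, hcommN, hTN, ← Module.End.mul_apply, ← pow_succ', ih z hz, add_zero] at h2
        rw [div_eq_inv_mul, mul_smul, ← h2, inv_smul_smul₀ (pow_ne_zero δ hc)]
      intro z hz
      let b := Module.finBasis ℂ E
      refine b.ext_elem fun i => ?_
      rw [map_zero, Finsupp.zero_apply]
      let ℓ : E →L[ℂ] ℂ := (LinearMap.toContinuousLinearMap (b.coord i)).comp (e (N ^ k))
      refine eq_zero_of_comp_mul_eq_const_mul hq0 (w := τ / c ^ δ) (g := fun z => ℓ (G z))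
        (fun n hn => hcr n ?_) (fun z hz => ?_) (fun z hz => ?_) z hz
      · rw [hn]
        have := pow_ne_zero δ hc
        field_simp
      · exact ℓ.differentiableAt.comp z (hG z hz)
      · have : ∀ z, ℓ (G z) = b.coord i ((N ^ k) (G z)) := fun z => rfl
        rw [this, this, h1 z hz, map_smul, smul_eq_mul]
    have hdown : ∀ j k, j + k = K → ∀ z ≠ 0, (N ^ k) (G z) = 0 := by
      intro j
      induction j with
      | zero =>
        intro k hk z hz
        rw [← hk, zero_add] at hK
        rw [hK]
        rfl
      | succ j ih =>
        intro k hk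
        exact hstep k (ih (k + 1) (by omega))
    intro k z hz
    rcases le_total k K with h | h
    · exact hdown (K - k) k (by omega) z hz
    · obtain ⟨m, rfl⟩ := Nat.exists_eq_add_of_le h
      rw [pow_add, hK, zero_mul]
      rfl
  intro z hz h
  have := key 0 z hz
  rw [pow_zero, Module.End.one_apply] at this
  rw [hfG z hz h, this, smul_zero]

end QDifference

/-! ### The sum as a function of the direction of summation -/

section Direction

variable {E : Type*} [NormedAddCommGroup E] [NormedSpace ℂ E]

theorem analyticAt_rhsCoeff (q : ℂ) {δ : ℕ} (U : Fin δ → E) {c : ℂ} (hc : c ≠ 0) (n : ℤ) :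
    AnalyticAt ℂ (fun c => rhsCoeff q U c n) c := by
  refine Finset.analyticAt_fun_sum _ fun k _ => ?_
  exact (((analyticAt_inv hc).zpow (inv_ne_zero hc)).mul analyticAt_const).smul analyticAt_const

/-- The powers of `q` have distinct moduli; thus at most one term of the series is singular at a
given direction. -/
theorem zpow_right_unique {q : ℂ} (hq : 1 < ‖q‖) {x τ : ℂ} (hx : x ≠ 0) {m n : ℤ}
    (hm : x * q ^ m = τ) (hn : x * q ^ n = τ) : m = n := by
  have h1 := mul_left_cancel₀ hx (hm.trans hn.symm)
  have h2 := congrArg norm h1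
  rw [norm_zpow, norm_zpow] at h2
  exact zpow_right_injective₀ (by linarith) hq.ne' h2

variable [FiniteDimensional ℂ E]

theorem analyticAt_solCoeff {q : ℂ} {δ : ℕ} {T : Module.End ℂ E} {τ : ℂ}
    (hT : IsNilpotent (T - algebraMap ℂ _ τ)) (U : Fin δ → E) {c : ℂ} (hc : c ≠ 0) {n : ℤ}
    (hcr : c ^ δ * q ^ n ≠ τ) : AnalyticAt ℂ (fun c => solCoeff q T U c n) c := by
  refine analyticAt_ring_inverse_apply (fun v => ?_) (isUnit_algebraMap_sub hT hcr)
    (analyticAt_rhsCoeff q U hc n)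
  simp only [LinearMap.sub_apply, Module.algebraMap_end_apply]
  exact (((analyticAt_id.pow δ).mul analyticAt_const).smul analyticAt_const).sub analyticAt_const

theorem norm_zpow_inv_le {ξ c : ℂ} (hξ : ξ ≠ 0) (h1 : ‖ξ‖ / 2 < ‖c‖) (h2 : ‖c‖ < 2 * ‖ξ‖) (n : ℤ) :
    ‖c⁻¹ ^ n‖ ≤ (2 * ‖ξ‖)⁻¹ ^ n + (‖ξ‖ / 2)⁻¹ ^ n := by
  have hx := norm_pos_iff.mpr hξ
  rw [norm_zpow, norm_inv]
  exact zpow_le_add (by positivity) (inv_anti₀ (by linarith) h2.le)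
    (inv_anti₀ (by positivity) h1.le) n

omit [FiniteDimensional ℂ E] in
-- A majorant independent of `c` in an annulus around `|ξ|`, obtained by adding the bounds on the
-- two boundary circles.
theorem exists_norm_rhsCoeff_le {q : ℂ} (hq : 1 < ‖q‖) {δ : ℕ} (U : Fin δ → E) {ξ a : ℂ}
    (hξ : ξ ≠ 0) (ha : a ≠ 0) : ∃ u : ℤ → ℝ, Summable u ∧ ∀ c : ℂ, ‖ξ‖ / 2 < ‖c‖ →
      ‖c‖ < 2 * ‖ξ‖ → ∀ n, ‖a ^ n • rhsCoeff q U c n‖ ≤ u n := by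
  have hx := norm_pos_iff.mpr hξ
  have ht := (thetaPowCoeff_spec hq δ).1
  have key : ∀ ρ : ℝ, 0 < ρ → ∀ k : Fin δ, Summable fun n : ℤ =>
      ρ⁻¹ ^ (n - (k : ℤ)) * ‖thetaPowCoeff q δ (n - k)‖ * ‖U k‖ * ‖a‖ ^ n := by
    intro ρ hρ k
    have hρ' : (ρ : ℂ) ≠ 0 := by exact_mod_cast hρ.ne'
    refine (rapidlySummable_rhsCoeff_term hq (δ := δ) (U k) hρ' k ‖a‖
      (norm_pos_iff.mpr ha)).congr fun n => ?_
    rw [norm_smul, norm_mul, norm_zpow, norm_inv, Complex.norm_real, Real.norm_of_nonneg hρ.le]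
  refine ⟨fun n => ∑ k : Fin δ,
    ((2 * ‖ξ‖)⁻¹ ^ (n - (k : ℤ)) * ‖thetaPowCoeff q δ (n - k)‖ * ‖U k‖ * ‖a‖ ^ n +
    (‖ξ‖ / 2)⁻¹ ^ (n - (k : ℤ)) * ‖thetaPowCoeff q δ (n - k)‖ * ‖U k‖ * ‖a‖ ^ n),
    summable_sum fun k _ => (key _ (by positivity) k).add (key _ (by positivity) k),
    fun c h1 h2 n => ?_⟩
  rw [rhsCoeff, Finset.smul_sum]
  refine (norm_sum_le _ _).trans (Finset.sum_le_sum fun k _ => ?_)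
  have h3 := norm_zpow_inv_le hξ h1 h2 (n - k)
  rw [norm_smul, norm_smul, norm_mul, norm_zpow a, ← add_mul, ← add_mul, ← add_mul, mul_comm]
  gcongr

/-- The part of the series which is regular at `c = ξ`. -/
theorem analyticAt_tsum_solCoeff {q : ℂ} (hq : 1 < ‖q‖) {δ : ℕ} {T : Module.End ℂ E} {τ : ℂ}
    (hτ : τ ≠ 0) (hT : IsNilpotent (T - algebraMap ℂ _ τ)) (U : Fin δ → E) {ξ a : ℂ}
    (hξ : ξ ≠ 0) (ha : a ≠ 0) {s : Set ℤ} [DecidablePred (· ∈ s)]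
    (hs : ∀ n, n ∉ s → ξ ^ δ * q ^ n ≠ τ) :
    AnalyticAt ℂ (fun c => ∑' n : ℤ, if n ∈ s then 0 else a ^ n • solCoeff q T U c n) ξ := by
  have := FiniteDimensional.complete ℂ E
  have hx := norm_pos_iff.mpr hξ
  obtain ⟨d, hd, hgap⟩ := exists_gap hq δ hτ hξ
  obtain ⟨C, hC⟩ := exists_norm_ring_inverse_le hT hd
  obtain ⟨u, hu, hle⟩ := exists_norm_rhsCoeff_le hq U hξ ha
  have hnear : ∀ᶠ c in 𝓝 ξ, ‖ξ‖ / 2 < ‖c‖ ∧ ‖c‖ < 2 * ‖ξ‖ :=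
    (continuous_norm.continuousAt.eventually_const_lt (by linarith)).and
      (continuous_norm.continuousAt.eventually_lt_const (by linarith))
  obtain ⟨r, hr, hball⟩ := Metric.eventually_nhds_iff_ball.mp (hgap.and hnear)
  have hC0 : ∀ n : ℤ, 0 ≤ u n := fun n =>
    (norm_nonneg _).trans (hle ξ (by linarith) (by linarith) n)
  -- The resolvent constant `C` is not known to be nonnegative, hence `max C 0`.
  have hd1 := Complex.differentiableOn_tsum_of_summable_norm (U := Metric.ball ξ r)
    (F := fun n c => if n ∈ s then 0 else a ^ n • solCoeff q T U c n)
    (hu.mul_left (max C 0)) (fun n c hc => ?_) Metric.isOpen_ball (fun n c hc => ?_)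
  · exact hd1.analyticAt (Metric.ball_mem_nhds ξ hr)
  · by_cases hn : n ∈ s
    · simp only [if_pos hn]
      exact differentiableWithinAt_const _
    · simp only [if_neg hn]
      obtain ⟨h1, h2, -⟩ := hball c hc
      have hc0 : c ≠ 0 := norm_pos_iff.mp (by linarith)
      have hcr : c ^ δ * q ^ n ≠ τ := fun h => by
        have := h1 n (hs n hn)
        rw [h, sub_self, norm_zero] at this
        linarith
      exact ((analyticAt_solCoeff hT U hc0 hcr).differentiableAt.const_smul
        (a ^ n)).differentiableWithinAt
  · obtain ⟨h1, h2, h3⟩ := hball c hc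
    by_cases hn : n ∈ s
    · simp only [if_pos hn, norm_zero]
      exact mul_nonneg (le_max_right _ _) (hC0 n)
    · simp only [if_neg hn, solCoeff]
      rw [← map_smul]
      refine (hC _ (h1 n (hs n hn)) _).trans ?_
      exact mul_le_mul (le_max_left _ _) (hle c h2 h3 n) (norm_nonneg _) (le_max_right _ _)

theorem analyticAt_inv_theta_pow {q : ℂ} (hq : 1 < ‖q‖) (δ : ℕ) {ξ a : ℂ} (hξ : ξ ≠ 0) (ha : a ≠ 0)
    (haξ : a ∉ spiral q (-ξ)) :
    AnalyticAt ℂ (fun c => (theta q (a / c) ^ δ)⁻¹) ξ ∧ (theta q (a / ξ) ^ δ)⁻¹ ≠ 0 := by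
  have hθ := theta_div_ne_zero hq hξ ha haξ
  have h1 : AnalyticAt ℂ (theta q) (a / ξ) := by
    have := analyticAt_theta_div hq one_ne_zero (div_ne_zero ha hξ)
    simpa using this
  have h2 : AnalyticAt ℂ (fun c => theta q (a / c)) ξ :=
    AnalyticAt.fun_comp (g := theta q) (f := fun c => a / c) h1
      (analyticAt_const.div analyticAt_id hξ)
  exact ⟨(h2.pow δ).inv (pow_ne_zero _ hθ), inv_ne_zero (pow_ne_zero _ hθ)⟩

/-- Near `ξ`, the sum is regular up to the term which is singular at `ξ`. -/
theorem exists_qSol_eq {q : ℂ} (hq : 1 < ‖q‖) {δ : ℕ} (hδ : 0 < δ) {T : Module.End ℂ E} {τ : ℂ}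
    (hτ : τ ≠ 0) (hT : IsNilpotent (T - algebraMap ℂ _ τ)) (U : Fin δ → E) {ξ a : ℂ}
    (hξ : ξ ≠ 0) (ha : a ≠ 0) (haξ : a ∉ spiral q (-ξ)) {n : ℤ}
    (hn : ∀ m, m ≠ n → ξ ^ δ * q ^ m ≠ τ) :
    ∃ g : ℂ → E, AnalyticAt ℂ g ξ ∧ ∀ᶠ c in 𝓝[≠] ξ, qSol q T U c a =
      (theta q (a / c) ^ δ)⁻¹ • a ^ n • solCoeff q T U c n + g c := by
  classical
  have := FiniteDimensional.complete ℂ E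
  refine ⟨_, (analyticAt_inv_theta_pow hq δ hξ ha haξ).1.smul
    (analyticAt_tsum_solCoeff hq hτ hT U hξ ha (s := {n}) fun m hm => hn m hm), ?_⟩
  filter_upwards [eventually_nonresonant hq hδ hτ hξ,
    nhdsWithin_le_nhds (isOpen_ne.mem_nhds hξ)] with c hc hc0
  rw [qSol, ((rapidlySummable_solCoeff hq hτ hT U hc0 hc).summable ha).tsum_eq_add_tsum_ite n,
    smul_add]
  rfl

/-- The one possibly singular term is a finite sum of negative powers of `c^δ q^n - τ` with analytic
coefficients. -/
theorem meromorphicAt_qSol {q : ℂ} (hq : 1 < ‖q‖) {δ : ℕ} (hδ : 0 < δ) {T : Module.End ℂ E} {τ : ℂ}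
    (hτ : τ ≠ 0) (hT : IsNilpotent (T - algebraMap ℂ _ τ)) (U : Fin δ → E) {ξ a : ℂ}
    (hξ : ξ ≠ 0) (ha : a ≠ 0) (haξ : a ∉ spiral q (-ξ)) :
    MeromorphicAt (fun c => qSol q T U c a) ξ := by
  obtain ⟨n, hn⟩ : ∃ n : ℤ, ∀ m, m ≠ n → ξ ^ δ * q ^ m ≠ τ := by
    by_cases h : ∃ n : ℤ, ξ ^ δ * q ^ n = τ
    · obtain ⟨n, hn⟩ := h
      exact ⟨n, fun m hm h' => hm (zpow_right_unique hq (pow_ne_zero δ hξ) h' hn)⟩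
    · push Not at h
      -- No term is singular at a direction which is not prohibited, so any index may be singled
      -- out.
      exact ⟨0, fun m _ => h m⟩
  obtain ⟨g, hg, heq⟩ := exists_qSol_eq hq hδ hτ hT U hξ ha haξ hn
  obtain ⟨K, hK⟩ := hT
  have h1 : MeromorphicAt (fun c => (theta q (a / c) ^ δ)⁻¹ • a ^ n •
      ∑ k ∈ Finset.range K, ((c ^ δ * q ^ n - τ) ^ (k + 1))⁻¹ •
        ((T - algebraMap ℂ (Module.End ℂ E) τ) ^ k) (rhsCoeff q U c n)) ξ := by
    refine (analyticAt_inv_theta_pow hq δ hξ ha haξ).1.meromorphicAt.smul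
      ((MeromorphicAt.const _ ξ).smul ?_)
    refine MeromorphicAt.fun_sum fun k _ => MeromorphicAt.smul ?_
      (analyticAt_linearMap_apply _ (analyticAt_rhsCoeff q U hξ n)).meromorphicAt
    exact (((((analyticAt_id.pow δ).mul analyticAt_const).sub analyticAt_const).pow
      (k + 1)).meromorphicAt).inv
  refine (h1.add hg.meromorphicAt).congr ?_
  filter_upwards [heq, eventually_nonresonant hq hδ hτ hξ] with c hc hcr
  rw [hc, solCoeff, ring_inverse_sub_eq_sum hK (hcr n), LinearMap.sum_apply]
  rfl

/-- The residue of the sum at a singular direction `ξ`. -/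
theorem hasResidue_qSol {q : ℂ} (hq : 1 < ‖q‖) {δ : ℕ} (hδ : 0 < δ) {T : Module.End ℂ E} {τ : ℂ}
    (hτ : τ ≠ 0) (hT : IsNilpotent (T - algebraMap ℂ _ τ)) (U : Fin δ → E) {ξ a : ℂ}
    (hξ : ξ ≠ 0) (ha : a ≠ 0) (haξ : a ∉ spiral q (-ξ)) {n : ℤ} (hn : ξ ^ δ * q ^ n = τ)
    {L : Module.End ℂ E} (hL : IsNilpotent (L - algebraMap ℂ _ ξ)) (hLT : q ^ n • L ^ δ = T)
    {H : Module.End ℂ E}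
    (hH : ∀ v, HasResidue (fun c => ((theta q (a / c) ^ δ)⁻¹ * ((a / (q * c)) ^ n)) •
      resolvent L c v) ξ (H v)) :
    HasResidue (fun c => qSol q T U c a) ξ (H (Ring.inverse ((δ : ℂ) • L ^ (δ - 1))
      (∑ k : Fin δ, (L ^ (k : ℕ)) (thetaPowCoeff q δ (n - k) • U k)))) := by
  have := FiniteDimensional.complete ℂ E
  have hq0 := ne_zero_of_one_lt_norm hq
  obtain ⟨g, hg, heq⟩ := exists_qSol_eq hq hδ hτ hT U hξ ha haξ
    fun m hm h' => hm (zpow_right_unique hq (pow_ne_zero δ hξ) h' hn)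
  -- The weight `(a/(qc))^n` collects `a^n` from the series, `q^{-n}` from `c^δ q^n - T = q^n (c^δ -
  -- L^δ)`, and `c^{-n}` from the coefficients of `θ(z/c)^δ`. The factors `c^k` left over form the
  -- polynomial `∑ c^k V_k`.
  have hh : AnalyticAt ℂ (fun c => (theta q (a / c) ^ δ)⁻¹ * ((a / (q * c)) ^ n)) ξ := by
    refine (analyticAt_inv_theta_pow hq δ hξ ha haξ).1.mul (AnalyticAt.zpow ?_ ?_)
    · exact analyticAt_const.div (analyticAt_const.mul analyticAt_id) (mul_ne_zero hq0 hξ)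
    · exact div_ne_zero ha (mul_ne_zero hq0 hξ)
  have h1 := (hasResidue_ring_inverse_pow_sub hδ hξ hL hh hH
    fun k => thetaPowCoeff q δ (n - k) • U k).add (hasResidue_of_analyticAt hg)
  rw [add_zero] at h1
  refine h1.congr ?_
  filter_upwards [heq, nhdsWithin_le_nhds (isOpen_ne.mem_nhds hξ)] with c hc hc0
  have hc0 : c ≠ 0 := hc0
  rw [hc, mul_smul]
  congr 2
  have h2 : algebraMap ℂ (Module.End ℂ E) (c ^ δ * q ^ n) - T =
      q ^ n • (algebraMap ℂ (Module.End ℂ E) (c ^ δ) - L ^ δ) := by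
    rw [smul_sub, hLT, Algebra.smul_def, ← map_mul, mul_comm]
  have h3 : ∀ X : Module.End ℂ E, Ring.inverse (q ^ n • X) = (q ^ n)⁻¹ • Ring.inverse X := by
    intro X
    have hqn := zpow_ne_zero n hq0
    by_cases hX : IsUnit X
    · refine ring_inverse_eq_of_mul_eq_one ?_ ?_
      · rw [smul_mul_smul_comm, mul_inv_cancel₀ hqn, one_smul, Ring.mul_inverse_cancel _ hX]
      · rw [smul_mul_smul_comm, inv_mul_cancel₀ hqn, one_smul, Ring.inverse_mul_cancel _ hX]
    · rw [Ring.inverse_non_unit _ hX, smul_zero, Ring.inverse_non_unit]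
      intro h
      refine hX ?_
      have := ((IsUnit.mk0 _ (inv_ne_zero hqn)).map (algebraMap ℂ (Module.End ℂ E))).mul h
      rwa [← Algebra.smul_def, inv_smul_smul₀ hqn] at this
  rw [solCoeff, h2, h3, rhsCoeff, LinearMap.smul_apply, smul_smul, map_sum, map_sum,
    Finset.smul_sum, Finset.smul_sum]
  refine Finset.sum_congr rfl fun k _ => ?_
  rw [map_smul, map_smul, map_smul, smul_smul, smul_smul, smul_smul]
  congr 1
  rw [div_zpow, mul_zpow, zpow_sub₀ (inv_ne_zero hc0), zpow_natCast, inv_zpow, inv_pow]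
  have := zpow_ne_zero n hc0
  have := zpow_ne_zero n hq0
  have := pow_ne_zero (k : ℕ) hc0
  field_simp

end Direction

/-! ### Normal forms of the equation `V(z) + z^δ F(qz) = T F(z) + U(z)` for meromorphic germs -/

section NormalForm

variable {E : Type*} [NormedAddCommGroup E] [NormedSpace ℂ E]

theorem exists_coeff_of_analyticAt {f : ℂ → E} (hf : AnalyticAt ℂ f 0) :
    ∃ (a : ℕ → E) (C x : ℝ), 0 < C ∧ 0 < x ∧ (∀ n, ‖a n‖ ≤ C * x ^ n) ∧
      ∀ᶠ z in 𝓝 0, HasSum (fun n : ℕ => z ^ n • a n) (f z) := by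
  obtain ⟨p, hp⟩ := hf
  obtain ⟨C, x, hC, hx, h⟩ := p.le_mul_pow_of_radius_pos hp.radius_pos
  refine ⟨p.coeff, C, x, hC, hx, fun n => ?_, ?_⟩
  · rw [← FormalMultilinearSeries.norm_apply_eq_norm_coef]
    exact h n
  · simpa using hasFPowerSeriesAt_iff'.mp hp

theorem coeff_eq_zero_of_hasSum_zero {a : ℕ → E}
    (h : ∀ᶠ z in 𝓝[≠] (0 : ℂ), HasSum (fun n : ℕ => z ^ n • a n) 0) (n : ℕ) : a n = 0 := by
  let p : FormalMultilinearSeries ℂ ℂ E := fun n => ContinuousMultilinearMap.mkPiRing ℂ (Fin n) (a n)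
  have hp : ∀ n, p.coeff n = a n := fun n => by
    simp [p, FormalMultilinearSeries.coeff]
  have h1 : HasFPowerSeriesAt (fun z => ∑' n : ℕ, z ^ n • a n) p 0 := by
    rw [hasFPowerSeriesAt_iff']
    simp only [hp, sub_zero]
    rw [eventually_nhdsWithin_iff] at h
    filter_upwards [h] with z hz
    by_cases hz0 : z = 0
    · subst hz0
      refine Summable.hasSum (summable_of_ne_finset_zero (s := {0}) fun n hn => ?_)
      rw [zero_pow (by simpa using hn), zero_smul]
    · exact (hz hz0).summable.hasSum
  have h2 : (fun z : ℂ => ∑' n : ℕ, z ^ n • a n) =ᶠ[𝓝 0] 0 := by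
    have h3 : (fun z : ℂ => ∑' n : ℕ, z ^ n • a n) =ᶠ[𝓝[≠] 0] 0 := by
      filter_upwards [h] with z hz using hz.tsum_eq
    exact h1.continuousAt.eventuallyEq_nhds_iff_eventuallyEq_nhdsNE continuousAt_const |>.mp h3
  rw [← hp n, h1.eq_zero_of_eventually h2]
  rfl

theorem hasSum_shift {a : ℕ → E} {z : ℂ} {s : E} (h : HasSum (fun n : ℕ => z ^ n • a n) s) (k : ℕ) :
    HasSum (fun n : ℕ => z ^ n • (if n < k then 0 else a (n - k))) (z ^ k • s) := by
  rw [← hasSum_nat_add_iff' k, Finset.sum_eq_zero, sub_zero]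
  · refine (h.const_smul (z ^ k)).congr_fun fun n => ?_
    rw [if_neg (by omega), Nat.add_sub_cancel, smul_smul, pow_add, mul_comm]
  · intro n hn
    rw [if_pos (Finset.mem_range.mp hn), smul_zero]

theorem hasSum_fin {δ : ℕ} (D : Fin δ → E) (z : ℂ) :
    HasSum (fun n : ℕ => z ^ n • (if h : n < δ then D ⟨n, h⟩ else 0))
      (∑ k : Fin δ, z ^ (k : ℕ) • D k) := by
  have h1 : ∑ k : Fin δ, z ^ (k : ℕ) • D k =
      ∑ n ∈ Finset.range δ, z ^ n • (if h : n < δ then D ⟨n, h⟩ else 0) := by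
    rw [← Fin.sum_univ_eq_sum_range (fun n => z ^ n • (if h : n < δ then D ⟨n, h⟩ else 0))]
    exact Finset.sum_congr rfl fun k _ => by simp
  rw [h1]
  refine hasSum_sum_of_ne_finset_zero fun n hn => ?_
  rw [dif_neg (by simpa using hn), smul_zero]

/-- A solution which grows at most geometrically of `q^m f_m = T f_{m+δ}` vanishes. -/
theorem eq_zero_of_geometric_growth {q : ℂ} (hq : 1 < ‖q‖) {δ : ℕ} (hδ : 0 < δ) (T : E →L[ℂ] E)
    {f : ℕ → E} {C x : ℝ} (hf : ∀ n, ‖f n‖ ≤ C * x ^ n)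
    (h : ∀ m, q ^ m • f m = T (f (m + δ))) (m : ℕ) : f m = 0 := by
  have hq0 := ne_zero_of_one_lt_norm hq
  have hle : ∀ m, ‖f m‖ ≤ (‖q‖ ^ m)⁻¹ * (‖T‖ * ‖f (m + δ)‖) := fun m => by
    have h1 := congrArg norm (h m)
    rw [norm_smul, norm_pow] at h1
    rw [le_inv_mul_iff₀ (by positivity), h1]
    exact T.le_opNorm _
  have hev := (tendsto_zpow_neg_mul hq (‖T‖ * x ^ δ)).eventually_le_const
    (show (0 : ℝ) < 1 / 2 by norm_num)
  obtain ⟨M, hM⟩ := hev.exists_forall_of_atTop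
  -- Beyond `M` each use of the recurrence gains a factor `1/2` over the geometric bound. Letting `j
  -- → ∞` kills the tail, and the recurrence then descends to all `m`.
  have hhalf : ∀ j m, M ≤ m → ‖f m‖ ≤ (1 / 2) ^ j * (C * x ^ m) := by
    intro j
    induction j with
    | zero => intro m _; simpa using hf m
    | succ j ih =>
      intro m hm
      calc ‖f m‖ ≤ (‖q‖ ^ m)⁻¹ * (‖T‖ * ‖f (m + δ)‖) := hle m
        _ ≤ (‖q‖ ^ m)⁻¹ * (‖T‖ * ((1 / 2) ^ j * (C * x ^ (m + δ)))) := by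
          gcongr
          exact ih _ (by omega)
        _ = ((‖q‖ ^ m)⁻¹ * (‖T‖ * x ^ δ)) * ((1 / 2) ^ j * (C * x ^ m)) := by
          rw [pow_add]; ring
        _ ≤ (1 / 2) * ((1 / 2) ^ j * (C * x ^ m)) := by
          have : 0 ≤ C * x ^ m := (norm_nonneg _).trans (hf m)
          gcongr
          exact hM m hm
        _ = (1 / 2) ^ (j + 1) * (C * x ^ m) := by ring
  have htail : ∀ m, M ≤ m → f m = 0 := fun m hm => by
    have h1 : Tendsto (fun j : ℕ => (1 / 2 : ℝ) ^ j * (C * x ^ m)) atTop (𝓝 0) := by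
      simpa using (tendsto_pow_atTop_nhds_zero_of_lt_one (r := (1 / 2 : ℝ)) (by norm_num)
        (by norm_num)).mul_const (C * x ^ m)
    exact norm_le_zero_iff.mp (ge_of_tendsto' h1 fun j => hhalf j m hm)
  have hdown : ∀ j m, M ≤ m + j → f m = 0 := by
    intro j
    induction j with
    | zero => exact fun m hm => htail m hm
    | succ j ih =>
      intro m hm
      have := h m
      rw [ih (m + δ) (by omega), map_zero] at this
      exact (smul_eq_zero.mp this).resolve_left (pow_ne_zero _ hq0)
  exact hdown M m (by omega)

variable [FiniteDimensional ℂ E]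

/-- A polynomial normal form which is a coboundary vanishes. -/
theorem normalForm_unique {q : ℂ} (hq : 1 < ‖q‖) {δ : ℕ} (hδ : 0 < δ) {T : Module.End ℂ E}
    (hT : IsUnit T) {D : Fin δ → E} {F : ℂ → E} (hF : MeromorphicAt F 0)
    (h : ∀ᶠ z in 𝓝[≠] (0 : ℂ), z ^ δ • F (q * z) = T (F z) + ∑ k : Fin δ, z ^ (k : ℕ) • D k)
    (k : Fin δ) : D k = 0 := by
  have hq0 := ne_zero_of_one_lt_norm hq
  have hinj : ∀ v, T v = 0 → v = 0 := fun v hv => by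
    have := congrArg (fun S : Module.End ℂ E => S v) (Ring.inverse_mul_cancel T hT)
    simpa [Module.End.mul_apply, hv] using this.symm
  let e := Module.End.toContinuousLinearMap (𝕜 := ℂ) E
  -- The recurrence is written for `g = z^N F`, which is analytic; all degrees are therefore shifted
  -- by `N`.
  obtain ⟨N, hN⟩ := hF
  obtain ⟨g, C, x, hC, hx, hg, hsum⟩ := exists_coeff_of_analyticAt hN
  have hqz : Tendsto (fun z : ℂ => q * z) (𝓝 0) (𝓝 0) := by
    have : Continuous fun z : ℂ => q * z := by fun_prop
    simpa using this.tendsto 0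
  have hz : ∀ᶠ z in 𝓝[≠] (0 : ℂ), HasSum (fun n : ℕ => z ^ n •
      ((if n < δ then 0 else (q ^ N)⁻¹ • q ^ (n - δ) • g (n - δ)) - T (g n) -
        (if n < N then 0 else if h : n - N < δ then D ⟨n - N, h⟩ else 0))) 0 := by
    filter_upwards [h, nhdsWithin_le_nhds hsum, nhdsWithin_le_nhds (hqz.eventually hsum),
      self_mem_nhdsWithin] with z h1 h2 h3 h4
    have h4 : z ≠ 0 := h4
    have s1 : HasSum (fun n : ℕ => z ^ n • ((q ^ N)⁻¹ • q ^ n • g n))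
        ((q ^ N)⁻¹ • ((q * z - 0) ^ N • F (q * z))) := by
      refine (h3.const_smul (q ^ N)⁻¹).congr_fun fun n => ?_
      rw [mul_pow, smul_smul, smul_smul, smul_smul]
      congr 1
      ring
    have s2 : HasSum (fun n : ℕ => z ^ n • T (g n)) (T ((z - 0) ^ N • F z)) := by
      refine ((e T).hasSum h2).congr_fun fun n => ?_
      exact (map_smul T _ _).symm
    have s3 := hasSum_shift (hasSum_fin D z) N
    have s4 := ((hasSum_shift s1 δ).sub s2).sub s3
    have e0 : z ^ δ • (q ^ N)⁻¹ • ((q * z - 0) ^ N • F (q * z)) - T ((z - 0) ^ N • F z) -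
        z ^ N • ∑ k : Fin δ, z ^ (k : ℕ) • D k = 0 := by
      have e1 : z ^ δ • (q ^ N)⁻¹ • ((q * z - 0) ^ N • F (q * z)) =
          z ^ N • z ^ δ • F (q * z) := by
        rw [sub_zero, mul_pow, smul_smul, smul_smul, smul_smul]
        congr 1
        have := pow_ne_zero N hq0
        field_simp
      rw [e1, h1, sub_zero, map_smul, smul_add]
      abel
    rw [e0] at s4
    refine s4.congr_fun fun n => ?_
    rw [smul_sub, smul_sub]
  have hco := coeff_eq_zero_of_hasSum_zero hz
  -- `F` has no pole: below degree `N` the polynomial contributes nothing, and injectivity of `T`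
  -- propagates vanishing upwards.
  have hlow : ∀ n, n < N → g n = 0 := by
    intro n
    induction n using Nat.strong_induction_on with
    | _ n ih =>
      intro hn
      have h1 := hco n
      rw [if_pos hn, sub_zero, sub_eq_zero] at h1
      refine hinj _ (h1.symm.trans ?_)
      split_ifs with h2
      · rfl
      · rw [ih (n - δ) (by omega) (by omega), smul_zero, smul_zero]
  -- In degrees at least `N + δ` the polynomial is exhausted, leaving the recurrence that forbids
  -- geometric growth.
  have hrec : ∀ m, q ^ m • g (N + m) = e T (g (N + (m + δ))) := fun m => by
    have h1 := hco (N + (m + δ))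
    rw [if_neg (by omega), if_neg (by omega), dif_neg (by omega), sub_zero, sub_eq_zero] at h1
    refine Eq.trans ?_ h1
    rw [show N + (m + δ) - δ = N + m by omega, smul_smul, pow_add, inv_mul_cancel_left₀
      (pow_ne_zero _ hq0)]
  have hzero := eq_zero_of_geometric_growth hq hδ (e T) (f := fun m => g (N + m))
    (C := C * x ^ N) (fun n => by rw [mul_assoc, ← pow_add]; exact hg _) hrec
  -- In degree `N + k` both terms coming from `F` now vanish, so only `D k` is left.
  have h1 := hco (N + k)
  rw [if_neg (show ¬ N + (k : ℕ) < N by omega), dif_pos (by omega), hzero k, map_zero, sub_zero]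
    at h1
  have h2 : (if N + (k : ℕ) < δ then (0 : E) else
      (q ^ N)⁻¹ • q ^ (N + (k : ℕ) - δ) • g (N + k - δ)) = 0 := by
    split_ifs with h3
    · rfl
    · rw [hlow _ (by omega), smul_zero, smul_zero]
  rw [h2, zero_sub, neg_eq_zero] at h1
  have h3 : (⟨N + k - N, by omega⟩ : Fin δ) = k := Fin.ext (by simp)
  rwa [h3] at h1

/-- The germ `V` is equivalent to a polynomial of degree `< δ`. -/
def HasNormalForm (q : ℂ) (δ : ℕ) (T : Module.End ℂ E) (V : ℂ → E) : Prop :=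
  ∃ (U : Fin δ → E) (F : ℂ → E), MeromorphicAt F 0 ∧ ∀ᶠ z in 𝓝[≠] (0 : ℂ),
    V z + z ^ δ • F (q * z) = T (F z) + ∑ k : Fin δ, z ^ (k : ℕ) • U k

omit [FiniteDimensional ℂ E] in
theorem HasNormalForm.add {q : ℂ} {δ : ℕ} {T : Module.End ℂ E} {V V' : ℂ → E}
    (h : HasNormalForm q δ T V) (h' : HasNormalForm q δ T V') :
    HasNormalForm q δ T fun z => V z + V' z := by
  obtain ⟨U, F, hF, h⟩ := h
  obtain ⟨U', F', hF', h'⟩ := h'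
  refine ⟨fun k => U k + U' k, fun z => F z + F' z, hF.add hF', ?_⟩
  filter_upwards [h, h'] with z h1 h2
  simp only [smul_add, map_add, Finset.sum_add_distrib]
  rw [add_add_add_comm, h1, h2]
  abel

omit [FiniteDimensional ℂ E] in
theorem HasNormalForm.congr {q : ℂ} {δ : ℕ} {T : Module.End ℂ E} {V V' : ℂ → E}
    (h : HasNormalForm q δ T V) (hV : V =ᶠ[𝓝[≠] 0] V') : HasNormalForm q δ T V' := by
  obtain ⟨U, F, hF, h⟩ := h
  refine ⟨U, F, hF, ?_⟩
  filter_upwards [h, hV] with z h1 h2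
  rw [← h2, h1]

/-! ### Existence of polynomial normal forms. -/

/-- The exponent `δ j(j+1)/2` is quadratic in `j` and beats every geometric growth. -/
theorem exists_summable_weight {q : ℂ} (hq : 1 < ‖q‖) {δ : ℕ} (hδ : 0 < δ) {y : ℝ} (hy : 0 < y) :
    Summable fun j : ℕ => (‖q‖ ^ (δ * ∑ i ∈ Finset.range (j + 1), i))⁻¹ * y ^ j := by
  have hq' : 0 < ‖q‖ := by linarith
  have hpos : ∀ j : ℕ, 0 < (‖q‖ ^ (δ * ∑ i ∈ Finset.range (j + 1), i))⁻¹ * y ^ j := fun j => by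
    positivity
  refine summable_of_ratio_test_tendsto_lt_one zero_lt_one
    (Eventually.of_forall fun j => (hpos j).ne') ?_
  have h1 : Tendsto (fun j : ℕ => (‖q‖ ^ (δ * (j + 1)))⁻¹ * y) atTop (𝓝 0) := by
    have h2 : Tendsto (fun j : ℕ => δ * (j + 1)) atTop atTop :=
      tendsto_atTop_mono (fun j => (Nat.le_succ j).trans (Nat.le_mul_of_pos_left _ hδ)) tendsto_id
    exact (tendsto_zpow_neg_mul hq y).comp h2
  refine h1.congr fun j => ?_
  rw [Real.norm_of_nonneg (hpos _).le, Real.norm_of_nonneg (hpos _).le, eq_div_iff (hpos j).ne',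
    Finset.sum_range_succ _ (j + 1), mul_add, pow_add, mul_inv]
  ring

/-- Iterating `f_m = q^{-m} (T f_{m+δ} - v_{m+δ})` towards infinity gives `f_m = -∑_j w_{m,j} T^j
v_{m+(j+1)δ}`, where `w_{m,j}` is the accumulated product of the factors `q^{-(m+iδ)}` for `0 ≤ i ≤
j`. Its quadratic decay makes the series converge and preserves the geometric rate `x`.
Invertibility of `T` plays no role here. -/
theorem exists_coeff_solution {q : ℂ} (hq : 1 < ‖q‖) {δ : ℕ} (hδ : 0 < δ) (T : E →L[ℂ] E)
    {v : ℕ → E} {C x : ℝ} (hx : 0 < x) (hv : ∀ n, ‖v n‖ ≤ C * x ^ n) :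
    ∃ (f : ℕ → E) (C' : ℝ), (∀ m, ‖f m‖ ≤ C' * x ^ m) ∧
      ∀ m, q ^ m • f m = T (f (m + δ)) - v (m + δ) := by
  have := FiniteDimensional.complete ℂ E
  have hq0 := ne_zero_of_one_lt_norm hq
  have hq' : 0 < ‖q‖ := by linarith
  set w : ℕ → ℕ → ℂ := fun m j =>
    (q ^ (m * (j + 1) + δ * ∑ i ∈ Finset.range (j + 1), i))⁻¹ with hw
  have hw0 : ∀ m, w m 0 = (q ^ m)⁻¹ := fun m => by simp [hw]
  have hws : ∀ m j, w m (j + 1) = (q ^ m)⁻¹ * w (m + δ) j := fun m j => by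
    simp only [hw]
    rw [← mul_inv, ← pow_add, Finset.sum_range_succ _ (j + 1)]
    congr 2
    ring
  have hwle : ∀ m j, ‖w m j‖ ≤ (‖q‖ ^ (δ * ∑ i ∈ Finset.range (j + 1), i))⁻¹ := fun m j => by
    simp only [hw, norm_inv, norm_pow]
    refine inv_anti₀ (by positivity) (pow_le_pow_right₀ hq.le (by omega))
  set S : ℕ → ℝ := fun j =>
    (‖q‖ ^ (δ * ∑ i ∈ Finset.range (j + 1), i))⁻¹ * ((‖T‖ + 1) * x ^ δ) ^ j with hS
  have hSs : Summable S := exists_summable_weight hq hδ (by positivity)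
  have hterm : ∀ m j, ‖w m j • (T ^ j) (v (m + (j + 1) * δ))‖ ≤ C * x ^ δ * x ^ m * S j := by
    intro m j
    have h1 : ‖(T ^ j) (v (m + (j + 1) * δ))‖ ≤ (‖T‖ + 1) ^ j * (C * x ^ (m + (j + 1) * δ)) := by
      refine ((T ^ j).le_opNorm _).trans ?_
      have h2 : ‖T ^ j‖ ≤ (‖T‖ + 1) ^ j := by
        rcases Nat.eq_zero_or_pos j with rfl | hj
        · rw [pow_zero, pow_zero]
          exact ContinuousLinearMap.norm_id_le
        · exact (norm_pow_le' T hj).trans (by gcongr; linarith)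
      exact mul_le_mul h2 (hv _) (norm_nonneg _) (by positivity)
    rw [norm_smul]
    refine (mul_le_mul (hwle m j) h1 (norm_nonneg _) (by positivity)).trans (le_of_eq ?_)
    simp only [hS]
    rw [pow_add, add_mul, one_mul, pow_add, mul_comm j δ, pow_mul x δ j, mul_pow]
    ring
  have hsum : ∀ m, Summable fun j => w m j • (T ^ j) (v (m + (j + 1) * δ)) := fun m =>
    Summable.of_norm_bounded (hSs.mul_left _) (hterm m)
  refine ⟨fun m => -∑' j, w m j • (T ^ j) (v (m + (j + 1) * δ)), C * x ^ δ * ∑' j, S j,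
    fun m => ?_, fun m => ?_⟩
  · rw [norm_neg]
    refine (tsum_of_norm_bounded (hSs.hasSum.mul_left _) (hterm m)).trans (le_of_eq ?_)
    ring
  · beta_reduce
    rw [map_neg, T.map_tsum (hsum _), (hsum m).tsum_eq_zero_add, hw0, pow_zero, smul_neg, smul_add,
      zero_add, one_mul, one_apply_eq_self, smul_inv_smul₀ (pow_ne_zero _ hq0),
      ← ((summable_nat_add_iff 1).mpr (hsum m)).tsum_const_smul, neg_add', sub_eq_add_neg,
      add_comm, sub_eq_add_neg]
    congr 2
    refine tsum_congr fun j => ?_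
    rw [hws, smul_smul, mul_inv_cancel_left₀ (pow_ne_zero _ hq0), map_smul, pow_succ',
      show m + (j + 1 + 1) * δ = m + δ + (j + 1) * δ by ring]
    rfl

/-- The recurrence removes every coefficient of degree at least `δ`; the polynomial is the
discrepancy `v k - T (f k)` left in the lower degrees. -/
theorem hasNormalForm_of_analyticAt {q : ℂ} (hq : 1 < ‖q‖) {δ : ℕ} (hδ : 0 < δ)
    (T : Module.End ℂ E) {V : ℂ → E} (hV : AnalyticAt ℂ V 0) : HasNormalForm q δ T V := by
  have := FiniteDimensional.complete ℂ E
  have hq0 := ne_zero_of_one_lt_norm hq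
  let e := Module.End.toContinuousLinearMap (𝕜 := ℂ) E
  obtain ⟨v, C, x, hC, hx, hv, hsum⟩ := exists_coeff_of_analyticAt hV
  obtain ⟨f, C', hf, hrec⟩ := exists_coeff_solution hq hδ (e T) hx hv
  have hr : 0 < (2 * x)⁻¹ := by positivity
  have hball : ∀ n : ℕ, ∀ z ∈ Metric.ball (0 : ℂ) (2 * x)⁻¹,
      ‖z ^ n • f n‖ ≤ C' * (1 / 2) ^ n := by
    intro n z hz
    have hz := (mem_ball_zero_iff.mp hz).le
    rw [norm_smul, norm_pow]
    calc ‖z‖ ^ n * ‖f n‖ ≤ (2 * x)⁻¹ ^ n * (C' * x ^ n) := by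
          gcongr
          exact hf n
      _ = C' * (1 / 2) ^ n := by
          rw [mul_left_comm, ← mul_pow]
          congr 2
          field_simp
  have hgeo : Summable fun n : ℕ => C' * (1 / 2 : ℝ) ^ n :=
    (summable_geometric_of_lt_one (by norm_num) (by norm_num)).mul_left _
  have hfs : ∀ z ∈ Metric.ball (0 : ℂ) (2 * x)⁻¹, Summable fun n : ℕ => z ^ n • f n :=
    fun z hz => Summable.of_norm_bounded hgeo fun n => hball n z hz
  have han : AnalyticAt ℂ (fun z : ℂ => ∑' n : ℕ, z ^ n • f n) 0 := by
    have := Complex.differentiableOn_tsum_of_summable_norm (F := fun (n : ℕ) (z : ℂ) => z ^ n • f n) hgeo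
      (fun n => ((differentiable_id.pow n).smul_const _).differentiableOn) Metric.isOpen_ball hball
    exact this.analyticAt (Metric.ball_mem_nhds 0 hr)
  have hqz : Tendsto (fun z : ℂ => q * z) (𝓝 0) (𝓝 0) := by
    have : Continuous fun z : ℂ => q * z := by fun_prop
    simpa using this.tendsto 0
  refine ⟨fun k => v k - T (f k), fun z => ∑' n : ℕ, z ^ n • f n, han.meromorphicAt, ?_⟩
  filter_upwards [nhdsWithin_le_nhds hsum, nhdsWithin_le_nhds (Metric.ball_mem_nhds (0 : ℂ) hr),
    nhdsWithin_le_nhds (hqz.eventually (Metric.ball_mem_nhds (0 : ℂ) hr))] with z h1 h2 h3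
  have hTs : HasSum (fun n => z ^ n • T (f n)) (T (∑' n : ℕ, z ^ n • f n)) := by
    refine ((e T).hasSum (hfs z h2).hasSum).congr_fun fun n => ?_
    exact (map_smul T _ _).symm
  have h4 : HasSum (fun n => z ^ n • (v n - T (f n))) (V z - T (∑' n : ℕ, z ^ n • f n)) := by
    refine (h1.sub hTs).congr_fun fun n => ?_
    rw [smul_sub]
  have h5 := (hasSum_nat_add_iff' δ).mpr h4
  have h6 : HasSum (fun n => z ^ (n + δ) • (v (n + δ) - T (f (n + δ))))
      (-(z ^ δ • ∑' n : ℕ, (q * z) ^ n • f n)) := by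
    refine ((hfs _ h3).hasSum.const_smul (z ^ δ)).neg.congr_fun fun n => ?_
    have h7 := hrec n
    have h8 : v (n + δ) - T (f (n + δ)) = -(q ^ n • f n) := by
      rw [h7]
      exact (neg_sub _ _).symm
    rw [h8, smul_neg, smul_smul, smul_smul, mul_pow, pow_add]
    congr 2
    ring
  have h7 := h5.unique h6
  rw [Finset.sum_range] at h7
  rw [sub_sub, sub_eq_iff_eq_add] at h7
  rw [h7]
  abel

/-- With `v = T w`, the gauge term `z^n w` trades `z^n v` for `q^n z^{n+δ} w`. Repeating this raises
the exponent until the analytic case applies. This is where `T` must be invertible. -/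
theorem hasNormalForm_zpow_smul {q : ℂ} (hq : 1 < ‖q‖) {δ : ℕ} (hδ : 0 < δ) {T : Module.End ℂ E}
    (hT : IsUnit T) (N : ℕ) : ∀ (n : ℤ) (v : E), -(N : ℤ) ≤ n →
      HasNormalForm q δ T fun z => z ^ n • v := by
  have hq0 := ne_zero_of_one_lt_norm hq
  induction N with
  | zero =>
    intro n v hn
    lift n to ℕ using by simpa using hn
    simp only [zpow_natCast]
    exact hasNormalForm_of_analyticAt hq hδ T ((analyticAt_id.pow n).smul analyticAt_const)
  | succ N ih =>
    intro n v hn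
    set w := Ring.inverse T v with hw
    have hTw : T w = v := by
      rw [hw, ← Module.End.mul_apply, Ring.mul_inverse_cancel T hT]
      rfl
    have h1 := ih (n + δ) (q ^ n • w) (by push_cast at hn; omega)
    have h2 : HasNormalForm q δ T fun z => z ^ n • v - z ^ (n + δ) • q ^ n • w := by
      refine ⟨0, fun z => z ^ n • w, ?_, ?_⟩
      · exact ((MeromorphicAt.id 0).zpow n).smul (MeromorphicAt.const w 0)
      · filter_upwards [self_mem_nhdsWithin] with z hz
        have hz : z ≠ 0 := hz
        rw [map_smul, hTw, zpow_add₀ hz, mul_zpow, zpow_natCast, smul_smul, smul_smul]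
        simp only [Pi.zero_apply, smul_zero, Finset.sum_const_zero, add_zero]
        rw [show z ^ n * z ^ δ * q ^ n = z ^ δ * (q ^ n * z ^ n) by ring, sub_add_cancel]
    refine (h2.add h1).congr (Eventually.of_forall fun z => ?_)
    simp

/-- Every meromorphic germ is equivalent to a polynomial of degree `< δ`. -/
theorem hasNormalForm_of_meromorphicAt {q : ℂ} (hq : 1 < ‖q‖) {δ : ℕ} (hδ : 0 < δ)
    {T : Module.End ℂ E} (hT : IsUnit T) {V : ℂ → E} (hV : MeromorphicAt V 0) :
    HasNormalForm q δ T V := by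
  obtain ⟨N, hN⟩ := hV
  -- The principal part is peeled off one monomial at a time, using `g(z) = g(0) + z · dslope g 0
  -- z`.
  have key : ∀ N : ℕ, ∀ g : ℂ → E, AnalyticAt ℂ g 0 →
      HasNormalForm q δ T fun z => (z ^ N)⁻¹ • g z := by
    intro N
    induction N with
    | zero =>
      intro g hg
      simpa using hasNormalForm_of_analyticAt hq hδ T hg
    | succ N ih =>
      intro g hg
      obtain ⟨p, hp⟩ := hg
      have h2 : AnalyticAt ℂ (dslope g 0) 0 := hp.has_fpower_series_dslope_fslope.analyticAt
      refine ((hasNormalForm_zpow_smul hq hδ hT (N + 1) (-((N + 1 : ℕ) : ℤ)) (g 0) le_rfl).add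
        (ih _ h2)).congr ?_
      filter_upwards [self_mem_nhdsWithin] with z hz
      have hz : z ≠ 0 := hz
      rw [dslope_of_ne _ hz, slope_def_module, sub_zero, zpow_neg, zpow_natCast, smul_smul,
        ← mul_inv, ← pow_succ, ← smul_add, add_sub_cancel]
  refine (key N _ hN).congr ?_
  filter_upwards [self_mem_nhdsWithin] with z hz
  have hz : z ≠ 0 := hz
  rw [sub_zero, inv_smul_smul₀ (pow_ne_zero _ hz)]

end NormalForm

/-! ### Matrices with a single eigenvalue and their roots -/

section Roots

/-- Cayley–Hamilton: over `ℂ` the characteristic polynomial is `(X - x)^k`. -/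
theorem isNilpotent_sub_of_spectrum_eq {k : ℕ} {A : Matrix (Fin k) (Fin k) ℂ} {x : ℂ}
    (hA : spectrum ℂ A = {x}) : (A - algebraMap ℂ _ x) ^ k = 0 := by
  have hm := A.charpoly_monic
  have hs : A.charpoly.Splits := IsAlgClosed.splits _
  have hroots : A.charpoly.roots = Multiset.replicate k x := by
    refine Multiset.eq_replicate.mpr ⟨?_, fun y hy => ?_⟩
    · rw [← hs.natDegree_eq_card_roots, A.charpoly_natDegree_eq_dim, Fintype.card_fin]
    · have h1 : y ∈ spectrum ℂ A := Matrix.mem_spectrum_iff_isRoot_charpoly.mpr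
        (Polynomial.isRoot_of_mem_roots hy)
      rwa [hA] at h1
  have h2 := hs.eq_prod_roots_of_monic hm
  rw [hroots, Multiset.map_replicate, Multiset.prod_replicate] at h2
  have h3 := A.aeval_self_charpoly
  rw [h2] at h3
  simpa using h3

theorem ne_zero_of_spectrum_eq {k : ℕ} {A : Matrix (Fin k) (Fin k) ℂ} {x : ℂ}
    (hA : spectrum ℂ A = {x}) : 0 < k := by
  rcases Nat.eq_zero_or_pos k with rfl | h
  · have h1 : x ∈ spectrum ℂ A := by rw [hA]; rfl
    exact absurd (isUnit_of_subsingleton _) h1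
  · exact h

open Polynomial in
/-- The truncated binomial polynomial for `(1 + X)^{1/δ}`. -/
noncomputable def rootPoly (δ k : ℕ) : ℂ[X] :=
  PowerSeries.trunc k (PowerSeries.binomialSeries ℂ (1 / (δ : ℂ)))

open Polynomial in
-- Binomial series multiply by adding exponents, and `δ · (1/δ) = 1`.
theorem binomialSeries_inv_pow {δ : ℕ} (hδ : 0 < δ) :
    PowerSeries.binomialSeries ℂ (1 / (δ : ℂ)) ^ δ = 1 + PowerSeries.X := by
  have h1 : ∀ n : ℕ, PowerSeries.binomialSeries ℂ (n * (1 / (δ : ℂ))) =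
      PowerSeries.binomialSeries ℂ (1 / (δ : ℂ)) ^ n := by
    intro n
    induction n with
    | zero => simp
    | succ n ih => rw [Nat.cast_succ, add_mul, one_mul, PowerSeries.binomialSeries_add, ih, pow_succ]
  have hδ0 : (δ : ℂ) ≠ 0 := by exact_mod_cast hδ.ne'
  rw [← h1, mul_one_div_cancel hδ0]
  have := PowerSeries.binomialSeries_nat (A := ℂ) (R := ℂ) 1
  simpa using this

open Polynomial in
-- Truncation changes the `δ`-th power only by a multiple of `X^k`, which `N` annihilates.
theorem aeval_rootPoly_pow {R : Type*} [Ring R] [Algebra ℂ R] {δ k : ℕ} (hδ : 0 < δ) {N : R}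
    (hN : N ^ k = 0) : (aeval N (rootPoly δ k)) ^ δ = 1 + N := by
  have h1 : (X : ℂ[X]) ^ k ∣ rootPoly δ k ^ δ - (1 + X) := by
    rw [X_pow_dvd_iff]
    intro d hd
    have h2 := PowerSeries.trunc_trunc_pow (PowerSeries.binomialSeries ℂ (1 / (δ : ℂ))) k δ
    rw [binomialSeries_inv_pow hδ] at h2
    have h3 := congrArg (fun p : ℂ[X] => p.coeff d) h2
    simp only [PowerSeries.coeff_trunc, if_pos hd] at h3
    rw [← Polynomial.coe_pow, Polynomial.coeff_coe] at h3
    rw [coeff_sub, rootPoly, h3, sub_eq_zero, ← Polynomial.coeff_coe]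
    simp
  obtain ⟨r, hr⟩ := h1
  have h2 := congrArg (aeval N) hr
  simp only [map_sub, map_pow, map_add, map_one, aeval_X, map_mul, hN, zero_mul] at h2
  exact sub_eq_zero.mp h2

open Polynomial in
theorem unipRoot_eq_aeval (δ : ℕ) (ρ : ℂ → ℂ) (x : ℂ) {k : ℕ} (A : Matrix (Fin k) (Fin k) ℂ) :
    unipRoot δ ρ x A = ρ x • aeval (x⁻¹ • A - 1) (rootPoly δ k) := by
  obtain _ | k := k
  · exact Subsingleton.elim _ _
  rw [unipRoot, rootPoly, aeval_eq_sum_range' (n := k + 1)]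
  · congr 1
    refine Finset.sum_congr rfl fun l hl => ?_
    rw [PowerSeries.coeff_trunc, if_pos (Finset.mem_range.mp hl), PowerSeries.binomialSeries_coeff,
      smul_assoc, one_smul]
  · exact PowerSeries.natDegree_trunc_lt _ k

variable {δ : ℕ} {ρ : ℂ → ℂ} {x : ℂ} {k : ℕ} {A : Matrix (Fin k) (Fin k) ℂ}

theorem inv_smul_sub_one_pow (hx : x ≠ 0) (hA : spectrum ℂ A = {x}) :
    (x⁻¹ • A - 1) ^ k = 0 := by
  have h1 : x⁻¹ • A - 1 = x⁻¹ • (A - algebraMap ℂ _ x) := by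
    rw [smul_sub, Algebra.algebraMap_eq_smul_one, inv_smul_smul₀ hx]
  rw [h1, smul_pow, isNilpotent_sub_of_spectrum_eq hA, smul_zero]

theorem unipRoot_pow (hδ : 0 < δ) (hρ : ρ x ^ δ = x) (hx : x ≠ 0) (hA : spectrum ℂ A = {x}) :
    unipRoot δ ρ x A ^ δ = A := by
  rw [unipRoot_eq_aeval, smul_pow, aeval_rootPoly_pow hδ (inv_smul_sub_one_pow hx hA), hρ,
    add_sub_cancel, smul_inv_smul₀ hx]

open Polynomial in
-- The binomial series has constant term `1`, so the root is `ρ x (1 + N r(N))` with `N` nilpotent.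
theorem isNilpotent_unipRoot_sub (hx : x ≠ 0) (hA : spectrum ℂ A = {x}) :
    IsNilpotent (unipRoot δ ρ x A - algebraMap ℂ _ (ρ x)) := by
  have hk := ne_zero_of_spectrum_eq hA
  set N := x⁻¹ • A - 1 with hN
  obtain ⟨r, hr⟩ : X ∣ rootPoly δ k - C 1 := by
    rw [X_dvd_iff, coeff_sub, rootPoly, PowerSeries.coeff_trunc, if_pos hk]
    simp
  have h2 : unipRoot δ ρ x A - algebraMap ℂ _ (ρ x) = ρ x • (N * aeval N r) := by
    have h3 := congrArg (aeval N) hr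
    simp only [map_sub, map_mul, aeval_X, map_one] at h3
    rw [unipRoot_eq_aeval, ← h3, Algebra.algebraMap_eq_smul_one, smul_sub]
  rw [h2]
  refine IsNilpotent.smul ?_ _
  have hcomm : Commute N (aeval N r) := by
    have : Commute (aeval N (X : ℂ[X])) (aeval N r) := by
      rw [commute_iff_eq, ← map_mul, mul_comm, map_mul]
    simpa using this
  exact hcomm.isNilpotent_mul_right ⟨k, inv_smul_sub_one_pow hx hA⟩

end Roots

/-! ### The endomorphisms `X ↦ R X P` -/

section MulOp

variable {m n : Type*} [Fintype m] [Fintype n] [DecidableEq m] [DecidableEq n]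

/-- The endomorphism `X ↦ R X P` of the space of `m × n` matrices. -/
def mulOp (R : Matrix m m ℂ) (P : Matrix n n ℂ) : Module.End ℂ (Matrix m n ℂ) where
  toFun X := R * X * P
  map_add' X Y := by rw [Matrix.mul_add, Matrix.add_mul]
  map_smul' a X := by simp

omit [DecidableEq m] in
theorem conjOp_eq_mulOp (R : Matrix m m ℂ) (S : Matrix n n ℂ) : conjOp R S = mulOp R S⁻¹ := rfl

omit [DecidableEq m] [DecidableEq n] in
theorem mulOp_mul (R R' : Matrix m m ℂ) (P P' : Matrix n n ℂ) :
    mulOp R P * mulOp R' P' = mulOp (R * R') (P' * P) := by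
  ext1 X
  simp only [Module.End.mul_apply, mulOp, LinearMap.coe_mk, AddHom.coe_mk, Matrix.mul_assoc]

theorem mulOp_pow (R : Matrix m m ℂ) (P : Matrix n n ℂ) (k : ℕ) :
    mulOp R P ^ k = mulOp (R ^ k) (P ^ k) := by
  induction k with
  | zero =>
    ext1 X
    simp [mulOp]
  | succ k ih => rw [pow_succ, ih, mulOp_mul, ← pow_succ, ← pow_succ']

theorem conjOp_pow (R : Matrix m m ℂ) (S : Matrix n n ℂ) (k : ℕ) :
    conjOp R S ^ k = conjOp (R ^ k) (S ^ k) := by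
  rw [conjOp_eq_mulOp, mulOp_pow, conjOp_eq_mulOp, Matrix.inv_pow']

theorem isNilpotent_mulOp_left {R : Matrix m m ℂ} (hR : IsNilpotent R) (P : Matrix n n ℂ) :
    IsNilpotent (mulOp R P) := by
  obtain ⟨k, hk⟩ := hR
  refine ⟨k, ?_⟩
  rw [mulOp_pow, hk]
  ext1 X
  simp [mulOp]

theorem isNilpotent_mulOp_right (R : Matrix m m ℂ) {P : Matrix n n ℂ} (hP : IsNilpotent P) :
    IsNilpotent (mulOp R P) := by
  obtain ⟨k, hk⟩ := hP
  refine ⟨k, ?_⟩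
  rw [mulOp_pow, hk]
  ext1 X
  simp [mulOp]

/-- `R X S⁻¹ - (x/y) X = (R - x) X S⁻¹ + x X (S⁻¹ - y⁻¹)` exhibits the difference as a sum of two
commuting nilpotent operators. -/
theorem isNilpotent_conjOp_sub {R : Matrix m m ℂ} {S : Matrix n n ℂ} {x y : ℂ} (hy : y ≠ 0)
    (hR : IsNilpotent (R - algebraMap ℂ _ x)) (hS : IsNilpotent (S - algebraMap ℂ _ y)) :
    IsNilpotent (conjOp R S - algebraMap ℂ _ (x / y)) := by
  have hSu : IsUnit S := by
    have h1 := hS.isUnit_add_left_of_commute ((IsUnit.mk0 y hy).map (algebraMap ℂ (Matrix n n ℂ)))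
      (Algebra.commutes _ _).symm
    rwa [add_sub_cancel] at h1
  have hSd := (Matrix.isUnit_iff_isUnit_det S).mp hSu
  have hSi : S * S⁻¹ = 1 := Matrix.mul_nonsing_inv S hSd
  have hiS : S⁻¹ * S = 1 := Matrix.nonsing_inv_mul S hSd
  have hP : IsNilpotent (S⁻¹ - algebraMap ℂ _ y⁻¹) := by
    have h1 : S⁻¹ - algebraMap ℂ _ y⁻¹ = (-y⁻¹) • (S⁻¹ * (S - algebraMap ℂ _ y)) := by
      rw [mul_sub, hiS, Algebra.algebraMap_eq_smul_one, Algebra.algebraMap_eq_smul_one,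
        Matrix.mul_smul, mul_one, smul_sub, smul_smul, neg_mul, inv_mul_cancel₀ hy, neg_smul,
        neg_smul, one_smul]
      abel
    rw [h1]
    refine IsNilpotent.smul ?_ _
    have hcomm : Commute S⁻¹ (S - algebraMap ℂ _ y) :=
      (show Commute S⁻¹ S from hiS.trans hSi.symm).sub_right (Algebra.commutes _ _).symm
    exact hcomm.isNilpotent_mul_left hS
  have h2 : conjOp R S - algebraMap ℂ _ (x / y) =
      mulOp (R - algebraMap ℂ _ x) S⁻¹ +
        mulOp (algebraMap ℂ _ x) (S⁻¹ - algebraMap ℂ _ y⁻¹) := by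
    ext1 X
    simp only [conjOp_eq_mulOp, mulOp, LinearMap.sub_apply, LinearMap.add_apply, LinearMap.coe_mk,
      AddHom.coe_mk, Algebra.algebraMap_eq_smul_one]
    simp only [Matrix.sub_mul, Matrix.mul_sub, Matrix.smul_mul, Matrix.mul_smul, Matrix.one_mul,
      Matrix.mul_one, smul_smul, div_eq_mul_inv, mul_comm]
    abel
  rw [h2]
  refine Commute.isNilpotent_add ?_ (isNilpotent_mulOp_left hR _) (isNilpotent_mulOp_right _ hP)
  rw [commute_iff_eq, mulOp_mul, mulOp_mul]
  congr 1
  · exact (Algebra.commutes _ _).symm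
  · rw [sub_mul, mul_sub, (Algebra.commutes y⁻¹ S⁻¹)]

end MulOp

section Lcomp

variable {ι κ : Type*} {r : ι → ℕ} {s : κ → ℕ} {δ : ℕ} {ρ : ℂ → ℂ} {α : ι → ℂ} {β : κ → ℂ}
  {A : ∀ i, Matrix (Fin (r i)) (Fin (r i)) ℂ} {B : ∀ j, Matrix (Fin (s j)) (Fin (s j)) ℂ}

theorem Lcomp_pow (hδ : 0 < δ) (hρ : ∀ x, x ≠ 0 → ρ x ^ δ = x) (hα : ∀ i, α i ≠ 0)
    (hβ : ∀ j, β j ≠ 0) (hA : ∀ i, spectrum ℂ (A i) = {α i}) (hB : ∀ j, spectrum ℂ (B j) = {β j})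
    (i : ι) (j : κ) : Lcomp δ ρ α β A B i j ^ δ = conjOp (A i) (B j) := by
  rw [Lcomp, conjOp_pow, unipRoot_pow hδ (hρ _ (hα i)) (hα i) (hA i),
    unipRoot_pow hδ (hρ _ (hβ j)) (hβ j) (hB j)]

theorem isNilpotent_smul_Lcomp_sub (hδ : 0 < δ) (hρ : ∀ x, x ≠ 0 → ρ x ^ δ = x)
    (hα : ∀ i, α i ≠ 0) (hβ : ∀ j, β j ≠ 0) (hA : ∀ i, spectrum ℂ (A i) = {α i})
    (hB : ∀ j, spectrum ℂ (B j) = {β j}) (i : ι) (j : κ) (ζ : ℂ) :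
    IsNilpotent (ζ • Lcomp δ ρ α β A B i j - algebraMap ℂ _ (ζ * ρ (α i) / ρ (β j))) := by
  have hρβ : ρ (β j) ≠ 0 := fun h => hβ j (by rw [← hρ _ (hβ j), h, zero_pow hδ.ne'])
  have h1 := isNilpotent_conjOp_sub hρβ
    (isNilpotent_unipRoot_sub (δ := δ) (ρ := ρ) (hα i) (hA i))
    (isNilpotent_unipRoot_sub (δ := δ) (ρ := ρ) (hβ j) (hB j))
  have h2 : ζ • Lcomp δ ρ α β A B i j - algebraMap ℂ _ (ζ * ρ (α i) / ρ (β j)) =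
      ζ • (Lcomp δ ρ α β A B i j - algebraMap ℂ _ (ρ (α i) / ρ (β j))) := by
    rw [smul_sub, mul_div_assoc, map_mul, Algebra.smul_def ζ (algebraMap ℂ _ (ρ (α i) / ρ (β j)))]
  rw [h2]
  exact h1.smul _

theorem isNilpotent_conjOp_block_sub (hβ : ∀ j, β j ≠ 0) (hA : ∀ i, spectrum ℂ (A i) = {α i})
    (hB : ∀ j, spectrum ℂ (B j) = {β j}) (i : ι) (j : κ) :
    IsNilpotent (conjOp (A i) (B j) - algebraMap ℂ _ (α i / β j)) :=
  isNilpotent_conjOp_sub (hβ j) ⟨_, isNilpotent_sub_of_spectrum_eq (hA i)⟩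
    ⟨_, isNilpotent_sub_of_spectrum_eq (hB j)⟩

end Lcomp

/-! ### Block matrices -/

section Blocks

variable {ι κ : Type*} {r : ι → ℕ} {s : κ → ℕ}

/-- The `(i,j)` block, as a linear map. -/
def blkLin (i : ι) (j : κ) : Matrix (Σ i, Fin (r i)) (Σ j, Fin (s j)) ℂ →ₗ[ℂ]
    Matrix (Fin (r i)) (Fin (s j)) ℂ where
  toFun X := blk X i j
  map_add' _ _ := rfl
  map_smul' _ _ := rfl

theorem blk_add (X Y : Matrix (Σ i, Fin (r i)) (Σ j, Fin (s j)) ℂ) (i : ι) (j : κ) :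
    blk (X + Y) i j = blk X i j + blk Y i j := rfl

theorem blk_sub (X Y : Matrix (Σ i, Fin (r i)) (Σ j, Fin (s j)) ℂ) (i : ι) (j : κ) :
    blk (X - Y) i j = blk X i j - blk Y i j := rfl

theorem blk_smul (x : ℂ) (Y : Matrix (Σ i, Fin (r i)) (Σ j, Fin (s j)) ℂ) (i : ι) (j : κ) :
    blk (x • Y) i j = x • blk Y i j := rfl

theorem blk_sum {ν : Type*} (t : Finset ν) (X : ν → Matrix (Σ i, Fin (r i)) (Σ j, Fin (s j)) ℂ)
    (i : ι) (j : κ) : blk (∑ k ∈ t, X k) i j = ∑ k ∈ t, blk (X k) i j :=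
  map_sum (blkLin i j) X t

theorem blk_polyEval {δ : ℕ} (U : Fin δ → Matrix (Σ i, Fin (r i)) (Σ j, Fin (s j)) ℂ) (z : ℂ)
    (i : ι) (j : κ) : blk (polyEval U z) i j = ∑ k : Fin δ, z ^ (k : ℕ) • blk (U k) i j := by
  rw [polyEval, blk_sum]
  rfl

theorem blk_ext {X Y : Matrix (Σ i, Fin (r i)) (Σ j, Fin (s j)) ℂ}
    (h : ∀ i j, blk X i j = blk Y i j) : X = Y := by
  ext ⟨i, k⟩ ⟨j, l⟩
  exact congrFun (congrFun (h i j) k) l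

variable [Fintype ι] [DecidableEq ι] [Fintype κ] [DecidableEq κ]

omit [Fintype κ] [DecidableEq κ] in
theorem blk_blockDiagonal'_mul (A : ∀ i, Matrix (Fin (r i)) (Fin (r i)) ℂ)
    (X : Matrix (Σ i, Fin (r i)) (Σ j, Fin (s j)) ℂ) (i : ι) (j : κ) :
    blk (Matrix.blockDiagonal' A * X) i j = A i * blk X i j := by
  ext k l
  simp only [blk, Matrix.of_apply, Matrix.mul_apply, Fintype.sum_sigma]
  rw [Finset.sum_eq_single i]
  · simp [Matrix.blockDiagonal'_apply_eq]
  · intro b _ hb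
    refine Finset.sum_eq_zero fun x _ => ?_
    rw [Matrix.blockDiagonal'_apply_ne _ _ _ hb.symm, zero_mul]
  · simp

omit [Fintype ι] [DecidableEq ι] in
theorem blk_mul_blockDiagonal' (B : ∀ j, Matrix (Fin (s j)) (Fin (s j)) ℂ)
    (X : Matrix (Σ i, Fin (r i)) (Σ j, Fin (s j)) ℂ) (i : ι) (j : κ) :
    blk (X * Matrix.blockDiagonal' B) i j = blk X i j * B j := by
  ext k l
  simp only [blk, Matrix.of_apply, Matrix.mul_apply, Fintype.sum_sigma]
  rw [Finset.sum_eq_single j]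
  · simp [Matrix.blockDiagonal'_apply_eq]
  · intro b _ hb
    refine Finset.sum_eq_zero fun x _ => ?_
    rw [Matrix.blockDiagonal'_apply_ne _ _ _ hb, mul_zero]
  · simp

theorem blockDiagonal'_mul_inv {B : ∀ j, Matrix (Fin (s j)) (Fin (s j)) ℂ}
    (hB : ∀ j, IsUnit (B j)) :
    Matrix.blockDiagonal' B * Matrix.blockDiagonal' (fun j => (B j)⁻¹) = 1 := by
  rw [← Matrix.blockDiagonal'_mul, ← Matrix.blockDiagonal'_one]
  congr 1
  ext1 j
  exact Matrix.mul_nonsing_inv _ ((Matrix.isUnit_iff_isUnit_det _).mp (hB j))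

theorem isUnit_blockDiagonal'_iff {B : ∀ j, Matrix (Fin (s j)) (Fin (s j)) ℂ} :
    IsUnit (Matrix.blockDiagonal' B) ↔ ∀ j, IsUnit (B j) := by
  constructor
  · intro h j
    have h1 := Matrix.mul_nonsing_inv _ ((Matrix.isUnit_iff_isUnit_det _).mp h)
    have h2 := congrArg (fun X => blk X j j) h1
    rw [blk_blockDiagonal'_mul, ← Matrix.blockDiagonal'_one] at h2
    refine IsUnit.of_mul_eq_one (blk (Matrix.blockDiagonal' B)⁻¹ j j) (h2.trans ?_)
    ext k l
    simp [blk, Matrix.blockDiagonal'_apply_eq]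
  · intro h
    exact IsUnit.of_mul_eq_one _ (blockDiagonal'_mul_inv h)

theorem blk_conjOp (R : ∀ i, Matrix (Fin (r i)) (Fin (r i)) ℂ)
    {S : ∀ j, Matrix (Fin (s j)) (Fin (s j)) ℂ} (hS : ∀ j, IsUnit (S j))
    (X : Matrix (Σ i, Fin (r i)) (Σ j, Fin (s j)) ℂ) (i : ι) (j : κ) :
    blk (conjOp (Matrix.blockDiagonal' R) (Matrix.blockDiagonal' S) X) i j =
      conjOp (R i) (S j) (blk X i j) := by
  simp only [conjOp, LinearMap.coe_mk, AddHom.coe_mk]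
  rw [Matrix.inv_eq_right_inv (blockDiagonal'_mul_inv hS), blk_mul_blockDiagonal',
    blk_blockDiagonal'_mul]

theorem mem_spectrum_blockDiagonal'_iff {A : ∀ i, Matrix (Fin (r i)) (Fin (r i)) ℂ} {x : ℂ} :
    x ∈ spectrum ℂ (Matrix.blockDiagonal' A) ↔ ∃ i, x ∈ spectrum ℂ (A i) := by
  have h : algebraMap ℂ _ x - Matrix.blockDiagonal' A =
      Matrix.blockDiagonal' fun i => algebraMap ℂ _ x - A i := by
    have : (algebraMap ℂ (Matrix (Σ i, Fin (r i)) (Σ i, Fin (r i)) ℂ) x) =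
        Matrix.blockDiagonal' fun i => algebraMap ℂ (Matrix (Fin (r i)) (Fin (r i)) ℂ) x := by
      have h1 := Matrix.blockDiagonal'_smul x (1 : ∀ i, Matrix (Fin (r i)) (Fin (r i)) ℂ)
      rw [Matrix.blockDiagonal'_one] at h1
      rw [Algebra.algebraMap_eq_smul_one, ← h1]
      congr 1
      ext1 i
      rw [Algebra.algebraMap_eq_smul_one]
      rfl
    rw [this]
    exact (Matrix.blockDiagonal'_sub _ _).symm
  simp only [spectrum.mem_iff, h, isUnit_blockDiagonal'_iff, not_forall]

variable {A : ∀ i, Matrix (Fin (r i)) (Fin (r i)) ℂ} {B : ∀ j, Matrix (Fin (s j)) (Fin (s j)) ℂ}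
  {α : ι → ℂ} {β : κ → ℂ}

/-- The factor `c^μ` cancels and only `l - k` matters. The condition then says that `c^δ q^n - T` is
invertible on every block. -/
theorem nonResonant_blockDiagonal'_iff {q : ℂ} (hq : q ≠ 0) (δ : ℕ) (μ : ℤ)
    (hβ : ∀ j, β j ≠ 0) (hA : ∀ i, spectrum ℂ (A i) = {α i}) (hB : ∀ j, spectrum ℂ (B j) = {β j})
    {c : ℂ} (hc : c ≠ 0) :
    NonResonant q δ μ (Matrix.blockDiagonal' A) (Matrix.blockDiagonal' B) c ↔
      ∀ i j, ∀ n : ℤ, c ^ δ * q ^ n ≠ α i / β j := by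
  have key : ∀ i j, ∀ k l : ℤ, q ^ k * c ^ μ * α i = q ^ l * c ^ (μ + δ) * β j ↔
      c ^ δ * q ^ (l - k) = α i / β j := by
    intro i j k l
    rw [eq_div_iff (hβ j), zpow_sub₀ hq, zpow_add₀ hc, zpow_natCast]
    have h1 := zpow_ne_zero k hq
    have h2 := zpow_ne_zero μ hc
    field_simp
    exact eq_comm
  constructor
  · intro h i j n hn
    refine h (α i) (mem_spectrum_blockDiagonal'_iff.mpr ⟨i, by rw [hA]; rfl⟩) (β j)
      (mem_spectrum_blockDiagonal'_iff.mpr ⟨j, by rw [hB]; rfl⟩) 0 n ((key i j 0 n).mpr ?_)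
    rwa [sub_zero]
  · intro h x hx y hy k l hkl
    obtain ⟨i, hi⟩ := mem_spectrum_blockDiagonal'_iff.mp hx
    obtain ⟨j, hj⟩ := mem_spectrum_blockDiagonal'_iff.mp hy
    rw [hA] at hi
    rw [hB] at hj
    rw [Set.mem_singleton_iff.mp hi, Set.mem_singleton_iff.mp hj] at hkl
    exact h i j _ ((key i j k l).mp hkl)

theorem isUnit_of_spectrum_eq {k : ℕ} {M : Matrix (Fin k) (Fin k) ℂ} {x : ℂ}
    (hM : spectrum ℂ M = {x}) (hx : x ≠ 0) : IsUnit M := by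
  rw [← spectrum.zero_notMem_iff ℂ, hM]
  exact fun h => hx h.symm

end Blocks

/-! ### Gauge transformations of block-triangular systems -/

section Gauge

variable {m n : Type*} [Fintype m] [DecidableEq m] [Fintype n] [DecidableEq n]

/-- Only the upper right block carries information; cancelling `z^μ` and the right factor `B` gives
the `q`-difference equation. Summation uses `V = 0`, analytic equivalence uses general `V`. -/
theorem gauge_triMat_iff (δ : ℕ) (μ : ℤ) (A : Matrix m m ℂ) {B : Matrix n n ℂ} (hB : IsUnit B)
    {z : ℂ} (hz : z ≠ 0) (F G : Matrix m n ℂ) {W W' : ℂ → Matrix m n ℂ} {V V' : Matrix m n ℂ}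
    (hW : W z = z ^ μ • (V * B)) (hW' : W' z = z ^ μ • (V' * B)) :
    Matrix.fromBlocks 1 G 0 1 * triMat δ μ A B W z = triMat δ μ A B W' z *
      Matrix.fromBlocks 1 F 0 1 ↔ V + z ^ δ • G = conjOp A B F + V' := by
  have hBd := (Matrix.isUnit_iff_isUnit_det _).mp hB
  have h1 : ∀ X Y : Matrix m n ℂ, X * B = Y * B ↔ X = Y := fun X Y =>
    ⟨fun h => by
      have := congrArg (· * B⁻¹) h
      simpa [Matrix.mul_nonsing_inv_cancel_right _ _ hBd] using this, fun h => by rw [h]⟩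
  have h2 : A * F = conjOp A B F * B := by
    simp [conjOp, Matrix.nonsing_inv_mul_cancel_right _ _ hBd]
  rw [triMat, triMat, Matrix.fromBlocks_multiply, Matrix.fromBlocks_multiply,
    Matrix.fromBlocks_inj]
  simp only [Matrix.one_mul, Matrix.mul_one, Matrix.mul_zero, Matrix.zero_mul, add_zero, zero_add,
    true_and, and_true]
  rw [hW, hW', Matrix.mul_smul, Matrix.smul_mul, h2, zpow_add₀ hz, zpow_natCast, mul_smul,
    ← smul_add, ← smul_add, ← Matrix.smul_mul, ← Matrix.add_mul, ← Matrix.add_mul]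
  rw [(smul_right_injective _ (zpow_ne_zero μ hz)).eq_iff, h1]

end Gauge

/-! ### Existence and uniqueness of the sums -/

section Summation

attribute [local instance] Matrix.normedAddCommGroup Matrix.normedSpace

/-- The entry of a matrix as a continuous linear functional. -/
noncomputable def entryCLM {m n : Type*} [Fintype m] [Fintype n] (x : m) (y : n) :
    Matrix m n ℂ →L[ℂ] ℂ :=
  LinearMap.toContinuousLinearMap (Matrix.entryLinearMap ℂ ℂ x y)

theorem differentiableAt_matrix_iff {m n : Type*} [Fintype m] [Fintype n] {f : ℂ → Matrix m n ℂ}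
    {z : ℂ} : DifferentiableAt ℂ f z ↔ ∀ x y, DifferentiableAt ℂ (fun w => f w x y) z :=
  ⟨fun h x y => (entryCLM x y).differentiableAt.comp z h, fun h =>
    differentiableAt_pi.mpr fun x => differentiableAt_pi.mpr fun y => h x y⟩

theorem analyticAt_of_differentiableAt_ne_zero {f : ℂ → ℂ}
    (hf : ∀ z ≠ 0, DifferentiableAt ℂ f z) {z : ℂ} (hz : z ≠ 0) : AnalyticAt ℂ f z :=
  DifferentiableOn.analyticAt (s := {0}ᶜ) (fun w hw => (hf w hw).differentiableWithinAt)
    (isOpen_compl_singleton.mem_nhds hz)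

theorem ne_zero_of_mem_spiral {q x z : ℂ} (hq : q ≠ 0) (hx : x ≠ 0) (hz : z ∈ spiral q x) :
    z ≠ 0 := by
  obtain ⟨n, rfl⟩ := hz
  exact mul_ne_zero hx (zpow_ne_zero n hq)

/-- A quotient by `θ(z/c)^δ` has poles of order at most `δ`. -/
theorem le_meromorphicOrderAt_inv_theta_pow_mul {q : ℂ} (hq : 1 < ‖q‖) (δ : ℕ) {c z : ℂ}
    (hc : c ≠ 0) (hz : z ∈ spiral q (-c)) {g : ℂ → ℂ} (hg : AnalyticAt ℂ g z) :
    MeromorphicAt (fun w => (theta q (w / c) ^ δ)⁻¹ * g w) z ∧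
      ((-(δ : ℤ) : ℤ) : WithTop ℤ) ≤
        meromorphicOrderAt (fun w => (theta q (w / c) ^ δ)⁻¹ * g w) z := by
  obtain ⟨h1, h2⟩ := meromorphicOrderAt_theta_div hq hc hz
  have h3 : MeromorphicAt (fun w => theta q (w / c)) z := h1.meromorphicAt
  have h4 : MeromorphicAt (fun w => (theta q (w / c) ^ δ)⁻¹) z := (h3.pow δ).inv
  have h5 : meromorphicOrderAt (fun w => (theta q (w / c) ^ δ)⁻¹) z = ((-(δ : ℤ) : ℤ) :) := by
    have := meromorphicOrderAt_inv (f := (fun w => theta q (w / c)) ^ δ) (x := z)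
    rw [meromorphicOrderAt_pow h3, h2] at this
    refine Eq.trans this ?_
    rw [mul_one]
    rfl
  refine ⟨h4.mul hg.meromorphicAt, ?_⟩
  have h6 := meromorphicOrderAt_mul h4 hg.meromorphicAt
  refine le_trans ?_ (le_of_eq h6.symm)
  rw [h5]
  calc ((-(δ : ℤ) : ℤ) : WithTop ℤ) = ((-(δ : ℤ) : ℤ) : WithTop ℤ) + 0 := (add_zero _).symm
    _ ≤ _ := by gcongr; exact hg.meromorphicOrderAt_nonneg

section General

variable {m n : Type*} [Fintype m] [DecidableEq m] [Fintype n] [DecidableEq n]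

theorem IsSummation.of_solution {q : ℂ} {δ : ℕ} (μ : ℤ) (A : Matrix m m ℂ)
    {B : Matrix n n ℂ} (hB : IsUnit B) (U : Fin δ → Matrix m n ℂ) {c : ℂ}
    {f : ℂ → Matrix m n ℂ}
    (h1 : ∀ z, z ≠ 0 → z ∉ spiral q (-c) → ∀ x y, AnalyticAt ℂ (fun w => f w x y) z)
    (h2 : ∀ z ∈ spiral q (-c), ∀ x y, MeromorphicAt (fun w => f w x y) z ∧
      ((-(δ : ℤ) : ℤ) : WithTop ℤ) ≤ meromorphicOrderAt (fun w => f w x y) z)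
    (h3 : ∀ z, z ≠ 0 → z ∉ spiral q (-c) →
      z ^ δ • f (q * z) = conjOp A B (f z) + polyEval U z) :
    IsSummation q δ (gradedMat δ μ A B) (modMat δ μ A B U) c
      fun z => Matrix.fromBlocks 1 (f z) 0 1 := by
  have h4 : ∀ (b z : ℂ), MeromorphicAt (fun _ : ℂ => b) z ∧
      ((-(δ : ℤ) : ℤ) : WithTop ℤ) ≤ meromorphicOrderAt (fun _ : ℂ => b) z := fun b z => by
    have hb : AnalyticAt ℂ (fun _ : ℂ => b) z := analyticAt_const
    refine ⟨hb.meromorphicAt, le_trans ?_ hb.meromorphicOrderAt_nonneg⟩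
    exact_mod_cast (by omega : -(δ : ℤ) ≤ 0)
  refine ⟨fun z => by simp, ?_, ?_, ?_⟩
  · rintro z hz hzc (x | x) (y | y)
    · exact analyticAt_const
    · exact h1 z hz hzc x y
    · exact analyticAt_const
    · exact analyticAt_const
  · rintro z hz (x | x) (y | y)
    · exact h4 _ _
    · exact h2 z hz x y
    · exact h4 _ _
    · exact h4 _ _
  · intro z hz hzc
    refine (gauge_triMat_iff δ μ A hB hz (f z) (f (q * z)) (V := 0) (V' := polyEval U z) ?_ rfl).mpr
      ?_
    · simp
    · rw [zero_add, h3 z hz hzc]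

theorem IsSummation.equation {q : ℂ} {δ : ℕ} {μ : ℤ} {A : Matrix m m ℂ}
    {B : Matrix n n ℂ} (hB : IsUnit B) {U : Fin δ → Matrix m n ℂ} {c : ℂ}
    {F : ℂ → Matrix (m ⊕ n) (m ⊕ n) ℂ}
    (hF : IsSummation q δ (gradedMat δ μ A B) (modMat δ μ A B U) c F) {z : ℂ} (hz : z ≠ 0)
    (hzc : z ∉ spiral q (-c)) :
    z ^ δ • (F (q * z)).toBlocks₁₂ = conjOp A B (F z).toBlocks₁₂ + polyEval U z := by
  have h := hF.gauge z hz hzc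
  rw [hF.unipotent (q * z), hF.unipotent z] at h
  have := (gauge_triMat_iff δ μ A hB hz (F z).toBlocks₁₂ (F (q * z)).toBlocks₁₂ (V := 0)
    (V' := polyEval U z) (by simp) rfl).mp h
  rwa [zero_add] at this

end General

variable {ι κ : Type*} [Fintype ι] [DecidableEq ι] [Fintype κ] [DecidableEq κ]
  {r : ι → ℕ} {s : κ → ℕ}

/-- The solution of `z^δ f(qz) = A f(z) B⁻¹ + U(z)` with poles on `[-c;q]`, block by block. -/
noncomputable def matSol (q : ℂ) {δ : ℕ} (A : ∀ i, Matrix (Fin (r i)) (Fin (r i)) ℂ)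
    (B : ∀ j, Matrix (Fin (s j)) (Fin (s j)) ℂ)
    (U : Fin δ → Matrix (Σ i, Fin (r i)) (Σ j, Fin (s j)) ℂ) (c z : ℂ) :
    Matrix (Σ i, Fin (r i)) (Σ j, Fin (s j)) ℂ :=
  Matrix.of fun x y =>
    qSol q (conjOp (A x.1) (B y.1)) (fun k => blk (U k) x.1 y.1) c z x.2 y.2

omit [Fintype ι] [DecidableEq ι] [Fintype κ] [DecidableEq κ] in
theorem blk_matSol (q : ℂ) {δ : ℕ} (A : ∀ i, Matrix (Fin (r i)) (Fin (r i)) ℂ)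
    (B : ∀ j, Matrix (Fin (s j)) (Fin (s j)) ℂ)
    (U : Fin δ → Matrix (Σ i, Fin (r i)) (Σ j, Fin (s j)) ℂ) (c z : ℂ) (i : ι) (j : κ) :
    blk (matSol q A B U c z) i j = qSol q (conjOp (A i) (B j)) (fun k => blk (U k) i j) c z := rfl

variable {A : ∀ i, Matrix (Fin (r i)) (Fin (r i)) ℂ} {B : ∀ j, Matrix (Fin (s j)) (Fin (s j)) ℂ}
  {α : ι → ℂ} {β : κ → ℂ}

theorem isSummation_matSol {q : ℂ} (hq : 1 < ‖q‖) {δ : ℕ} (μ : ℤ) (hα : ∀ i, α i ≠ 0)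
    (hβ : ∀ j, β j ≠ 0) (hA : ∀ i, spectrum ℂ (A i) = {α i}) (hB : ∀ j, spectrum ℂ (B j) = {β j})
    (U : Fin δ → Matrix (Σ i, Fin (r i)) (Σ j, Fin (s j)) ℂ) {c : ℂ} (hc : c ≠ 0)
    (hcr : ∀ i j, ∀ n : ℤ, c ^ δ * q ^ n ≠ α i / β j) :
    IsSummation q δ (gradedMat δ μ (Matrix.blockDiagonal' A) (Matrix.blockDiagonal' B))
      (modMat δ μ (Matrix.blockDiagonal' A) (Matrix.blockDiagonal' B) U) c
      fun z => Matrix.fromBlocks 1 (matSol q A B U c z) 0 1 := by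
  have hq0 := ne_zero_of_one_lt_norm hq
  have hBu : ∀ j, IsUnit (B j) := fun j => isUnit_of_spectrum_eq (hB j) (hβ j)
  have hg : ∀ (x : Σ i, Fin (r i)) (y : Σ j, Fin (s j)), ∀ z ≠ 0, AnalyticAt ℂ (fun z : ℂ =>
      (∑' n : ℤ, z ^ n • solCoeff q (conjOp (A x.1) (B y.1)) (fun k => blk (U k) x.1 y.1) c n)
        x.2 y.2) z := fun x y z hz =>
    analyticAt_of_differentiableAt_ne_zero (fun w hw => differentiableAt_matrix_iff.mp
      (differentiableAt_tsum_solCoeff hq (div_ne_zero (hα x.1) (hβ y.1))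
        (isNilpotent_conjOp_block_sub hβ hA hB x.1 y.1) _ hc (hcr x.1 y.1) hw) x.2 y.2) hz
  refine IsSummation.of_solution μ _ (isUnit_blockDiagonal'_iff.mpr hBu) U ?_ ?_ ?_
  · intro z hz hzc x y
    refine AnalyticAt.mul ?_ (hg x y z hz)
    exact ((analyticAt_theta_div hq hc hz).pow δ).inv
      (pow_ne_zero δ (theta_div_ne_zero hq hc hz hzc))
  · intro z hz x y
    exact le_meromorphicOrderAt_inv_theta_pow_mul hq δ hc hz
      (hg x y z (ne_zero_of_mem_spiral hq0 (neg_ne_zero.mpr hc) hz))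
  · intro z hz hzc
    refine blk_ext fun i j => ?_
    rw [blk_smul, blk_add, blk_conjOp A hBu, blk_polyEval, blk_matSol, blk_matSol]
    exact qSol_equation hq (div_ne_zero (hα i) (hβ j))
      (isNilpotent_conjOp_block_sub hβ hA hB i j) _ hc (hcr i j) hz hzc

/-- On each block the difference of two sums solves the homogeneous equation, and its numerator is
holomorphic on `ℂ^*`. -/
theorem IsSummation.unique {q : ℂ} (hq : 1 < ‖q‖) {δ : ℕ} {μ : ℤ}
    (hβ : ∀ j, β j ≠ 0) (hA : ∀ i, spectrum ℂ (A i) = {α i}) (hB : ∀ j, spectrum ℂ (B j) = {β j})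
    {U : Fin δ → Matrix (Σ i, Fin (r i)) (Σ j, Fin (s j)) ℂ} {c : ℂ} (hc : c ≠ 0)
    (hcr : ∀ i j, ∀ n : ℤ, c ^ δ * q ^ n ≠ α i / β j)
    {F F' : ℂ → Matrix ((Σ i, Fin (r i)) ⊕ (Σ j, Fin (s j))) ((Σ i, Fin (r i)) ⊕ (Σ j, Fin (s j))) ℂ}
    (hF : IsSummation q δ (gradedMat δ μ (Matrix.blockDiagonal' A) (Matrix.blockDiagonal' B))
      (modMat δ μ (Matrix.blockDiagonal' A) (Matrix.blockDiagonal' B) U) c F)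
    (hF' : IsSummation q δ (gradedMat δ μ (Matrix.blockDiagonal' A) (Matrix.blockDiagonal' B))
      (modMat δ μ (Matrix.blockDiagonal' A) (Matrix.blockDiagonal' B) U) c F')
    {z : ℂ} (hz : z ≠ 0) (hzc : z ∉ spiral q (-c)) : F' z = F z := by
  have hBu : ∀ j, IsUnit (B j) := fun j => isUnit_of_spectrum_eq (hB j) (hβ j)
  have hBd := isUnit_blockDiagonal'_iff.mpr hBu
  suffices h : (F' z).toBlocks₁₂ = (F z).toBlocks₁₂ by
    rw [hF'.unipotent z, hF.unipotent z, h]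
  have key : ∀ x y, ∃ G : ℂ → ℂ, (∀ z ≠ 0, DifferentiableAt ℂ G z) ∧
      ∀ z, z ≠ 0 → z ∉ spiral q (-c) →
        (F' z).toBlocks₁₂ x y - (F z).toBlocks₁₂ x y = (theta q (z / c) ^ δ)⁻¹ * G z := by
    intro x y
    obtain ⟨G, hG, hGe⟩ := exists_differentiable_numerator hq δ hc
      (fun z hz hzc => hF.analytic z hz hzc (Sum.inl x) (Sum.inr y))
      (fun z hz => hF.polar z hz (Sum.inl x) (Sum.inr y))
    obtain ⟨G', hG', hGe'⟩ := exists_differentiable_numerator hq δ hc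
      (fun z hz hzc => hF'.analytic z hz hzc (Sum.inl x) (Sum.inr y))
      (fun z hz => hF'.polar z hz (Sum.inl x) (Sum.inr y))
    refine ⟨fun z => G' z - G z, fun z hz => (hG' z hz).sub (hG z hz), fun z hz hzc => ?_⟩
    rw [mul_sub, ← hGe z hz hzc, ← hGe' z hz hzc]
    rfl
  choose G hG hGe using key
  rw [← sub_eq_zero]
  refine blk_ext fun i j => ?_
  refine eq_zero_of_homogeneous hq (isNilpotent_conjOp_block_sub hβ hA hB i j) hc (hcr i j)
    (f := fun z => blk ((F' z).toBlocks₁₂ - (F z).toBlocks₁₂) i j)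
    (G := fun z => Matrix.of fun k l => G ⟨i, k⟩ ⟨j, l⟩ z)
    (fun z hz => differentiableAt_matrix_iff.mpr fun k l => hG _ _ z hz) ?_ ?_ z hz hzc
  · intro z hz hzc
    ext k l
    exact hGe ⟨i, k⟩ ⟨j, l⟩ z hz hzc
  · intro z hz hzc
    rw [← blk_conjOp A hBu, ← blk_smul, smul_sub, map_sub, hF'.equation hBd hz hzc,
      hF.equation hBd hz hzc, add_sub_add_right_eq_sub]

/-- The choice made by `Classical.epsilon` is harmless: uniqueness identifies it with the explicit
solution off the spiral. -/
theorem qSum_eq {q : ℂ} (hq : 1 < ‖q‖) {δ : ℕ} (μ : ℤ) (hα : ∀ i, α i ≠ 0)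
    (hβ : ∀ j, β j ≠ 0) (hA : ∀ i, spectrum ℂ (A i) = {α i}) (hB : ∀ j, spectrum ℂ (B j) = {β j})
    (U : Fin δ → Matrix (Σ i, Fin (r i)) (Σ j, Fin (s j)) ℂ) {c : ℂ} (hc : c ≠ 0)
    (hcr : ∀ i j, ∀ n : ℤ, c ^ δ * q ^ n ≠ α i / β j) {z : ℂ} (hz : z ≠ 0)
    (hzc : z ∉ spiral q (-c)) :
    qSum q δ (gradedMat δ μ (Matrix.blockDiagonal' A) (Matrix.blockDiagonal' B))
      (modMat δ μ (Matrix.blockDiagonal' A) (Matrix.blockDiagonal' B) U) c z =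
    Matrix.fromBlocks 1 (matSol q A B U c z) 0 1 :=
  have h := isSummation_matSol hq μ hα hβ hA hB U hc hcr
  h.unique hq hβ hA hB hc hcr (Classical.epsilon_spec ⟨_, h⟩) hz hzc

theorem fromBlocks_one_inv_mul {m n : Type*} [Fintype m] [DecidableEq m] [Fintype n]
    [DecidableEq n] (f g : Matrix m n ℂ) :
    (Matrix.fromBlocks 1 f 0 1)⁻¹ * Matrix.fromBlocks 1 g 0 1 =
      (Matrix.fromBlocks 1 (g - f) 0 1 : Matrix (m ⊕ n) (m ⊕ n) ℂ) := by
  have : (Matrix.fromBlocks 1 f 0 1 : Matrix (m ⊕ n) (m ⊕ n) ℂ)⁻¹ =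
      Matrix.fromBlocks 1 (-f) 0 1 := by
    refine Matrix.inv_eq_right_inv ?_
    simp [Matrix.fromBlocks_multiply]
  rw [this, Matrix.fromBlocks_multiply]
  simp [sub_eq_add_neg]

theorem unipotentLog_fromBlocks {m n : Type*} [Fintype m] [DecidableEq m] [Fintype n]
    [DecidableEq n] (f : Matrix m n ℂ) :
    unipotentLog (Matrix.fromBlocks 1 f 0 1) = Matrix.fromBlocks 0 f 0 0 := by
  have h1 : (Matrix.fromBlocks 1 f 0 1 : Matrix (m ⊕ n) (m ⊕ n) ℂ) - 1 =
      Matrix.fromBlocks 0 f 0 0 := by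
    rw [sub_eq_iff_eq_add, ← Matrix.fromBlocks_one, Matrix.fromBlocks_add]
    simp
  have h2 : (Matrix.fromBlocks 0 f 0 0 : Matrix (m ⊕ n) (m ⊕ n) ℂ) *
      Matrix.fromBlocks 0 f 0 0 = 0 := by
    simp [Matrix.fromBlocks_multiply]
  rw [unipotentLog, h1]
  -- For size `0` the range is empty and the linear term is missing from the logarithm; otherwise it
  -- is the only nonzero term, since the square vanishes.
  rcases Nat.eq_zero_or_pos (Fintype.card (m ⊕ n)) with h0 | h0
  · have := Fintype.card_eq_zero_iff.mp h0
    exact Subsingleton.elim _ _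
  · rw [Finset.sum_eq_single 0]
    · simp
    · intro k _ hk
      obtain ⟨k, rfl⟩ := Nat.exists_eq_succ_of_ne_zero hk
      have h3 := pow_succ (Matrix.fromBlocks 0 f 0 0 : Matrix (m ⊕ n) (m ⊕ n) ℂ) k
      rw [pow_succ _ (k + 1), h3, mul_assoc, h2, mul_zero, smul_zero]
    · intro h
      exact absurd (Finset.mem_range.mpr h0) h

theorem logStokes_eq {q : ℂ} (hq : 1 < ‖q‖) {δ : ℕ} (μ : ℤ) (hα : ∀ i, α i ≠ 0)
    (hβ : ∀ j, β j ≠ 0) (hA : ∀ i, spectrum ℂ (A i) = {α i}) (hB : ∀ j, spectrum ℂ (B j) = {β j})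
    (U : Fin δ → Matrix (Σ i, Fin (r i)) (Σ j, Fin (s j)) ℂ) {a : ℂ} (ha : a ≠ 0) {c₀ c : ℂ}
    (hc₀ : c₀ ≠ 0) (hcr₀ : ∀ i j, ∀ n : ℤ, c₀ ^ δ * q ^ n ≠ α i / β j) (hac₀ : a ∉ spiral q (-c₀))
    (hc : c ≠ 0) (hcr : ∀ i j, ∀ n : ℤ, c ^ δ * q ^ n ≠ α i / β j) (hac : a ∉ spiral q (-c)) :
    logStokes q δ (gradedMat δ μ (Matrix.blockDiagonal' A) (Matrix.blockDiagonal' B))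
      (modMat δ μ (Matrix.blockDiagonal' A) (Matrix.blockDiagonal' B) U) c₀ a c =
    Matrix.fromBlocks 0 (matSol q A B U c a - matSol q A B U c₀ a) 0 0 := by
  rw [logStokes, qSum_eq hq μ hα hβ hA hB U hc₀ hcr₀ ha hac₀,
    qSum_eq hq μ hα hβ hA hB U hc hcr ha hac, fromBlocks_one_inv_mul, unipotentLog_fromBlocks]

/-- The points `a` and `c` play symmetric roles: `a ∈ [-c;q]` amounts to `c ∈ [-a;q]`. -/
theorem eventually_notMem_spiral_neg {q : ℂ} (hq : 1 < ‖q‖) {a ξ : ℂ} (ha : a ≠ 0) (hξ : ξ ≠ 0) :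
    ∀ᶠ c in 𝓝[≠] ξ, a ∉ spiral q (-c) := by
  have hq0 := ne_zero_of_one_lt_norm hq
  filter_upwards [eventually_notMem_spiral hq ha hξ] with c hc ⟨n, hn⟩
  refine hc ⟨-n, ?_⟩
  rw [hn, neg_mul, neg_mul, neg_mul, neg_neg, mul_assoc, ← zpow_add₀ hq0, add_neg_cancel, zpow_zero, mul_one]

theorem eventually_logStokes_eq {q : ℂ} (hq : 1 < ‖q‖) {δ : ℕ} (hδ : 0 < δ) (μ : ℤ)
    (hα : ∀ i, α i ≠ 0)
    (hβ : ∀ j, β j ≠ 0) (hA : ∀ i, spectrum ℂ (A i) = {α i}) (hB : ∀ j, spectrum ℂ (B j) = {β j})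
    (U : Fin δ → Matrix (Σ i, Fin (r i)) (Σ j, Fin (s j)) ℂ) {a : ℂ} (ha : a ≠ 0) {c₀ ξ : ℂ}
    (hc₀ : c₀ ≠ 0) (hcr₀ : ∀ i j, ∀ n : ℤ, c₀ ^ δ * q ^ n ≠ α i / β j) (hac₀ : a ∉ spiral q (-c₀))
    (hξ : ξ ≠ 0) : ∀ᶠ c in 𝓝[≠] ξ,
    logStokes q δ (gradedMat δ μ (Matrix.blockDiagonal' A) (Matrix.blockDiagonal' B))
      (modMat δ μ (Matrix.blockDiagonal' A) (Matrix.blockDiagonal' B) U) c₀ a c =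
    Matrix.fromBlocks 0 (matSol q A B U c a - matSol q A B U c₀ a) 0 0 := by
  have h1 : ∀ᶠ c in 𝓝[≠] ξ, ∀ i j, ∀ n : ℤ, c ^ δ * q ^ n ≠ α i / β j := by
    refine eventually_all.mpr fun i => eventually_all.mpr fun j => ?_
    exact eventually_nonresonant hq hδ (div_ne_zero (hα i) (hβ j)) hξ
  have h2 : ∀ᶠ c in 𝓝[≠] ξ, c ≠ 0 := (eventually_ne_nhds hξ).filter_mono nhdsWithin_le_nhds
  filter_upwards [h1, h2, eventually_notMem_spiral_neg hq ha hξ] with c hcr hc hac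
  exact logStokes_eq hq μ hα hβ hA hB U ha hc₀ hcr₀ hac₀ hc hcr hac

theorem meromorphicAt_logStokes {q : ℂ} (hq : 1 < ‖q‖) {δ : ℕ} (hδ : 0 < δ) (μ : ℤ)
    (hα : ∀ i, α i ≠ 0)
    (hβ : ∀ j, β j ≠ 0) (hA : ∀ i, spectrum ℂ (A i) = {α i}) (hB : ∀ j, spectrum ℂ (B j) = {β j})
    (U : Fin δ → Matrix (Σ i, Fin (r i)) (Σ j, Fin (s j)) ℂ) {a : ℂ} (ha : a ≠ 0) {c₀ ξ : ℂ}
    (hc₀ : c₀ ≠ 0) (hcr₀ : ∀ i j, ∀ n : ℤ, c₀ ^ δ * q ^ n ≠ α i / β j) (hac₀ : a ∉ spiral q (-c₀))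
    (hξ : ξ ≠ 0) (haξ : a ∉ spiral q (-ξ)) (x y) : MeromorphicAt (fun c =>
    logStokes q δ (gradedMat δ μ (Matrix.blockDiagonal' A) (Matrix.blockDiagonal' B))
      (modMat δ μ (Matrix.blockDiagonal' A) (Matrix.blockDiagonal' B) U) c₀ a c x y) ξ := by
  have h := eventually_logStokes_eq hq hδ μ hα hβ hA hB U ha hc₀ hcr₀ hac₀ hξ
  refine MeromorphicAt.congr ?_ (h.mono fun c hc => (congrFun (congrFun hc x) y).symm)
  rcases x with x | x <;> rcases y with y | y
  · exact analyticAt_const.meromorphicAt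
  · refine MeromorphicAt.sub ?_ (analyticAt_const.meromorphicAt)
    have h1 := meromorphicAt_qSol hq hδ (div_ne_zero (hα x.1) (hβ y.1))
      (isNilpotent_conjOp_block_sub hβ hA hB x.1 y.1) (fun k => blk (U k) x.1 y.1) hξ ha haξ
    obtain ⟨n, hn⟩ := h1
    exact ⟨n, (entryCLM x.2 y.2).analyticAt _ |>.comp hn⟩
  · exact analyticAt_const.meromorphicAt
  · exact analyticAt_const.meromorphicAt

end Summation

/-! ### Residues of the Stokes operators -/

section AlienDerivations

attribute [local instance] Matrix.normedAddCommGroup Matrix.normedSpace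

/-- The spectrum is a single point, so one contour remains. Nonemptiness of the index types keeps
the spectrum from being empty. -/
theorem holoCalc_eq {m n : Type*} [Fintype m] [Fintype n] [Nonempty m] [Nonempty n]
    {L : Module.End ℂ (Matrix m n ℂ)} {ξ : ℂ} (hL : IsNilpotent (L - algebraMap ℂ _ ξ)) {h : ℂ → ℂ}
    {H : Module.End ℂ (Matrix m n ℂ)}
    (hH : ∀ v, HasResidue (fun c => h c • resolvent L c v) ξ (H v)) (X : Matrix m n ℂ) :
    holoCalc h L X = H X := by
  have hs : spectrum ℂ L = {ξ} := by
    refine (spectrum.nonempty_of_isAlgClosed_of_finiteDimensional ℂ L).subset_singleton_iff.mp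
      fun w hw => ?_
    by_contra hne
    exact hw (isUnit_algebraMap_sub hL hne)
  rw [holoCalc, hs, finsum_mem_singleton]
  ext x y
  exact ((hH X).map (entryCLM x y)).residue_eq

/-- Entrywise, a Vandermonde system at the powers of a primitive `δ`-th root of unity. -/
theorem eq_zero_of_sum_rootsOfUnity_smul_eq_zero {m n : Type*} {δ : ℕ} (hδ : 0 < δ)
    {X : Fin δ → Matrix m n ℂ}
    (h : ∀ ζ : ℂ, ζ ^ δ = 1 → ∑ k : Fin δ, ζ ^ (k : ℕ) • X k = 0) (k : Fin δ) : X k = 0 := by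
  have hω := Complex.isPrimitiveRoot_exp δ hδ.ne'
  set ω := Complex.exp (2 * Real.pi * Complex.I / δ)
  have hinj : Function.Injective fun l : Fin δ => ω ^ (l : ℕ) := fun l l' hl =>
    Fin.ext (hω.pow_inj l.2 l'.2 hl)
  ext x y
  refine congrFun (Matrix.eq_zero_of_forall_index_sum_pow_mul_eq_zero
    (v := fun k => X k x y) hinj fun l => ?_) k
  have h1 := h (ω ^ (l : ℕ)) (by rw [← pow_mul, mul_comm, pow_mul, hω.pow_eq_one, one_pow])
  have h2 := congrFun (congrFun h1 x) y
  simpa [Matrix.sum_apply] using h2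

variable {ι κ : Type*} [Fintype ι] [DecidableEq ι] [Fintype κ] [DecidableEq κ]
  {r : ι → ℕ} {s : κ → ℕ}
  {A : ∀ i, Matrix (Fin (r i)) (Fin (r i)) ℂ} {B : ∀ j, Matrix (Fin (s j)) (Fin (s j)) ℂ}
  {α : ι → ℂ} {β : κ → ℂ}

/-- The sum in the direction `c₀` does not depend on `c`, hence contributes no residue. -/
theorem alienDer_block {q : ℂ} (hq : 1 < ‖q‖) {δ : ℕ} (hδ : 0 < δ) (μ : ℤ)
    (hα : ∀ i, α i ≠ 0)
    (hβ : ∀ j, β j ≠ 0) (hA : ∀ i, spectrum ℂ (A i) = {α i}) (hB : ∀ j, spectrum ℂ (B j) = {β j})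
    (U : Fin δ → Matrix (Σ i, Fin (r i)) (Σ j, Fin (s j)) ℂ) {a : ℂ} (ha : a ≠ 0) {c₀ ξ : ℂ}
    (hc₀ : c₀ ≠ 0) (hcr₀ : ∀ i j, ∀ n : ℤ, c₀ ^ δ * q ^ n ≠ α i / β j) (hac₀ : a ∉ spiral q (-c₀))
    (hξ : ξ ≠ 0) {i : ι} {j : κ}
    {v : Matrix (Fin (r i)) (Fin (s j)) ℂ}
    (hv : HasResidue (fun c => qSol q (conjOp (A i) (B j)) (fun k => blk (U k) i j) c a) ξ v) :
    blk (alienDer q δ (gradedMat δ μ (Matrix.blockDiagonal' A) (Matrix.blockDiagonal' B))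
      (modMat δ μ (Matrix.blockDiagonal' A) (Matrix.blockDiagonal' B) U) c₀ a ξ).toBlocks₁₂ i j
        = v := by
  ext k l
  refine HasResidue.residue_eq (f := fun c => logStokes q δ _ _ c₀ a c _ _) ?_
  have h1 := (hv.map (entryCLM k l)).sub (hasResidue_of_analyticAt
    (f := fun _ => matSol q A B U c₀ a ⟨i, k⟩ ⟨j, l⟩) (ξ := ξ) analyticAt_const)
  rw [sub_zero] at h1
  refine h1.congr ?_
  filter_upwards [eventually_logStokes_eq hq hδ μ hα hβ hA hB U ha hc₀ hcr₀ hac₀ hξ] with c hc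
  rw [hc]
  rfl

/-- If `a = -ξ q^m`, then `-a` would be resonant together with `ξ`. This is why the basepoint
condition concerns `-a`: it keeps `θ(a/ξ)` nonzero at every prohibited `ξ`. -/
theorem notMem_spiral_neg_of_resonant {q : ℂ} (hq : q ≠ 0) {δ : ℕ} {a ξ τ : ℂ}
    (ha : ∀ n : ℤ, (-a) ^ δ * q ^ n ≠ τ) {n : ℤ} (hn : ξ ^ δ * q ^ n = τ) :
    a ∉ spiral q (-ξ) := by
  rintro ⟨m, hm⟩
  refine ha (n - m * δ) ?_
  rw [← hn, hm, neg_mul, neg_neg, mul_pow, mul_assoc, ← zpow_natCast (q ^ m), ← zpow_mul,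
    ← zpow_add₀ hq]
  congr 2
  ring

variable {ρ : ℂ → ℂ}

omit [Fintype ι] [DecidableEq ι] [Fintype κ] [DecidableEq κ] in
theorem isUnit_smul_Lcomp {δ : ℕ} (hδ : 0 < δ) (hρ : ∀ x, x ≠ 0 → ρ x ^ δ = x)
    (hα : ∀ i, α i ≠ 0) (hβ : ∀ j, β j ≠ 0) (hA : ∀ i, spectrum ℂ (A i) = {α i})
    (hB : ∀ j, spectrum ℂ (B j) = {β j}) (i : ι) (j : κ) {w : ℂ} (hw : w ≠ 0) :
    IsUnit (w • Lcomp δ ρ α β A B i j) := by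
  have hρ0 : ∀ x, x ≠ 0 → ρ x ≠ 0 := fun x hx h => hx (by rw [← hρ x hx, h, zero_pow hδ.ne'])
  have := isUnit_aeval_of_eval_ne_zero (isNilpotent_smul_Lcomp_sub hδ hρ hα hβ hA hB i j w)
    (p := Polynomial.X)
    (by simpa using div_ne_zero (mul_ne_zero hw (hρ0 _ (hα i))) (hρ0 _ (hβ j)))
  simpa using this

/-- The alien derivations in terms of the Laurent coefficients of `θ^δ`. -/
theorem exists_alienDer_block_eq {q : ℂ} (hq : 1 < ‖q‖) {δ : ℕ} (hδ : 0 < δ) (μ : ℤ)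
    (hρ : ∀ x, x ≠ 0 → ρ x ^ δ = x) (hα : ∀ i, α i ≠ 0)
    (hβ : ∀ j, β j ≠ 0) (hA : ∀ i, spectrum ℂ (A i) = {α i}) (hB : ∀ j, spectrum ℂ (B j) = {β j})
    {a : ℂ} (ha : a ≠ 0) (har : ∀ i j, ∀ n : ℤ, (-a) ^ δ * q ^ n ≠ α i / β j) {c₀ : ℂ}
    (hc₀ : c₀ ≠ 0) (hcr₀ : ∀ i j, ∀ n : ℤ, c₀ ^ δ * q ^ n ≠ α i / β j) (hac₀ : a ∉ spiral q (-c₀))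
    (i : ι) (j : κ) {n : ℤ} {w : ℂ} (hw : w ^ δ * q ^ n = 1) :
    ∃ H : Module.End ℂ (Matrix (Fin (r i)) (Fin (s j)) ℂ), IsUnit H ∧
      (∀ v, HasResidue (fun c => ((theta q (a / c) ^ δ)⁻¹ * ((a / (q * c)) ^ n)) •
        resolvent (w • Lcomp δ ρ α β A B i j) c v) (w * ρ (α i) / ρ (β j)) (H v)) ∧
      ∀ U : Fin δ → Matrix (Σ i, Fin (r i)) (Σ j, Fin (s j)) ℂ,
        blk (alienDer q δ (gradedMat δ μ (Matrix.blockDiagonal' A) (Matrix.blockDiagonal' B))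
          (modMat δ μ (Matrix.blockDiagonal' A) (Matrix.blockDiagonal' B) U) c₀ a
            (w * ρ (α i) / ρ (β j))).toBlocks₁₂ i j =
        H (Ring.inverse ((δ : ℂ) • (w • Lcomp δ ρ α β A B i j) ^ (δ - 1))
          (∑ k : Fin δ, ((w • Lcomp δ ρ α β A B i j) ^ (k : ℕ))
            (thetaPowCoeff q δ (n - k) • blk (U k) i j))) := by
  have hq0 := ne_zero_of_one_lt_norm hq
  have hρ0 : ∀ x, x ≠ 0 → ρ x ≠ 0 := fun x hx h => hx (by rw [← hρ x hx, h, zero_pow hδ.ne'])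
  have hw0 : w ≠ 0 := fun h => by simp [h, hδ.ne'] at hw
  set ξ := w * ρ (α i) / ρ (β j) with hξdef
  have hξ : ξ ≠ 0 := div_ne_zero (mul_ne_zero hw0 (hρ0 _ (hα i))) (hρ0 _ (hβ j))
  have hn : ξ ^ δ * q ^ n = α i / β j := by
    rw [hξdef, div_pow, mul_pow, hρ _ (hα i), hρ _ (hβ j), div_mul_eq_mul_div, mul_right_comm, hw,
      one_mul]
  have haξ := notMem_spiral_neg_of_resonant hq0 (har i j) hn
  have hL := isNilpotent_smul_Lcomp_sub hδ hρ hα hβ hA hB i j w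
  -- The relation `ξ^δ q^n = τ` lifted to operators.
  have hLT : q ^ n • (w • Lcomp δ ρ α β A B i j) ^ δ = conjOp (A i) (B j) := by
    rw [smul_pow, smul_smul, mul_comm, hw, one_smul, Lcomp_pow hδ hρ hα hβ hA hB]
  obtain ⟨h1, h2⟩ := analyticAt_inv_theta_pow hq δ hξ ha haξ
  have hqξ : q * ξ ≠ 0 := mul_ne_zero hq0 hξ
  have h3 : AnalyticAt ℂ (fun c => (theta q (a / c) ^ δ)⁻¹ * ((a / (q * c)) ^ n)) ξ :=
    h1.mul ((analyticAt_const.div (analyticAt_const.mul analyticAt_id) hqξ).fun_zpow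
      (div_ne_zero ha hqξ))
  obtain ⟨H, hHu, hH⟩ := exists_functionalCalculus hL h3
  refine ⟨H, hHu (mul_ne_zero h2 (zpow_ne_zero _ (div_ne_zero ha hqξ))), hH, fun U => ?_⟩
  exact alienDer_block hq hδ μ hα hβ hA hB U ha hc₀ hcr₀ hac₀ hξ
    (hasResidue_qSol hq hδ (div_ne_zero (hα i) (hβ j))
      (isNilpotent_conjOp_block_sub hβ hA hB i j) (fun k => blk (U k) i j) hξ ha haξ hn hL hLT hH)

theorem injective_of_isUnit {E : Type*} [AddCommGroup E] [Module ℂ E] {T : Module.End ℂ E}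
    (hT : IsUnit T) : Function.Injective T :=
  ((Module.End.isUnit_iff T).mp hT).1

theorem isUnit_ring_inverse_smul_pow {E : Type*} [AddCommGroup E] [Module ℂ E] {δ : ℕ}
    (hδ : 0 < δ) {T : Module.End ℂ E} (hT : IsUnit T) :
    IsUnit (Ring.inverse ((δ : ℂ) • T ^ (δ - 1))) := by
  refine IsUnit.ringInverse ?_
  have hδ0 : (δ : ℂ) ≠ 0 := by exact_mod_cast hδ.ne'
  exact (hT.pow _).smul (Units.mk0 _ hδ0)

/-- The coefficients of a polynomial are determined, up to the coefficients of `θ^δ`, by its values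
at the `w L` where `w^δ q^n = 1`. -/
theorem thetaPowCoeff_smul_eq_zero {m n : Type*} {q : ℂ} (hq : q ≠ 0) {δ : ℕ} (hδ : 0 < δ)
    {L : Module.End ℂ (Matrix m n ℂ)} (hL : IsUnit L) (N : ℤ) {D : Fin δ → Matrix m n ℂ}
    (h : ∀ w : ℂ, w ^ δ * q ^ N = 1 → ∑ k : Fin δ, ((w • L) ^ (k : ℕ)) (D k) = 0) (k : Fin δ) :
    D k = 0 := by
  -- One solution `w` suffices to start from: its multiples by `δ`-th roots of unity are also
  -- admissible and separate the terms `(w L)^k (D k)`.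
  obtain ⟨w, hw⟩ := IsAlgClosed.exists_pow_nat_eq (q ^ (-N)) hδ
  have hw1 : w ^ δ * q ^ N = 1 := by rw [hw, ← zpow_add₀ hq, neg_add_cancel, zpow_zero]
  have hw0 : w ≠ 0 := fun h => by simp [h, hδ.ne'] at hw1
  have h1 := eq_zero_of_sum_rootsOfUnity_smul_eq_zero hδ
    (X := fun k => ((w • L) ^ (k : ℕ)) (D k)) (fun ζ hζ => by
      rw [← h (ζ * w) (by rw [mul_pow, hζ, one_mul, hw1])]
      refine Finset.sum_congr rfl fun k _ => ?_
      rw [mul_smul, smul_pow ζ]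
      rfl) k
  have hu : IsUnit ((w • L) ^ (k : ℕ)) := (hL.smul (Units.mk0 w hw0)).pow _
  exact injective_of_isUnit hu (h1.trans (map_zero _).symm)

/-- Otherwise `θ^δ` would vanish identically, while `θ` is nonzero off its spiral. -/
theorem exists_thetaPowCoeff_ne_zero {q : ℂ} (hq : 1 < ‖q‖) (δ : ℕ) :
    ∃ n, thetaPowCoeff q δ n ≠ 0 := by
  by_contra! h
  obtain ⟨z, hz, hz0⟩ := ((eventually_notMem_spiral hq one_ne_zero one_ne_zero).and
    ((eventually_ne_nhds one_ne_zero).filter_mono nhdsWithin_le_nhds)).exists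
  have h1 := (thetaPowCoeff_spec hq δ).2 z hz0
  simp only [h, smul_zero, tsum_zero] at h1
  have h2 := theta_div_ne_zero hq one_ne_zero hz0 hz
  rw [div_one] at h2
  exact pow_ne_zero δ h2 h1.symm

/-- The map acting block by block on a family of matrices. -/
def blockEquiv {Ω : Type*}
    (K : ∀ (_ : Ω) (i : ι) (j : κ), (Module.End ℂ (Matrix (Fin (r i)) (Fin (s j)) ℂ))ˣ) :
    (Ω → Matrix (Σ i, Fin (r i)) (Σ j, Fin (s j)) ℂ) ≃ₗ[ℂ]
      (Ω → Matrix (Σ i, Fin (r i)) (Σ j, Fin (s j)) ℂ) where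
  toFun Y ζ := Matrix.of fun x y =>
    (K ζ x.1 y.1 : Module.End ℂ _) (blk (Y ζ) x.1 y.1) x.2 y.2
  invFun Y ζ := Matrix.of fun x y =>
    ((K ζ x.1 y.1)⁻¹.1 : Module.End ℂ _) (blk (Y ζ) x.1 y.1) x.2 y.2
  map_add' Y Z := by
    ext ζ x y
    simp [blk_add]
  map_smul' t Y := by
    ext ζ x y
    simp [blk_smul]
  left_inv Y := by
    ext1 ζ
    refine blk_ext fun i j => ?_
    exact LinearMap.congr_fun (K ζ i j).inv_mul (blk (Y ζ) i j)
  right_inv Y := by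
    ext1 ζ
    refine blk_ext fun i j => ?_
    exact LinearMap.congr_fun (K ζ i j).mul_inv (blk (Y ζ) i j)

omit [Fintype ι] [DecidableEq ι] [Fintype κ] [DecidableEq κ] in
theorem blk_blockEquiv {Ω : Type*}
    (K : ∀ (_ : Ω) (i : ι) (j : κ), (Module.End ℂ (Matrix (Fin (r i)) (Fin (s j)) ℂ))ˣ)
    (Y : Ω → Matrix (Σ i, Fin (r i)) (Σ j, Fin (s j)) ℂ) (ζ : Ω) (i : ι) (j : κ) :
    blk (blockEquiv K Y ζ) i j = (K ζ i j : Module.End ℂ _) (blk (Y ζ) i j) := rfl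

theorem blk_borelInvariant (q : ℂ) {δ : ℕ} (hδ : 0 < δ) (hρ : ∀ x, x ≠ 0 → ρ x ^ δ = x)
    (hβ : ∀ j, β j ≠ 0) (hB : ∀ j, spectrum ℂ (B j) = {β j})
    (U : Fin δ → Matrix (Σ i, Fin (r i)) (Σ j, Fin (s j)) ℂ) (ζ : rootsOfUnity δ ℂ)
    (i : ι) (j : κ) :
    blk (borelInvariant q ρ α β A B U ζ) i j =
      ∑ k : Fin δ, ((((ζ : ℂˣ) : ℂ) • Lcomp δ ρ α β A B i j) ^ (k : ℕ))
        (thetaPowCoeff q δ (-((k : ℕ) : ℤ)) • blk (U k) i j) := by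
  have hS : ∀ j, IsUnit (unipRoot δ ρ (β j) (B j)) := fun j => by
    rw [← isUnit_pow_iff hδ.ne', unipRoot_pow hδ (hρ _ (hβ j)) (hβ j) (hB j)]
    exact isUnit_of_spectrum_eq (hB j) (hβ j)
  rw [borelInvariant, evalOp, blk_sum]
  refine Finset.sum_congr rfl fun k _ => ?_
  rw [qBorel, ← blk_smul]
  generalize thetaPowCoeff q δ (-((k : ℕ) : ℤ)) • U k = X
  generalize (k : ℕ) = k
  induction k with
  | zero => rfl
  | succ k ih =>
    rw [pow_succ', pow_succ', Module.End.mul_apply, Module.End.mul_apply, ← ih,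
      LinearMap.smul_apply, LinearMap.smul_apply, blk_smul]
    congr 1
    exact blk_conjOp _ hS _ i j

end AlienDerivations

/-! ### Analytic classification -/

section Classification

attribute [local instance] Matrix.normedAddCommGroup Matrix.normedSpace

theorem meromorphicAt_zpow_smul {E : Type*} [NormedAddCommGroup E] [NormedSpace ℂ E] {f : ℂ → E}
    (hf : MeromorphicAt f 0) (n : ℤ) : MeromorphicAt (fun z => z ^ n • f z) 0 :=
  ((MeromorphicAt.id 0).zpow n).smul hf

theorem meromorphicAt_matrix {m n : Type*} [Fintype m] [Fintype n] [DecidableEq m] [DecidableEq n]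
    {f : ℂ → Matrix m n ℂ} {z : ℂ} (h : ∀ x y, MeromorphicAt (fun w => f w x y) z) :
    MeromorphicAt f z := by
  have h1 : ∀ x y, MeromorphicAt (fun w => f w x y • Matrix.single x y (1 : ℂ)) z := fun x y =>
    (h x y).smul analyticAt_const.meromorphicAt
  have h2 : f = fun w => ∑ x, ∑ y, f w x y • Matrix.single x y (1 : ℂ) := by
    ext1 w
    conv_lhs => rw [Matrix.matrix_eq_sum_single (f w)]
    simp
  rw [h2]
  exact MeromorphicAt.fun_sum fun x _ => MeromorphicAt.fun_sum fun y _ => h1 x y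

theorem meromorphicAt_matrix_entry {m n : Type*} [Fintype m] [Fintype n]
    {f : ℂ → Matrix m n ℂ} {z : ℂ} (h : MeromorphicAt f z) (x : m) (y : n) :
    MeromorphicAt (fun w => f w x y) z := by
  obtain ⟨k, hk⟩ := h
  exact ⟨k, ((entryCLM x y).analyticAt _).comp hk⟩

variable {ι κ : Type*} [Fintype ι] [DecidableEq ι] [Fintype κ] [DecidableEq κ]
  {r : ι → ℕ} {s : κ → ℕ}
  {A : ∀ i, Matrix (Fin (r i)) (Fin (r i)) ℂ} {B : ∀ j, Matrix (Fin (s j)) (Fin (s j)) ℂ}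
  {α : ι → ℂ} {β : κ → ℂ}

omit [Fintype ι] [DecidableEq ι] [Fintype κ] [DecidableEq κ] in
theorem isUnit_conjOp_block (hα : ∀ i, α i ≠ 0) (hβ : ∀ j, β j ≠ 0)
    (hA : ∀ i, spectrum ℂ (A i) = {α i}) (hB : ∀ j, spectrum ℂ (B j) = {β j}) (i : ι) (j : κ) :
    IsUnit (conjOp (A i) (B j)) := by
  have := isUnit_aeval_of_eval_ne_zero (isNilpotent_conjOp_block_sub hβ hA hB i j)
    (p := Polynomial.X) (by simpa using div_ne_zero (hα i) (hβ j))
  simpa using this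

/-- The normal form is unique, so completeness of the alien derivations reduces to their determining
`U`. -/
theorem analyticEquiv_modMat_iff {q : ℂ} (hq : 1 < ‖q‖) {δ : ℕ} (hδ : 0 < δ) (μ : ℤ)
    (hα : ∀ i, α i ≠ 0) (hβ : ∀ j, β j ≠ 0) (hA : ∀ i, spectrum ℂ (A i) = {α i})
    (hB : ∀ j, spectrum ℂ (B j) = {β j})
    (U U' : Fin δ → Matrix (Σ i, Fin (r i)) (Σ j, Fin (s j)) ℂ) :
    AnalyticEquiv q (modMat δ μ (Matrix.blockDiagonal' A) (Matrix.blockDiagonal' B) U)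
      (modMat δ μ (Matrix.blockDiagonal' A) (Matrix.blockDiagonal' B) U') ↔ U = U' := by
  have hBu : ∀ j, IsUnit (B j) := fun j => isUnit_of_spectrum_eq (hB j) (hβ j)
  constructor
  · rintro ⟨F, hF, h⟩
    ext1 k
    rw [← sub_eq_zero, ← neg_sub, neg_eq_zero]
    refine blk_ext fun i j => ?_
    refine normalForm_unique hq hδ (isUnit_conjOp_block hα hβ hA hB i j)
      (D := fun k => blk (U' k - U k) i j) (F := fun z => blk (F z) i j)
      (meromorphicAt_matrix fun x y => hF ⟨i, x⟩ ⟨j, y⟩) ?_ k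
    filter_upwards [h, self_mem_nhdsWithin] with z hz hz0
    have h1 := (gauge_triMat_iff δ μ _ (isUnit_blockDiagonal'_iff.mpr hBu) hz0 _ _ rfl rfl).mp hz
    have h2 := congrArg (fun X => blk X i j) h1
    rw [blk_add, blk_add, blk_conjOp A hBu, blk_polyEval, blk_polyEval, blk_smul] at h2
    simp only [blk_sub, smul_sub, Finset.sum_sub_distrib]
    rw [← add_sub_assoc, ← h2, add_sub_cancel_left]
  · rintro rfl
    refine ⟨fun _ => 0, fun _ _ => analyticAt_const.meromorphicAt, Eventually.of_forall fun z => ?_⟩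
    simp

theorem exists_analyticEquiv_modMat {q : ℂ} (hq : 1 < ‖q‖) {δ : ℕ} (hδ : 0 < δ) (μ : ℤ)
    (hα : ∀ i, α i ≠ 0) (hβ : ∀ j, β j ≠ 0) (hA : ∀ i, spectrum ℂ (A i) = {α i})
    (hB : ∀ j, spectrum ℂ (B j) = {β j}) {W : ℂ → Matrix (Σ i, Fin (r i)) (Σ j, Fin (s j)) ℂ}
    (hW : ∀ x y, MeromorphicAt (fun z => W z x y) 0) :
    ∃ U : Fin δ → Matrix (Σ i, Fin (r i)) (Σ j, Fin (s j)) ℂ,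
      AnalyticEquiv q (triMat δ μ (Matrix.blockDiagonal' A) (Matrix.blockDiagonal' B) W)
        (modMat δ μ (Matrix.blockDiagonal' A) (Matrix.blockDiagonal' B) U) := by
  have hBu : ∀ j, IsUnit (B j) := fun j => isUnit_of_spectrum_eq (hB j) (hβ j)
  have hBd := isUnit_blockDiagonal'_iff.mpr hBu
  set V : ℂ → Matrix (Σ i, Fin (r i)) (Σ j, Fin (s j)) ℂ := fun z =>
    z ^ (-μ) • (W z * (Matrix.blockDiagonal' B)⁻¹) with hVdef
  have hV : MeromorphicAt V 0 := by
    refine meromorphicAt_zpow_smul (meromorphicAt_matrix fun x y => ?_) (-μ)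
    simp only [Matrix.mul_apply]
    exact MeromorphicAt.fun_sum fun k _ => (hW x k).mul analyticAt_const.meromorphicAt
  have key : ∀ i j, HasNormalForm q δ (conjOp (A i) (B j)) fun z => blk (V z) i j := fun i j =>
    hasNormalForm_of_meromorphicAt hq hδ (isUnit_conjOp_block hα hβ hA hB i j)
      (meromorphicAt_matrix fun x y => meromorphicAt_matrix_entry hV ⟨i, x⟩ ⟨j, y⟩)
  choose U F hF h using key
  refine ⟨fun k => Matrix.of fun x y => U x.1 y.1 k x.2 y.2,
    fun z => Matrix.of fun x y => F x.1 y.1 z x.2 y.2,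
    fun x y => meromorphicAt_matrix_entry (hF x.1 y.1) x.2 y.2, ?_⟩
  filter_upwards [eventually_all.mpr fun i => eventually_all.mpr fun j => h i j,
    self_mem_nhdsWithin] with z hz hz0
  refine (gauge_triMat_iff δ μ _ hBd hz0 _ _ (V := V z) ?_ rfl).mpr ?_
  · rw [hVdef]
    simp only
    rw [Matrix.smul_mul, Matrix.nonsing_inv_mul_cancel_right _ _
      ((Matrix.isUnit_iff_isUnit_det _).mp hBd), smul_smul, ← zpow_add₀ hz0, add_neg_cancel,
      zpow_zero, one_smul]
  · refine blk_ext fun i j => ?_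
    rw [blk_add, blk_add, blk_conjOp A hBu, blk_polyEval, blk_smul]
    exact hz i j

theorem blk_alienInvariant (q : ℂ) {δ : ℕ} (μ : ℤ) (ρ : ℂ → ℂ) (c₀ a : ℂ)
    (U : Fin δ → Matrix (Σ i, Fin (r i)) (Σ j, Fin (s j)) ℂ) (ζ : rootsOfUnity δ ℂ) (i : ι) (j : κ) :
    blk (alienInvariant q μ ρ α β A B c₀ a U ζ) i j =
      blk (alienDer q δ (gradedMat δ μ (Matrix.blockDiagonal' A) (Matrix.blockDiagonal' B))
        (modMat δ μ (Matrix.blockDiagonal' A) (Matrix.blockDiagonal' B) U) c₀ a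
          (((ζ : ℂˣ) : ℂ) * ρ (α i) / ρ (β j))).toBlocks₁₂ i j := by
  ext k l
  simp only [blk, alienInvariant, polePoint, Matrix.of_apply]

/-- The automorphism sending the `q`-Borel invariant to the alien-derivation invariant. -/
theorem exists_alienAutomorphism {q : ℂ} (hq : 1 < ‖q‖) {δ : ℕ} (hδ : 0 < δ) (μ : ℤ)
    {ρ : ℂ → ℂ} (hρ : ∀ x, x ≠ 0 → ρ x ^ δ = x) (hα : ∀ i, α i ≠ 0)
    (hβ : ∀ j, β j ≠ 0) (hA : ∀ i, spectrum ℂ (A i) = {α i}) (hB : ∀ j, spectrum ℂ (B j) = {β j})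
    {a : ℂ} (ha : a ≠ 0) (har : ∀ i j, ∀ n : ℤ, (-a) ^ δ * q ^ n ≠ α i / β j) {c₀ : ℂ}
    (hc₀ : c₀ ≠ 0) (hcr₀ : ∀ i j, ∀ n : ℤ, c₀ ^ δ * q ^ n ≠ α i / β j) (hac₀ : a ∉ spiral q (-c₀)) :
    ∃ Φ : (rootsOfUnity δ ℂ → Matrix (Σ i, Fin (r i)) (Σ j, Fin (s j)) ℂ) ≃ₗ[ℂ]
        (rootsOfUnity δ ℂ → Matrix (Σ i, Fin (r i)) (Σ j, Fin (s j)) ℂ),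
      (∀ Y ζ i j, blk (Φ Y ζ) i j =
        thetaMul q δ a (((ζ : ℂˣ) : ℂ) • Lcomp δ ρ α β A B i j) (blk (Y ζ) i j)) ∧
      ∀ U : Fin δ → Matrix (Σ i, Fin (r i)) (Σ j, Fin (s j)) ℂ,
        Φ (borelInvariant q ρ α β A B U) = alienInvariant q μ ρ α β A B c₀ a U := by
  -- The index is specialised to `n = 0`: the weight `(a/(qc))^n` becomes `1` and the coefficients
  -- `t_{n-k}` become those of the `q`-Borel transform.
  have h0 : ∀ ζ : rootsOfUnity δ ℂ, ((ζ : ℂˣ) : ℂ) ^ δ * q ^ (0 : ℤ) = 1 := fun ζ => by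
    have := (mem_rootsOfUnity' δ (ζ : ℂˣ)).mp ζ.2
    simpa using this
  choose H hHu hH hHU using fun (ζ : rootsOfUnity δ ℂ) i j =>
    exists_alienDer_block_eq hq hδ μ hρ hα hβ hA hB ha har hc₀ hcr₀ hac₀ i j (h0 ζ)
  have hK : ∀ (ζ : rootsOfUnity δ ℂ) i j, IsUnit (H ζ i j *
      Ring.inverse ((δ : ℂ) • (((ζ : ℂˣ) : ℂ) • Lcomp δ ρ α β A B i j) ^ (δ - 1))) :=
    fun ζ i j => (hHu ζ i j).mul (isUnit_ring_inverse_smul_pow hδ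
      (isUnit_smul_Lcomp hδ hρ hα hβ hA hB i j (Units.ne_zero _)))
  have hKv : ∀ Y ζ i j, blk (blockEquiv (fun ζ i j => (hK ζ i j).unit) Y ζ) i j = H ζ i j
      (Ring.inverse ((δ : ℂ) • (((ζ : ℂˣ) : ℂ) • Lcomp δ ρ α β A B i j) ^ (δ - 1))
        (blk (Y ζ) i j)) := fun Y ζ i j => by
    rw [blk_blockEquiv, IsUnit.unit_spec, Module.End.mul_apply]
  refine ⟨blockEquiv fun ζ i j => (hK ζ i j).unit, fun Y ζ i j => ?_, fun U => ?_⟩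
  · have : Nonempty (Fin (r i)) := ⟨⟨0, ne_zero_of_spectrum_eq (hA i)⟩⟩
    have : Nonempty (Fin (s j)) := ⟨⟨0, ne_zero_of_spectrum_eq (hB j)⟩⟩
    rw [hKv, thetaMul, holoCalc_eq
      (isNilpotent_smul_Lcomp_sub hδ hρ hα hβ hA hB i j _) (H := H ζ i j)]
    simpa only [zpow_zero, mul_one] using hH ζ i j
  · ext1 ζ
    refine blk_ext fun i j => ?_
    have h1 := hHU ζ i j U
    simp only [zero_sub] at h1
    rw [hKv, blk_borelInvariant q hδ hρ hβ hB, blk_alienInvariant, h1]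

/-- Fix `m` with `t_m ≠ 0`. At the prohibited directions of index `n = m + k` the coefficient of `U
k` is `t_{n-k} = t_m`. The index thus varies with `k`, and no nonvanishing of `t_0, …, t_{-(δ-1)}`
is needed. -/
theorem alienDer_injective {q : ℂ} (hq : 1 < ‖q‖) {δ : ℕ} (hδ : 0 < δ) (μ : ℤ)
    (hα : ∀ i, α i ≠ 0)
    (hβ : ∀ j, β j ≠ 0) (hA : ∀ i, spectrum ℂ (A i) = {α i}) (hB : ∀ j, spectrum ℂ (B j) = {β j})
    {a : ℂ} (ha : a ≠ 0) (har : ∀ i j, ∀ n : ℤ, (-a) ^ δ * q ^ n ≠ α i / β j) {c₀ : ℂ}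
    (hc₀ : c₀ ≠ 0) (hcr₀ : ∀ i j, ∀ n : ℤ, c₀ ^ δ * q ^ n ≠ α i / β j) (hac₀ : a ∉ spiral q (-c₀))
    {U U' : Fin δ → Matrix (Σ i, Fin (r i)) (Σ j, Fin (s j)) ℂ}
    (h : ∀ ξ : ℂ, ξ ≠ 0 →
      ¬ NonResonant q δ μ (Matrix.blockDiagonal' A) (Matrix.blockDiagonal' B) ξ →
      alienDer q δ (gradedMat δ μ (Matrix.blockDiagonal' A) (Matrix.blockDiagonal' B))
          (modMat δ μ (Matrix.blockDiagonal' A) (Matrix.blockDiagonal' B) U) c₀ a ξ =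
        alienDer q δ (gradedMat δ μ (Matrix.blockDiagonal' A) (Matrix.blockDiagonal' B))
          (modMat δ μ (Matrix.blockDiagonal' A) (Matrix.blockDiagonal' B) U') c₀ a ξ) : U = U' := by
  have hq0 := ne_zero_of_one_lt_norm hq
  -- An auxiliary choice of roots: the alien derivations do not depend on it, it only parametrises
  -- the prohibited directions.
  choose! ρ hρ using fun (x : ℂ) (_ : x ≠ 0) => IsAlgClosed.exists_pow_nat_eq x hδ
  have hρ0 : ∀ x, x ≠ 0 → ρ x ≠ 0 := fun x hx h => hx (by rw [← hρ x hx, h, zero_pow hδ.ne'])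
  have hLu : ∀ i j, ∀ w : ℂ, w ≠ 0 → IsUnit (w • Lcomp δ ρ α β A B i j) := fun i j w hw =>
    isUnit_smul_Lcomp hδ hρ hα hβ hA hB i j hw
  obtain ⟨m, hm⟩ := exists_thetaPowCoeff_ne_zero hq δ
  ext1 k
  rw [← sub_eq_zero]
  refine blk_ext fun i j => ?_
  have h1 := thetaPowCoeff_smul_eq_zero hq0 hδ (by simpa using hLu i j 1 one_ne_zero) (m + k)
    (D := fun l => thetaPowCoeff q δ (m + k - l) • blk (U l - U' l) i j) (fun w hw => ?_) k
  · rw [add_sub_cancel_right] at h1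
    exact (smul_eq_zero.mp h1).resolve_left hm
  · have hw0 : w ≠ 0 := fun h => by simp [h, hδ.ne'] at hw
    obtain ⟨H, hHu, -, hHU⟩ :=
      exists_alienDer_block_eq hq hδ μ hρ hα hβ hA hB ha har hc₀ hcr₀ hac₀ i j hw
    have hξ : w * ρ (α i) / ρ (β j) ≠ 0 :=
      div_ne_zero (mul_ne_zero hw0 (hρ0 _ (hα i))) (hρ0 _ (hβ j))
    have h2 := congrArg (fun X => blk (Matrix.toBlocks₁₂ X) i j) (h _ hξ fun hn =>
      (nonResonant_blockDiagonal'_iff hq0 δ μ hβ hA hB hξ).mp hn i j (m + k) (by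
        rw [div_pow, mul_pow, hρ _ (hα i), hρ _ (hβ j), div_mul_eq_mul_div, mul_right_comm, hw,
          one_mul]))
    rw [hHU, hHU] at h2
    have h3 := injective_of_isUnit (isUnit_ring_inverse_smul_pow hδ (hLu i j w hw0))
      (injective_of_isUnit hHu h2)
    simp only [blk_sub, smul_sub, map_sub, Finset.sum_sub_distrib]
    rw [sub_eq_zero]
    exact h3

theorem borelInvariant_injective {q : ℂ} {δ : ℕ} (hq : q ≠ 0) (hδ : 0 < δ)
    {ρ : ℂ → ℂ} (hρ : ∀ x, x ≠ 0 → ρ x ^ δ = x) (hα : ∀ i, α i ≠ 0)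
    (hβ : ∀ j, β j ≠ 0) (hA : ∀ i, spectrum ℂ (A i) = {α i}) (hB : ∀ j, spectrum ℂ (B j) = {β j})
    (ht : ∀ k : Fin δ, thetaPowCoeff q δ (-((k : ℕ) : ℤ)) ≠ 0) :
    Function.Injective (borelInvariant (δ := δ) q ρ α β A B) := by
  intro U U' h
  ext1 k
  rw [← sub_eq_zero]
  refine blk_ext fun i j => ?_
  have h2 := thetaPowCoeff_smul_eq_zero hq hδ
    (by simpa using isUnit_smul_Lcomp hδ hρ hα hβ hA hB i j one_ne_zero) 0
    (D := fun l => thetaPowCoeff q δ (-((l : ℕ) : ℤ)) • blk (U l - U' l) i j) (fun w hw => ?_) k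
  · exact (smul_eq_zero.mp h2).resolve_left (ht k)
  · rw [zpow_zero, mul_one] at hw
    have : NeZero δ := ⟨hδ.ne'⟩
    have h3 := congrArg (fun X => blk X i j) (congrFun h (rootsOfUnity.mkOfPowEq w hw))
    rw [blk_borelInvariant q hδ hρ hβ hB, blk_borelInvariant q hδ hρ hβ hB,
      rootsOfUnity.coe_mkOfPowEq] at h3
    simp only [blk_sub, smul_sub, map_sub, Finset.sum_sub_distrib]
    rw [sub_eq_zero]
    exact h3

end Classification

end QAlien

open QAlien Filter Topology
-- Assembly of the theorem.
theorem mainTheorem6 {ι κ : Type*} [Fintype ι] [DecidableEq ι] [Fintype κ] [DecidableEq κ]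
    (q : ℂ) (hq : 1 < ‖q‖) (δ : ℕ) (hδ : 0 < δ) (μ : ℤ) (r : ι → ℕ) (s : κ → ℕ)
    (A : ∀ i, Matrix (Fin (r i)) (Fin (r i)) ℂ) (B : ∀ j, Matrix (Fin (s j)) (Fin (s j)) ℂ)
    (α : ι → ℂ) (β : κ → ℂ) (hα : ∀ i, α i ≠ 0) (hβ : ∀ j, β j ≠ 0)
    (hA : ∀ i, spectrum ℂ (A i) = {α i}) (hB : ∀ j, spectrum ℂ (B j) = {β j})
    (ρ : ℂ → ℂ) (hρ : ∀ x, x ≠ 0 → ρ x ^ δ = x)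
    (a : ℂ) (ha : a ≠ 0)
    (ha_res : NonResonant q δ μ (Matrix.blockDiagonal' A) (Matrix.blockDiagonal' B) (-a))
    (c₀ : ℂ) (hc₀ : c₀ ≠ 0)
    (hc₀_res : NonResonant q δ μ (Matrix.blockDiagonal' A) (Matrix.blockDiagonal' B) c₀)
    (hac₀ : a ∉ spiral q (-c₀)) :
    -- the sums in the non-prohibited directions are well defined
    (∀ (U : Fin δ → Matrix (Σ i, Fin (r i)) (Σ j, Fin (s j)) ℂ) (c : ℂ), c ≠ 0 →
      NonResonant q δ μ (Matrix.blockDiagonal' A) (Matrix.blockDiagonal' B) c →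
      ∃ F, IsSummation q δ
          (gradedMat δ μ (Matrix.blockDiagonal' A) (Matrix.blockDiagonal' B))
          (modMat δ μ (Matrix.blockDiagonal' A) (Matrix.blockDiagonal' B) U) c F ∧
        ∀ F', IsSummation q δ
            (gradedMat δ μ (Matrix.blockDiagonal' A) (Matrix.blockDiagonal' B))
            (modMat δ μ (Matrix.blockDiagonal' A) (Matrix.blockDiagonal' B) U) c F' →
          ∀ z, z ≠ 0 → z ∉ spiral q (-c) → F' z = F z) ∧
    -- the logarithm of the Stokes operator is meromorphic, so that its residues make sense
    (∀ (U : Fin δ → Matrix (Σ i, Fin (r i)) (Σ j, Fin (s j)) ℂ) (ξ : ℂ),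
      ξ ≠ 0 → a ∉ spiral q (-ξ) → ∀ x y, MeromorphicAt (fun c => logStokes q δ
        (gradedMat δ μ (Matrix.blockDiagonal' A) (Matrix.blockDiagonal' B))
        (modMat δ μ (Matrix.blockDiagonal' A) (Matrix.blockDiagonal' B) U) c₀ a c x y) ξ) ∧
    -- the automorphism, and its action on the invariants
    (∃ Φ : (rootsOfUnity δ ℂ → Matrix (Σ i, Fin (r i)) (Σ j, Fin (s j)) ℂ) ≃ₗ[ℂ]
        (rootsOfUnity δ ℂ → Matrix (Σ i, Fin (r i)) (Σ j, Fin (s j)) ℂ),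
      (∀ Y ζ i j, blk (Φ Y ζ) i j =
        thetaMul q δ a (((ζ : ℂˣ) : ℂ) • Lcomp δ ρ α β A B i j) (blk (Y ζ) i j)) ∧
      ∀ U : Fin δ → Matrix (Σ i, Fin (r i)) (Σ j, Fin (s j)) ℂ,
        Φ (borelInvariant q ρ α β A B U) = alienInvariant q μ ρ α β A B c₀ a U) ∧
    -- every module in the formal class has a polynomial normal form
    (∀ W : ℂ → Matrix (Σ i, Fin (r i)) (Σ j, Fin (s j)) ℂ,
      (∀ x y, MeromorphicAt (fun z => W z x y) 0) →
      ∃ U : Fin δ → Matrix (Σ i, Fin (r i)) (Σ j, Fin (s j)) ℂ,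
        AnalyticEquiv q (triMat δ μ (Matrix.blockDiagonal' A) (Matrix.blockDiagonal' B) W)
          (modMat δ μ (Matrix.blockDiagonal' A) (Matrix.blockDiagonal' B) U)) ∧
    -- the alien derivations at the prohibited directions are a complete set of analytic invariants
    (∀ U U' : Fin δ → Matrix (Σ i, Fin (r i)) (Σ j, Fin (s j)) ℂ,
      AnalyticEquiv q (modMat δ μ (Matrix.blockDiagonal' A) (Matrix.blockDiagonal' B) U)
          (modMat δ μ (Matrix.blockDiagonal' A) (Matrix.blockDiagonal' B) U') ↔
        ∀ ξ : ℂ, ξ ≠ 0 →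
          ¬ NonResonant q δ μ (Matrix.blockDiagonal' A) (Matrix.blockDiagonal' B) ξ →
          alienDer q δ (gradedMat δ μ (Matrix.blockDiagonal' A) (Matrix.blockDiagonal' B))
              (modMat δ μ (Matrix.blockDiagonal' A) (Matrix.blockDiagonal' B) U) c₀ a ξ =
            alienDer q δ (gradedMat δ μ (Matrix.blockDiagonal' A) (Matrix.blockDiagonal' B))
              (modMat δ μ (Matrix.blockDiagonal' A) (Matrix.blockDiagonal' B) U') c₀ a ξ) ∧
    -- those at the `δ`-th roots of the `α i / β j` suffice when the `q`-Borel transform is injective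
    ((∀ k : Fin δ, thetaPowCoeff q δ (-((k : ℕ) : ℤ)) ≠ 0) →
      ∀ U U' : Fin δ → Matrix (Σ i, Fin (r i)) (Σ j, Fin (s j)) ℂ,
        AnalyticEquiv q (modMat δ μ (Matrix.blockDiagonal' A) (Matrix.blockDiagonal' B) U)
            (modMat δ μ (Matrix.blockDiagonal' A) (Matrix.blockDiagonal' B) U') ↔
          alienInvariant q μ ρ α β A B c₀ a U = alienInvariant q μ ρ α β A B c₀ a U') := by
  have nr : ∀ {c : ℂ}, c ≠ 0 → (NonResonant q δ μ (Matrix.blockDiagonal' A)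
      (Matrix.blockDiagonal' B) c ↔ ∀ i j, ∀ n : ℤ, c ^ δ * q ^ n ≠ α i / β j) := fun hc =>
    nonResonant_blockDiagonal'_iff (ne_zero_of_one_lt_norm hq) δ μ hβ hA hB hc
  have har := (nr (neg_ne_zero.mpr ha)).mp ha_res
  have hcr₀ := (nr hc₀).mp hc₀_res
  have hΦ := exists_alienAutomorphism hq hδ μ hρ hα hβ hA hB ha har hc₀ hcr₀ hac₀
  refine ⟨fun U c hc hcr => ?_, fun U ξ hξ haξ x y => ?_, hΦ, fun W hW => ?_, fun U U' => ?_,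
    fun ht U U' => ?_⟩
  · have hcr' := (nr hc).mp hcr
    have h := isSummation_matSol hq μ hα hβ hA hB U hc hcr'
    exact ⟨_, h, fun F' hF' z hz hzc => h.unique hq hβ hA hB hc hcr' hF' hz hzc⟩
  · exact meromorphicAt_logStokes hq hδ μ hα hβ hA hB U ha hc₀ hcr₀ hac₀ hξ haξ x y
  · exact exists_analyticEquiv_modMat hq hδ μ hα hβ hA hB hW
  · rw [analyticEquiv_modMat_iff hq hδ μ hα hβ hA hB]
    exact ⟨fun h ξ _ _ => by rw [h],
      alienDer_injective hq hδ μ hα hβ hA hB ha har hc₀ hcr₀ hac₀⟩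
  · rw [analyticEquiv_modMat_iff hq hδ μ hα hβ hA hB]
    refine ⟨fun h => by rw [h], fun h => ?_⟩
    obtain ⟨Φ, -, hΦU⟩ := hΦ
    -- Equality of the alien invariants is transported back through the automorphism to equality of
    -- the `q`-Borel invariants.
    rw [← hΦU, ← hΦU] at h
    exact borelInvariant_injective (ne_zero_of_one_lt_norm hq) hδ hρ hα hβ hA hB ht
      (Φ.injective h)
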